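/- \textbf{Notation.} Let $N\ge 1$ and $p\ge 1$. For $z\in\mathbb C^m$ ($m=1$ or $m=N$) put $|z|_p=\big(|(\Re z_1,\dots,\Re z_m)|^p+|(\Im z_1,\dots,\Im z_m)|^p\big)^{1/p}$, where $|\cdot|$ is the Euclidean norm, and let $$Q_{p,N}=\frac1p\int_{\mathbb S^{N-1}}|\boldsymbol\omega\cdot h|^p\,d\mathcal H^{N-1}(h),$$ where $\boldsymbol\omega\in\mathbb R^N$ is an arbitrary unit vector. Let $A:\mathbb R^N\to\mathbb R^N$ and let $\Omega\subset\mathbb R^N$ be open. For $u\in L^1(\Omega,\mathbb C)$ and $U\subset\Omega$ open put $$C_{1,A,u}(U)=\sup_\varphi\int_U \Re u\,\operatorname{div}\varphi-(A\cdot\varphi)\,\Im u\,dx,\qquad C_{2,A,u}(U)=\sup_\varphi\int_U \Im u\,\operatorname{div}\varphi+(A\cdot\varphi)\,\Re u\,dx,$$ the suprema being over $\varphi\in C_c^\infty(U,\mathbb R^N)$ with $\|\varphi\|_{L^\infty}\le1$. Put $|Du|_A(U)=C_{1,A,u}(U)+C_{2,A,u}(U)$ and, for Borel sets $E\subset\Omega$,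 $|Du|_A(E)=\inf_{U} C_{1,A,u}(U)+\inf_U C_{2,A,u}(U)$, the infima being over the open sets $U$ with $E\subset U\subset\Omega$. The real vector space $BV_A(\Omega)$ consists of the $u\in L^1(\Omega,\mathbb C)$ with $|Du|_A(\Omega)<\infty$; its norm is $\int_\Omega|u|_1\,dx+|Du|_A(\Omega)$. The open set $\Omega$ is an \emph{extension domain} (for $A$) if $\partial\Omega$ is bounded and for every open set $W\supset\overline\Omega$ there is a linear and continuous extension operator $E:BV_A(\Omega)\to BV_A(\mathbb R^N)$ such that, for every $u\in BV_A(\Omega)$, $Eu=0$ almost everywhere in $\mathbb R^N\setminus W$ and $|DEu|_A(\partial\Omega)=0$. The space $W^{1,p}_A(\Omega)$ consists of the $u\in L^p(\Omega,\mathbb C)$ that have a weak gradient $\nabla u\in L^1_{\rm loc}(\Omega,\mathbb C^N)$ with $\int_\Omega|\nabla u-iA(x)u|_p^p\,dx<\infty$. \textbf{Theorem (General magnetic Bourgain--Brezis--Mironescu limit).} Let $A:\mathbb R^N\to\mathbb R^N$ be of class $C^2$. (i) For every bounded extension domain $\Omega\subset\mathbb R^N$ and every $u\in BV_A(\Omega)$,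 $$\lim_{s\nearrow1}(1-s)\int_\Omega\int_\Omega\frac{\big|u(x)-e^{i(x-y)\cdot A(\frac{x+y}2)}u(y)\big|_1}{|x-y|^{N+s}}\,dx\,dy=Q_{1,N}\,|Du|_A(\Omega).$$ (ii) For every $p\ge1$, every bounded open set $\Omega\subset\mathbb R^N$ with Lipschitz boundary and every $u\in W^{1,p}_A(\Omega)$, $$\lim_{s\nearrow1}(1-s)\int_\Omega\int_\Omega\frac{\big|u(x)-e^{i(x-y)\cdot A(\frac{x+y}2)}u(y)\big|_p^p}{|x-y|^{N+ps}}\,dx\,dy=Q_{p,N}\int_\Omega|\nabla u-iA(x)u|_p^p\,dx.$$ -/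

import Mathlib

open Filter MeasureTheory Set Topology
open scoped ContDiff ENNReal NNReal

namespace MagneticBBM

noncomputable section

/-- The Euclidean space `ℝ^N`. -/
abbrev Euc (N : ℕ) : Type := EuclideanSpace ℝ (Fin N)

/-- The norm `|z|_p = (|Re z|^p + |Im z|^p)^(1/p)` of a complex number. -/
def pNorm (p : ℝ) (z : ℂ) : ℝ :=
  (|z.re| ^ p + |z.im| ^ p) ^ (1 / p)

/-- The norm `|z|_p = (|(Re z_1, …, Re z_N)|^p + |(Im z_1, …, Im z_N)|^p)^(1/p)` on `ℂ^N`,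
where `|·|` is the Euclidean norm of `ℝ^N`. -/
def pNormVec {N : ℕ} (p : ℝ) (z : EuclideanSpace ℂ (Fin N)) : ℝ :=
  (‖(WithLp.toLp 2 (fun i => (z i).re) : Euc N)‖ ^ p +
    ‖(WithLp.toLp 2 (fun i => (z i).im) : Euc N)‖ ^ p) ^ (1 / p)

/-- The constant `Q_{p,N} = (1/p) ∫_{S^{N-1}} |e · h|^p dH^{N-1}(h)`, written with the unit
vector `e` that is used to compute it. `Measure.toSphere volume` is the surface measure of the
unit sphere (for `N = 1`, the counting measure on the two points of the sphere). -/
def bbmConst {N : ℕ} (p : ℝ) (e : Euc N) : ℝ :=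
  (1 / p) * ∫ h : Metric.sphere (0 : Euc N) 1, |inner ℝ e (h : Euc N)| ^ p
    ∂((volume : Measure (Euc N)).toSphere)

/-- The `p`-th power of the magnetic Gagliardo seminorm,
`∫_Ω ∫_Ω |u(x) - exp(i (x - y) · A((x + y)/2)) u(y)|_p^p / |x - y|^(N + p s) dx dy`. -/
def gagliardo {N : ℕ} (A : Euc N → Euc N) (p s : ℝ) (Ω : Set (Euc N)) (u : Euc N → ℂ) : ℝ≥0∞ :=
  ∫⁻ y in Ω, ∫⁻ x in Ω, ENNReal.ofReal
    (pNorm p (u x - Complex.exp (Complex.I *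
        ((inner ℝ (x - y) (A ((1 / 2 : ℝ) • (x + y))) : ℝ) : ℂ)) * u y) ^ p
      / ‖x - y‖ ^ ((N : ℝ) + p * s))

/-! ### Functions of bounded magnetic variation -/

/-- The divergence `∑ i, ∂_i φ_i`. -/
def divergence {N : ℕ} (φ : Euc N → Euc N) (x : Euc N) : ℝ :=
  ∑ i, (fderiv ℝ φ x (EuclideanSpace.single i 1)) i

/-- The test fields `φ ∈ C_c^∞(U, ℝ^N)` with `‖φ‖_∞ ≤ 1`. -/
def testFields {N : ℕ} (U : Set (Euc N)) : Set (Euc N → Euc N) :=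
  {φ | ContDiff ℝ ∞ φ ∧ HasCompactSupport φ ∧ tsupport φ ⊆ U ∧ ∀ x, ‖φ x‖ ≤ 1}

/-- `C_{1,A,u}(U) = sup_φ ∫_U (Re u) div φ - (A · φ) Im u`. The supremum is nonnegative since
`φ = 0` is admissible. -/
def variationRe {N : ℕ} (A : Euc N → Euc N) (u : Euc N → ℂ) (U : Set (Euc N)) : ℝ≥0∞ :=
  ⨆ φ ∈ testFields U, ENNReal.ofReal
    (∫ x in U, ((u x).re * divergence φ x - inner ℝ (A x) (φ x) * (u x).im))

/-- `C_{2,A,u}(U) = sup_φ ∫_U (Im u) div φ + (A · φ) Re u`. -/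
def variationIm {N : ℕ} (A : Euc N → Euc N) (u : Euc N → ℂ) (U : Set (Euc N)) : ℝ≥0∞ :=
  ⨆ φ ∈ testFields U, ENNReal.ofReal
    (∫ x in U, ((u x).im * divergence φ x + inner ℝ (A x) (φ x) * (u x).re))

/-- The magnetic variation `|Du|_A(U) = C_{1,A,u}(U) + C_{2,A,u}(U)` of an open set `U`. -/
def variation {N : ℕ} (A : Euc N → Euc N) (u : Euc N → ℂ) (U : Set (Euc N)) : ℝ≥0∞ :=
  variationRe A u U + variationIm A u U

/-- The magnetic variation measure `|Du|_A(E)` of a (Borel) set `E ⊆ Ω`, defined from the values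
on open sets by outer regularity. -/
def variationMeas {N : ℕ} (A : Euc N → Euc N) (Ω : Set (Euc N)) (u : Euc N → ℂ)
    (E : Set (Euc N)) : ℝ≥0∞ :=
  (⨅ U ∈ {U : Set (Euc N) | IsOpen U ∧ E ⊆ U ∧ U ⊆ Ω}, variationRe A u U) +
    ⨅ U ∈ {U : Set (Euc N) | IsOpen U ∧ E ⊆ U ∧ U ⊆ Ω}, variationIm A u U

/-- `u ∈ BV_A(Ω)`: `u ∈ L¹(Ω, ℂ)` and `|Du|_A(Ω) < ∞`. -/
def MemBV {N : ℕ} (A : Euc N → Euc N) (Ω : Set (Euc N)) (u : Euc N → ℂ) : Prop :=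
  MemLp u 1 (volume.restrict Ω) ∧ variation A u Ω < ⊤

/-- The norm `‖u‖_{L¹(Ω)} + |Du|_A(Ω)` of `BV_A(Ω)`, with `‖u‖_{L¹(Ω)} = ∫_Ω |u|_1`. -/
def bvNorm {N : ℕ} (A : Euc N → Euc N) (Ω : Set (Euc N)) (u : Euc N → ℂ) : ℝ≥0∞ :=
  (∫⁻ x in Ω, ENNReal.ofReal (pNorm 1 (u x))) + variation A u Ω

/-- `T` is a linear and continuous extension operator `BV_A(Ω) → BV_A(ℝ^N)` between these real
Banach spaces. It is written on functions: the elements of both spaces are functions up to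
equality almost everywhere, so linearity is an identity almost everywhere, and linearity together
with the norm bound shows that `T` respects equality almost everywhere on `Ω`. -/
structure IsExtensionOperator {N : ℕ} (A : Euc N → Euc N) (Ω : Set (Euc N))
    (T : (Euc N → ℂ) → (Euc N → ℂ)) : Prop where
  memBV : ∀ u, MemBV A Ω u → MemBV A univ (T u)
  map_add : ∀ u v, MemBV A Ω u → MemBV A Ω v → T (u + v) =ᵐ[volume] T u + T v
  map_smul : ∀ (c : ℝ) (u), MemBV A Ω u → T (c • u) =ᵐ[volume] c • T u
  bounded : ∃ C : ℝ≥0, ∀ u, MemBV A Ω u → bvNorm A univ (T u) ≤ C * bvNorm A Ω u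
  extends_ae : ∀ u, MemBV A Ω u → ∀ᵐ x ∂(volume.restrict Ω), T u x = u x

/-- Extension domains (with respect to `A`): open sets with bounded boundary such that for every
open `W ⊇ closure Ω` there is an extension operator `T : BV_A(Ω) → BV_A(ℝ^N)` with `T u = 0`
almost everywhere outside `W` and `|D(T u)|_A(∂Ω) = 0` for all `u`. -/
def IsExtensionDomain {N : ℕ} (A : Euc N → Euc N) (Ω : Set (Euc N)) : Prop :=
  IsOpen Ω ∧ Bornology.IsBounded (frontier Ω) ∧
    ∀ W : Set (Euc N), IsOpen W → closure Ω ⊆ W →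
      ∃ T : (Euc N → ℂ) → (Euc N → ℂ), IsExtensionOperator A Ω T ∧
        ∀ u, MemBV A Ω u →
          (∀ᵐ x ∂(volume.restrict Wᶜ), T u x = 0) ∧
          variationMeas A univ (T u) (frontier Ω) = 0

/-! ### Magnetic Sobolev spaces -/

/-- `g = ∇u` weakly on `Ω`: `u` and `g` are locally integrable on `Ω` and
`∫_Ω u ∂_i φ = - ∫_Ω g_i φ` for all `φ ∈ C_c^∞(Ω)` and all `i`. -/
def HasWeakGradient {N : ℕ} (Ω : Set (Euc N)) (u : Euc N → ℂ)
    (g : Euc N → EuclideanSpace ℂ (Fin N)) : Prop :=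
  LocallyIntegrableOn u Ω volume ∧ LocallyIntegrableOn g Ω volume ∧
    ∀ φ : Euc N → ℝ, ContDiff ℝ ∞ φ → HasCompactSupport φ → tsupport φ ⊆ Ω →
      ∀ i : Fin N,
        ∫ x in Ω, u x * ((fderiv ℝ φ x (EuclideanSpace.single i 1) : ℝ) : ℂ) =
          -∫ x in Ω, g x i * ((φ x : ℝ) : ℂ)

/-- The magnetic gradient `∇u - i A u`, where `g` stands for `∇u`. -/
def magGrad {N : ℕ} (A : Euc N → Euc N) (u : Euc N → ℂ) (g : Euc N → EuclideanSpace ℂ (Fin N))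
    (x : Euc N) : EuclideanSpace ℂ (Fin N) :=
  WithLp.toLp 2 (fun i => g x i - Complex.I * ((A x i : ℝ) : ℂ) * u x)

/-- The energy `∫_Ω |∇u - i A u|_p^p dx`, where `g` stands for `∇u`. -/
def magEnergy {N : ℕ} (A : Euc N → Euc N) (p : ℝ) (Ω : Set (Euc N)) (u : Euc N → ℂ)
    (g : Euc N → EuclideanSpace ℂ (Fin N)) : ℝ≥0∞ :=
  ∫⁻ x in Ω, ENNReal.ofReal (pNormVec p (magGrad A u g x) ^ p)

/-- `u ∈ W^{1,p}_A(Ω)`: `u ∈ L^p(Ω, ℂ)` has a weak gradient `g` on `Ω` and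
`∫_Ω |g - i A u|_p^p < ∞`. -/
def MemMagSobolev {N : ℕ} (A : Euc N → Euc N) (p : ℝ) (Ω : Set (Euc N)) (u : Euc N → ℂ) : Prop :=
  MemLp u (ENNReal.ofReal p) (volume.restrict Ω) ∧
    ∃ g : Euc N → EuclideanSpace ℂ (Fin N), HasWeakGradient Ω u g ∧ magEnergy A p Ω u g < ⊤

/-- `Ω` has Lipschitz boundary: near every boundary point and in suitable Cartesian coordinates
(with last coordinate direction `e`), `Ω` is the set of points strictly above the graph of a
Lipschitz function of the orthogonal projection `y - ⟨e, y⟩ e` of `y` to the hyperplane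
orthogonal to `e`. -/
def HasLipschitzBoundary {N : ℕ} (Ω : Set (Euc N)) : Prop :=
  ∀ x₀ ∈ frontier Ω, ∃ r : ℝ, 0 < r ∧ ∃ e : Euc N, ‖e‖ = 1 ∧
    ∃ (γ : Euc N → ℝ) (K : ℝ≥0), LipschitzWith K γ ∧
      ∀ y ∈ Metric.ball x₀ r, y ∈ Ω ↔ γ (y - (inner ℝ e y : ℝ) • e) < inner ℝ e y

end

end MagneticBBM

/-! ### Translations in L^p and an integral Minkowski inequality. -/

namespace MagneticBBM

/-! Substituting h = x - y = rθ writes the seminorm as the integral over r > 0 of r^(p(1-s)-1) B(r),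
where B(r) is the p-th power of the L^p norm on S^(N-1) × Ω of the difference quotient at scale r,
cut off when the second point leaves Ω (`lintegral_gagliardo_eq_radial`). The kernels (1-s)
r^(p(1-s)-1) concentrate at 0 with total mass 1/p, so the limit is B(0+)/p (`tendsto_radial`).
Everything reduces to the behaviour of the quotients as r → 0.

The p-th power of |·|_p splits into real and imaginary parts. On a bounded set the phase is 1 + i
A(y)·h + o(|h|) uniformly, because A is uniformly continuous there; hence each part of the magnetic
increment is, up to o(r) in L^p, the increment v(y+h) - v(y) + ⟨f(y), h⟩ with (v, f) = (Re u, (Im u)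
A) or (Im u, -(Re u) A) (`tendsto_component`). This is a real, nonmagnetic problem for the
distribution Dv + f.

Sobolev case. With g = ∇v extended by zero, the remainder v(x+h) - v(x) - ⟨g(x), h⟩ is o(|h|) in
L^p. Where the segment from x to x+h stays in Ω this follows from the fundamental theorem of
calculus and continuity of translations in L^p. Elsewhere the Lipschitz boundary provides an inward
detour of length comparable to |h| (`exists_detour_of_mem_closure`), so no extension of u is needed.
The quotients then converge to ⟨g + f, θ⟩, and integrating |⟨a, θ⟩|^p over the sphere gives p
Q_{p,N} |a|^p.

BV case. From above, mollification turns the increments on Ω into integrals of |⟨∇v_ρ + f_ρ, θ⟩|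
over a compact neighbourhood of the closure, which after integration in θ are controlled by the
variation on any open O containing the closure (`eventually_radialQuot_bvDiff_le`). The extension
charges ∂Ω with zero variation, so the variation on a suitable O exceeds that on Ω by arbitrarily
little (`bvVar_union_le`). From below, a test field supported in Ω is fixed, the function is
mollified at a fixed scale, and Fatou's lemma is applied as r → 0
(`eventually_lt_radialQuot_bvDiff`). -/

theorem tendsto_eLpNorm_translate_sub {N : ℕ} {F : Type*} [NormedAddCommGroup F] {p : ℝ≥0∞}
    (hp1 : 1 ≤ p) (hp : p ≠ ⊤) {f : Euc N → F} (hf : MemLp f p volume) :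
    Tendsto (fun h : Euc N => eLpNorm (fun x => f (x + h) - f x) p volume) (𝓝 0) (𝓝 0) := by
  have : Fact (1 ≤ p) := ⟨hp1⟩
  let g : Euc N → C(Euc N, Euc N) := fun h => ⟨fun x => x + h, by fun_prop⟩
  have hg : Continuous g := by
    have : Continuous (fun q : Euc N × Euc N => q.2 + q.1) := by fun_prop
    exact (ContinuousMap.curry ⟨_, this⟩).continuous
  have hgm : ∀ h, MeasurePreserving (g h) volume volume := fun h =>
    measurePreserving_add_right volume h
  have key := (continuous_const (y := hf.toLp f)).compMeasurePreservingLp hg hgm hp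
  have h0 := key.tendsto 0
  rw [tendsto_iff_edist_tendsto_0] at h0
  refine h0.congr fun h => ?_
  rw [Lp.edist_def]
  refine eLpNorm_congr_ae ?_
  have e1 := Lp.coeFn_compMeasurePreserving (hf.toLp f) (hgm h)
  have e2 := Lp.coeFn_compMeasurePreserving (hf.toLp f) (hgm 0)
  have e3 := hf.coeFn_toLp
  have e4 := (hgm h).quasiMeasurePreserving.ae_eq_comp e3
  filter_upwards [e1, e2, e3, e4, (hgm 0).quasiMeasurePreserving.ae_eq_comp e3] with x h1 h2 h3 h4 h5
  simp only [Pi.sub_apply, h1, h2, h4, h5]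
  simp [g]

/-- Since ν is a probability measure, the norm of the average is at most the L^p(ν) norm of k(x, ·);
Tonelli then exchanges the two integrals of the p-th power. -/
theorem eLpNorm_integral_le_of_forall {X T F : Type*} [MeasurableSpace X] [MeasurableSpace T]
    [NormedAddCommGroup F] [NormedSpace ℝ F] {μ : Measure X} {ν : Measure T} [SFinite μ]
    [IsProbabilityMeasure ν] {p : ℝ≥0∞} (hp1 : 1 ≤ p) (hp : p ≠ ⊤) {k : X → T → F} {C : ℝ≥0∞}
    (hk : AEStronglyMeasurable (Function.uncurry k) (μ.prod ν))
    (hC : ∀ᵐ t ∂ν, eLpNorm (fun x => k x t) p μ ≤ C) :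
    eLpNorm (fun x => ∫ t, k x t ∂ν) p μ ≤ C := by
  have hp0 : p ≠ 0 := (one_pos.trans_le hp1).ne'
  have hpr : 0 < p.toReal := ENNReal.toReal_pos hp0 hp
  rw [eLpNorm_eq_lintegral_rpow_enorm_toReal hp0 hp]
  rw [one_div, ENNReal.rpow_inv_le_iff hpr]
  calc ∫⁻ x, ‖∫ t, k x t ∂ν‖ₑ ^ p.toReal ∂μ
      ≤ ∫⁻ x, ∫⁻ t, ‖k x t‖ₑ ^ p.toReal ∂ν ∂μ := by
        refine lintegral_mono_ae ?_
        filter_upwards [hk.prodMk_left] with x hx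
        have h1 : ‖∫ t, k x t ∂ν‖ₑ ≤ eLpNorm (k x) p ν := by
          refine (enorm_integral_le_lintegral_enorm _).trans ?_
          rw [← eLpNorm_one_eq_lintegral_enorm]
          exact eLpNorm_le_eLpNorm_of_exponent_le hp1 hx
        rw [eLpNorm_eq_lintegral_rpow_enorm_toReal hp0 hp, one_div,
          ENNReal.le_rpow_inv_iff hpr] at h1
        exact h1
    _ = ∫⁻ t, ∫⁻ x, ‖k x t‖ₑ ^ p.toReal ∂μ ∂ν :=
        lintegral_lintegral_swap (hk.enorm.pow_const _)
    _ ≤ ∫⁻ t, C ^ p.toReal ∂ν := by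
        refine lintegral_mono_ae ?_
        filter_upwards [hC] with t ht
        rw [eLpNorm_eq_lintegral_rpow_enorm_toReal hp0 hp, one_div,
          ENNReal.rpow_inv_le_iff hpr] at ht
        exact ht
    _ = C ^ p.toReal := by simp

/-! ### Polar coordinates and the sphere integral of |⟨a, θ⟩|^p. -/

section Polar
variable {N : ℕ}

theorem lintegral_polar (hN : N ≠ 0) {f : Euc N → ℝ≥0∞} (hf : Measurable f) :
    ∫⁻ x, f x = ∫⁻ r in Ioi (0 : ℝ), ENNReal.ofReal (r ^ (N - 1)) *
      ∫⁻ θ : Metric.sphere (0 : Euc N) 1, f (r • (θ : Euc N)) ∂(volume : Measure (Euc N)).toSphere := by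
  have : Nonempty (Fin N) := ⟨⟨0, Nat.pos_of_ne_zero hN⟩⟩
  have : Nontrivial (Euc N) := inferInstance
  have hmp := Measure.measurePreserving_homeomorphUnitSphereProd (volume : Measure (Euc N))
  have hmp' := hmp.symm (homeomorphUnitSphereProd (Euc N)).toMeasurableEquiv
  have h1 : ∫⁻ x, f x = ∫⁻ x : ({0}ᶜ : Set (Euc N)), f x.1 ∂(volume.comap Subtype.val) := by
    rw [lintegral_subtype_comap (measurableSet_singleton _).compl, restrict_compl_singleton]
  have h2 := hmp'.lintegral_comp (f := fun x => f x.1) (hf.comp measurable_subtype_coe)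
  rw [h1, ← h2, lintegral_prod_symm]
  swap
  · exact ((hf.comp measurable_subtype_coe).comp hmp'.measurable).aemeasurable
  have hdim : Module.finrank ℝ (Euc N) = N := by simp
  rw [Measure.volumeIoiPow, lintegral_withDensity_eq_lintegral_mul]
  · rw [hdim]
    have := lintegral_subtype_comap (μ := volume) (measurableSet_Ioi (a := (0:ℝ)))
      (fun r : ℝ => ENNReal.ofReal (r ^ (N - 1)) *
      ∫⁻ θ : Metric.sphere (0 : Euc N) 1, f (r • (θ : Euc N)) ∂(volume : Measure (Euc N)).toSphere)
    rw [← this]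
    rfl
  · fun_prop
  · exact Measurable.lintegral_prod_left' ((hf.comp measurable_subtype_coe).comp hmp'.measurable)

/-- Expresses the sphere integral through a Lebesgue integral over a ball, where invariance under
linear isometries is available. -/
theorem lintegral_ball_inner_rpow (hN : N ≠ 0) {p : ℝ} (hp : 1 ≤ p) (a : Euc N) :
    ∫⁻ x in Metric.ball 0 1, ‖(inner ℝ a x : ℝ)‖ₑ ^ p =
      (∫⁻ r in Ioi (0 : ℝ), ENNReal.ofReal (r ^ (N - 1)) * (Iio 1).indicator
        (fun r => ENNReal.ofReal r ^ p) r) *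
      ∫⁻ θ : Metric.sphere (0 : Euc N) 1, ‖(inner ℝ a (θ : Euc N) : ℝ)‖ₑ ^ p
        ∂(volume : Measure (Euc N)).toSphere := by
  rw [← lintegral_indicator Metric.isOpen_ball.measurableSet, lintegral_polar hN
    (Measurable.indicator (by fun_prop) Metric.isOpen_ball.measurableSet), ← lintegral_mul_const]
  swap
  · exact Measurable.mul (by fun_prop) (Measurable.indicator (by fun_prop) measurableSet_Iio)
  refine setLIntegral_congr_fun measurableSet_Ioi fun r (hr : 0 < r) => ?_
  beta_reduce
  have hb : MeasurableSet (Metric.ball (0 : Euc N) 1) := Metric.isOpen_ball.measurableSet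
  rw [mul_assoc]
  congr 1
  rw [← lintegral_const_mul _ (by fun_prop)]
  refine lintegral_congr fun θ => ?_
  have hθ : ‖(θ : Euc N)‖ = 1 := by simp
  by_cases h : r < 1
  · rw [indicator_of_mem, indicator_of_mem (by exact h), inner_smul_right, enorm_mul,
      ENNReal.mul_rpow_of_nonneg _ _ (by linarith), Real.enorm_of_nonneg hr.le]
    simpa [norm_smul, hθ, abs_of_pos hr] using h
  · rw [indicator_of_notMem, indicator_of_notMem (by exact h), zero_mul]
    simpa [norm_smul, hθ, abs_of_pos hr] using h

/-- The radial factor c is finite and nonzero, so it cancels, and the two ball integrals agree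
because a linear isometry carries a to b. -/
theorem lintegral_sphere_inner_rpow_of_unit (hN : N ≠ 0) {p : ℝ} (hp : 1 ≤ p) {a b : Euc N}
    (ha : ‖a‖ = 1) (hb : ‖b‖ = 1) :
    ∫⁻ θ : Metric.sphere (0 : Euc N) 1, ‖(inner ℝ a (θ : Euc N) : ℝ)‖ₑ ^ p
        ∂(volume : Measure (Euc N)).toSphere =
      ∫⁻ θ : Metric.sphere (0 : Euc N) 1, ‖(inner ℝ b (θ : Euc N) : ℝ)‖ₑ ^ p
        ∂(volume : Measure (Euc N)).toSphere := by
  set c := ∫⁻ r in Ioi (0 : ℝ), ENNReal.ofReal (r ^ (N - 1)) * (Iio 1).indicator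
        (fun r => ENNReal.ofReal r ^ p) r with hc
  have hc0 : c ≠ 0 := by
    have hm : Measurable fun r : ℝ => ENNReal.ofReal (r ^ (N - 1)) * (Iio 1).indicator
        (fun r => ENNReal.ofReal r ^ p) r :=
      Measurable.mul (by fun_prop) (Measurable.indicator (by fun_prop) measurableSet_Iio)
    rw [hc, ← pos_iff_ne_zero, setLIntegral_pos_iff hm]
    refine lt_of_lt_of_le (b := volume (Ioo (0 : ℝ) 1)) (by simp) (measure_mono ?_)
    rintro r ⟨h0, h1⟩
    refine ⟨?_, h0⟩
    rw [Function.mem_support, indicator_of_mem (by exact h1)]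
    have h3 : ENNReal.ofReal r ≠ 0 := by simpa using h0
    have h2 : ENNReal.ofReal (r ^ (N - 1)) ≠ 0 := by simpa using pow_pos h0 _
    exact mul_ne_zero h2 (by simp [h3])
  have hct : c ≠ ⊤ := by
    refine ne_top_of_le_ne_top (b := volume (Ioo (0 : ℝ) 1)) (by simp) ?_
    rw [← setLIntegral_one, ← lintegral_indicator measurableSet_Ioo, hc,
      ← lintegral_indicator measurableSet_Ioi]
    refine lintegral_mono fun r => ?_
    by_cases h0 : 0 < r
    · rw [indicator_of_mem (by exact h0)]
      by_cases h1 : r < 1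
      · rw [indicator_of_mem (by exact h1), indicator_of_mem (by exact ⟨h0, h1⟩)]
        refine mul_le_one' ?_ ?_
        · rw [ENNReal.ofReal_le_one]; exact pow_le_one₀ h0.le h1.le
        · exact ENNReal.rpow_le_one (ENNReal.ofReal_le_one.2 h1.le) (by linarith)
      · rw [indicator_of_notMem (by exact h1)]; simp
    · rw [indicator_of_notMem (by exact h0)]; simp
  rw [← ENNReal.mul_right_inj hc0 hct, ← lintegral_ball_inner_rpow hN hp,
    ← lintegral_ball_inner_rpow hN hp]
  -- The reflection in the hyperplane orthogonal to a - b exchanges the two unit vectors.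
  set ι := (Submodule.span ℝ {a - b})ᗮ.reflection with hι
  have hab : ι a = b := Submodule.reflection_sub (ha.trans hb.symm)
  have hmp : MeasurePreserving ι volume volume := ι.measurePreserving
  rw [← hmp.setLIntegral_comp_preimage Metric.isOpen_ball.measurableSet
    (f := fun x => ‖(inner ℝ b x : ℝ)‖ₑ ^ p) (by fun_prop)]
  rw [← hab]
  simp only [LinearIsometryEquiv.inner_map_map]
  simp

/-- Homogeneity of degree p in a reduces to unit vectors. The factor p undoes the 1/p in `bbmConst`.
-/
theorem lintegral_sphere_inner_rpow {p : ℝ} (hp : 1 ≤ p) {e : Euc N} (he : ‖e‖ = 1) (a : Euc N) :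
    ∫⁻ θ : Metric.sphere (0 : Euc N) 1, ‖(inner ℝ a (θ : Euc N) : ℝ)‖ₑ ^ p
        ∂(volume : Measure (Euc N)).toSphere =
      ENNReal.ofReal p * ENNReal.ofReal (bbmConst p e) * ‖a‖ₑ ^ p := by
  -- In dimension zero there is no unit vector e.
  have hN : N ≠ 0 := by
    rintro rfl
    simp [Subsingleton.elim e 0] at he
  have hp0 : 0 < p := by linarith
  have h1 : ENNReal.ofReal p * ENNReal.ofReal (bbmConst p e) =
      ∫⁻ θ : Metric.sphere (0 : Euc N) 1, ‖(inner ℝ e (θ : Euc N) : ℝ)‖ₑ ^ p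
        ∂(volume : Measure (Euc N)).toSphere := by
    rw [← ENNReal.ofReal_mul hp0.le, bbmConst, ← mul_assoc, mul_one_div_cancel hp0.ne', one_mul,
      ofReal_integral_eq_lintegral_ofReal]
    · refine lintegral_congr fun θ => ?_
      rw [← ENNReal.ofReal_rpow_of_nonneg (abs_nonneg _) hp0.le, ← Real.norm_eq_abs, ofReal_norm]
    · refine Integrable.of_bound (C := 1) ?_ (ae_of_all _ fun θ => ?_)
      · refine Continuous.aestronglyMeasurable ?_
        exact Continuous.rpow_const (by fun_prop) fun _ => Or.inr hp0.le
      · have hθ : ‖(θ : Euc N)‖ = 1 := by simp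
        have := abs_real_inner_le_norm e (θ : Euc N)
        rw [he, hθ, one_mul] at this
        rw [Real.norm_of_nonneg (by positivity)]
        exact Real.rpow_le_one (abs_nonneg _) this hp0.le
    · exact ae_of_all _ fun θ => by positivity
  rw [h1]
  by_cases ha : a = 0
  · simp [ha, hp0]
  have ha' : ‖a‖ ≠ 0 := by simpa using ha
  have hu : ‖‖a‖⁻¹ • a‖ = 1 := by simp [norm_smul, ha]
  rw [lintegral_sphere_inner_rpow_of_unit hN hp he hu, ← lintegral_mul_const]
  swap
  · fun_prop
  refine lintegral_congr fun θ => ?_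
  rw [← ENNReal.mul_rpow_of_nonneg _ _ hp0.le, inner_smul_left, ← enorm_norm a, ← enorm_mul]
  congr 2
  simp
  field_simp

end Polar

/-! ### Concentration of the radial kernels at the origin. -/

theorem ofReal_mul_lintegral_rpow {p s a b : ℝ} (hp : 1 ≤ p) (hs : s < 1) (ha : 0 ≤ a)
    (hab : a ≤ b) :
    ENNReal.ofReal (1 - s) * ∫⁻ r in Ioc a b, ENNReal.ofReal (r ^ (p * (1 - s) - 1)) =
      ENNReal.ofReal ((b ^ (p * (1 - s)) - a ^ (p * (1 - s))) / p) := by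
  have hq : 0 < p * (1 - s) := mul_pos (by linarith) (by linarith)
  rw [← ofReal_integral_eq_lintegral_ofReal, ← intervalIntegral.integral_of_le hab,
    integral_rpow (Or.inl (by linarith)), ← ENNReal.ofReal_mul (by linarith)]
  · congr 1
    have : 1 - s ≠ 0 := by linarith
    have : p ≠ 0 := by linarith
    simp only [sub_add_cancel]
    field_simp
  · exact (intervalIntegral.intervalIntegrable_rpow' (by linarith)).1
  · filter_upwards [ae_restrict_mem measurableSet_Ioc] with r hr
    exact Real.rpow_nonneg (ha.trans hr.1.le) _

theorem tendsto_rpow_mul_one_sub {a p : ℝ} (ha : 0 < a) :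
    Tendsto (fun s : ℝ => a ^ (p * (1 - s))) (𝓝[<] 1) (𝓝 1) := by
  have : Continuous fun s : ℝ => a ^ (p * (1 - s)) :=
    (Real.continuous_const_rpow ha.ne').comp (by fun_prop)
  simpa using (this.tendsto 1).mono_left nhdsWithin_le_nhds

/-- As s → 1 the kernels put mass 1/p on every (0, δ] and mass tending to 0 on every (δ, b]. Thus
only the limit of B at 0+ matters, provided B is bounded away from 0 and vanishes far out. The lower
bound uses only small r, and L may be infinite. -/
theorem tendsto_radial {p : ℝ} (hp : 1 ≤ p) {B : ℝ → ℝ≥0∞} {L : ℝ≥0∞} {R : ℝ}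
    (hB : Tendsto B (𝓝[>] 0) (𝓝 L)) (hR : ∀ r, R < r → B r = 0)
    (hbd : ∀ δ > 0, ∃ C : ℝ≥0∞, C ≠ ⊤ ∧ ∀ r ≥ δ, B r ≤ C) :
    Tendsto (fun s : ℝ => ENNReal.ofReal (1 - s) *
      ∫⁻ r in Ioi (0 : ℝ), ENNReal.ofReal (r ^ (p * (1 - s) - 1)) * B r) (𝓝[<] 1)
      (𝓝 (L / ENNReal.ofReal p)) := by
  have hp0 : 0 < p := by linarith
  have hpE : ENNReal.ofReal p ≠ 0 := by simpa using hp0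
  have hm : ∀ δ > 0, Tendsto (fun s : ℝ => ENNReal.ofReal (1 - s) *
      ∫⁻ r in Ioc 0 δ, ENNReal.ofReal (r ^ (p * (1 - s) - 1))) (𝓝[<] 1)
      (𝓝 (ENNReal.ofReal p)⁻¹) := by
    intro δ hδ
    have h1 : Tendsto (fun s : ℝ => ENNReal.ofReal (δ ^ (p * (1 - s)) / p)) (𝓝[<] 1)
        (𝓝 (ENNReal.ofReal p)⁻¹) := by
      rw [← ENNReal.ofReal_inv_of_pos hp0, ← one_div]
      exact ENNReal.tendsto_ofReal ((tendsto_rpow_mul_one_sub hδ).div_const p)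
    refine h1.congr' ?_
    filter_upwards [self_mem_nhdsWithin] with s (hs : s < 1)
    rw [ofReal_mul_lintegral_rpow hp hs le_rfl hδ.le, Real.zero_rpow
      (mul_pos hp0 (by linarith)).ne', sub_zero]
  have hm2 : ∀ δ > 0, ∀ b ≥ δ, Tendsto (fun s : ℝ => ENNReal.ofReal (1 - s) *
      ∫⁻ r in Ioc δ b, ENNReal.ofReal (r ^ (p * (1 - s) - 1))) (𝓝[<] 1) (𝓝 0) := by
    intro δ hδ b hb
    have h1 : Tendsto (fun s : ℝ => ENNReal.ofReal ((b ^ (p * (1 - s)) - δ ^ (p * (1 - s))) / p))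
        (𝓝[<] 1) (𝓝 0) := by
      rw [← ENNReal.ofReal_zero, ← zero_div p, ← sub_self (1 : ℝ)]
      exact ENNReal.tendsto_ofReal (((tendsto_rpow_mul_one_sub (hδ.trans_le hb)).sub
        (tendsto_rpow_mul_one_sub hδ)).div_const p)
    refine h1.congr' ?_
    filter_upwards [self_mem_nhdsWithin] with s (hs : s < 1)
    rw [ofReal_mul_lintegral_rpow hp hs hδ.le hb]
  rw [tendsto_order]
  constructor
  · intro a ha
    rw [ENNReal.lt_div_iff_mul_lt (Or.inl hpE) (Or.inl ENNReal.ofReal_ne_top)] at ha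
    obtain ⟨L', h1, h2⟩ := exists_between ha
    have hev := (tendsto_order.1 hB).1 L' h2
    rw [eventually_nhdsWithin_iff, Metric.eventually_nhds_iff] at hev
    obtain ⟨δ, hδ, hev⟩ := hev
    have h3 : Tendsto (fun s : ℝ => (ENNReal.ofReal (1 - s) *
      ∫⁻ r in Ioc 0 (δ / 2), ENNReal.ofReal (r ^ (p * (1 - s) - 1))) * L') (𝓝[<] 1)
      (𝓝 ((ENNReal.ofReal p)⁻¹ * L')) :=
      ENNReal.Tendsto.mul_const (hm (δ / 2) (by linarith)) (Or.inl (by simp))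
    have h4 : a < (ENNReal.ofReal p)⁻¹ * L' := by
      rw [mul_comm, ← div_eq_mul_inv,
        ENNReal.lt_div_iff_mul_lt (Or.inl hpE) (Or.inl ENNReal.ofReal_ne_top)]
      exact h1
    filter_upwards [(tendsto_order.1 h3).1 a h4] with s hs
    refine hs.trans_le ?_
    rw [mul_assoc, ← lintegral_mul_const _ (by fun_prop)]
    gcongr 1
    refine (setLIntegral_mono' measurableSet_Ioc fun r hr => ?_).trans
      (lintegral_mono_set Ioc_subset_Ioi_self)
    gcongr
    refine (hev ?_ hr.1).le
    rw [Real.dist_eq, sub_zero, abs_of_pos hr.1]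
    linarith [hr.2]
  · intro a ha
    rw [gt_iff_lt, ENNReal.div_lt_iff (Or.inl hpE) (Or.inl ENNReal.ofReal_ne_top)] at ha
    obtain ⟨L', h1, h2⟩ := exists_between ha
    have hev := (tendsto_order.1 hB).2 L' h1
    rw [eventually_nhdsWithin_iff, Metric.eventually_nhds_iff] at hev
    obtain ⟨δ, hδ, hev⟩ := hev
    set d := δ / 2
    have hd : 0 < d := by positivity
    obtain ⟨C, hC, hCB⟩ := hbd d hd
    have hb : d ≤ max R d := le_max_right _ _
    have h3 : Tendsto (fun s : ℝ => (ENNReal.ofReal (1 - s) *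
      ∫⁻ r in Ioc 0 d, ENNReal.ofReal (r ^ (p * (1 - s) - 1))) * L' + (ENNReal.ofReal (1 - s) *
      ∫⁻ r in Ioc d (max R d), ENNReal.ofReal (r ^ (p * (1 - s) - 1))) * C) (𝓝[<] 1)
      (𝓝 ((ENNReal.ofReal p)⁻¹ * L' + 0 * C)) :=
      (ENNReal.Tendsto.mul_const (hm d hd) (Or.inl (by simp))).add
        (ENNReal.Tendsto.mul_const (hm2 d hd _ hb) (Or.inr hC))
    have h4 : (ENNReal.ofReal p)⁻¹ * L' + 0 * C < a := by
      rw [zero_mul, add_zero, mul_comm, ← div_eq_mul_inv,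
        ENNReal.div_lt_iff (Or.inl hpE) (Or.inl ENNReal.ofReal_ne_top)]
      exact h2
    filter_upwards [(tendsto_order.1 h3).2 a h4] with s hs
    refine lt_of_le_of_lt ?_ hs
    rw [mul_assoc, ← lintegral_mul_const _ (by fun_prop), mul_assoc,
      ← lintegral_mul_const _ (by fun_prop), ← mul_add]
    gcongr 1
    -- Near 0 the integrand is controlled by L', on the middle range by the constant C, and beyond R
    -- it vanishes.
    have hsplit : Ioi (0 : ℝ) ⊆ (Ioc 0 d ∪ Ioc d (max R d)) ∪ Ioi (max R d) := by
      rw [Ioc_union_Ioc_eq_Ioc hd.le hb, Ioc_union_Ioi_eq_Ioi (hd.le.trans hb)]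
    refine (lintegral_mono_set hsplit).trans <| (lintegral_union_le _ _ _).trans ?_
    have hz : ∫⁻ r in Ioi (max R d), ENNReal.ofReal (r ^ (p * (1 - s) - 1)) * B r = 0 := by
      rw [setLIntegral_congr_fun (g := fun _ => 0) measurableSet_Ioi]
      · simp
      · intro r (hr : max R d < r)
        simp [hR r (lt_of_le_of_lt (le_max_left _ _) hr)]
    rw [hz, add_zero]
    refine (lintegral_union_le _ _ _).trans (add_le_add ?_ ?_)
    · refine setLIntegral_mono' measurableSet_Ioc fun r hr => ?_
      gcongr
      refine (hev ?_ hr.1).le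
      rw [Real.dist_eq, sub_zero, abs_of_pos hr.1]
      have := hr.2
      simp only [d] at this
      linarith
    · refine setLIntegral_mono' measurableSet_Ioc fun r hr => ?_
      gcongr
      exact hCB r hr.1.le


/-! ### Reduction of the seminorm to difference quotients on sphere times domain. -/

section Radial
variable {N : ℕ}

/-- The product of the surface measure of the sphere and Lebesgue measure on `Ω`. -/
noncomputable abbrev polarMeasure (Ω : Set (Euc N)) : Measure (Metric.sphere (0 : Euc N) 1 × Euc N) :=
  (volume : Measure (Euc N)).toSphere.prod (volume.restrict Ω)

open Classical in
/-- The quotient `w(y, rθ) / r`, set to zero when `y + rθ` is outside `Ω`. -/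
noncomputable def radialQuot (Ω : Set (Euc N)) (w : Euc N → Euc N → ℝ) (r : ℝ)
    (z : Metric.sphere (0 : Euc N) 1 × Euc N) : ℝ :=
  if z.2 + r • (z.1 : Euc N) ∈ Ω then r⁻¹ * w z.2 (r • (z.1 : Euc N)) else 0

theorem measurable_radialQuot {Ω : Set (Euc N)} (hΩ : MeasurableSet Ω) {w : Euc N → Euc N → ℝ}
    (hw : Measurable (Function.uncurry w)) (r : ℝ) : Measurable (radialQuot Ω w r) := by
  classical
  refine Measurable.ite ?_ ?_ measurable_const
  · exact measurableSet_preimage (f := fun z : Metric.sphere (0 : Euc N) 1 × Euc N =>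
      z.2 + r • (z.1 : Euc N)) (by fun_prop) hΩ
  · refine measurable_const.mul ?_
    exact hw.comp (g := Function.uncurry w) (f := fun z : Metric.sphere (0 : Euc N) 1 × Euc N =>
      (z.2, r • (z.1 : Euc N))) (by fun_prop)

theorem eLpNorm_rpow_eq {X F : Type*} [MeasurableSpace X] [NormedAddCommGroup F] {μ : Measure X}
    {p : ℝ} (hp : 1 ≤ p) (f : X → F) :
    eLpNorm f (ENNReal.ofReal p) μ ^ p = ∫⁻ x, ‖f x‖ₑ ^ p ∂μ := by
  have hp0 : 0 < p := by linarith
  rw [eLpNorm_eq_lintegral_rpow_enorm_toReal (by simpa using hp0) ENNReal.ofReal_ne_top,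
    ENNReal.toReal_ofReal hp0.le, ← ENNReal.rpow_mul, one_div_mul_cancel hp0.ne', ENNReal.rpow_one]

/-- Here w(y, h) is an increment with base point y and step h = x - y. After Tonelli and polar
coordinates the power of r is r^(N-1) · r^(-N-ps), and the division by r inside `radialQuot`
accounts for a further r^p. -/
theorem lintegral_gagliardo_eq_radial (hN : N ≠ 0) {p : ℝ} (hp : 1 ≤ p) (s : ℝ)
    {Ω : Set (Euc N)} (hΩ : MeasurableSet Ω) {w : Euc N → Euc N → ℝ}
    (hw : Measurable (Function.uncurry w)) :
    ∫⁻ y in Ω, ∫⁻ x in Ω, ENNReal.ofReal (|w y (x - y)| ^ p / ‖x - y‖ ^ ((N : ℝ) + p * s)) =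
      ∫⁻ r in Ioi (0 : ℝ), ENNReal.ofReal (r ^ (p * (1 - s) - 1)) *
        eLpNorm (radialQuot Ω w r) (ENNReal.ofReal p) (polarMeasure Ω) ^ p := by
  classical
  have hp0 : 0 < p := by linarith
  set K : Euc N → Euc N → ℝ≥0∞ := fun y h =>
    Ω.indicator (fun _ => ENNReal.ofReal (|w y h| ^ p / ‖h‖ ^ ((N : ℝ) + p * s))) (y + h) with hK
  have hKm : Measurable (Function.uncurry K) := by
    have h1 : Measurable fun z : Euc N × Euc N =>
        ENNReal.ofReal (|w z.1 z.2| ^ p / ‖z.2‖ ^ ((N : ℝ) + p * s)) := by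
      have h2 : Measurable fun z : Euc N × Euc N => w z.1 z.2 := hw
      fun_prop
    have h3 : MeasurableSet {z : Euc N × Euc N | z.1 + z.2 ∈ Ω} :=
      measurableSet_preimage (f := fun z : Euc N × Euc N => z.1 + z.2) (by fun_prop) hΩ
    exact h1.indicator h3
  calc _ = ∫⁻ y in Ω, ∫⁻ h, K y h := by
        refine lintegral_congr fun y => ?_
        rw [← lintegral_indicator hΩ, ← lintegral_add_left_eq_self _ y]
        refine lintegral_congr fun h => ?_
        simp only [hK, indicator, add_sub_cancel_left]
    _ = ∫⁻ h, ∫⁻ y in Ω, K y h := lintegral_lintegral_swap hKm.aemeasurable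
    _ = _ := by
        rw [lintegral_polar hN hKm.lintegral_prod_left]
        refine setLIntegral_congr_fun measurableSet_Ioi fun r (hr : 0 < r) => ?_
        beta_reduce
        rw [eLpNorm_rpow_eq hp, lintegral_prod _
          ((measurable_radialQuot hΩ hw r).enorm.pow_const _).aemeasurable,
          ← lintegral_const_mul, ← lintegral_const_mul]
        rotate_left
        · exact Measurable.lintegral_prod_right'
            ((measurable_radialQuot hΩ hw r).enorm.pow_const _)
        · exact (Measurable.lintegral_prod_left' (μ := volume.restrict Ω) hKm).comp (by fun_prop)
        refine lintegral_congr fun θ => ?_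
        have hθ : ‖(θ : Euc N)‖ = 1 := by simp
        rw [← lintegral_const_mul, ← lintegral_const_mul]
        rotate_left
        · exact ((measurable_radialQuot hΩ hw r).enorm.pow_const _).comp (by fun_prop)
        · exact hKm.comp (f := fun y : Euc N => (y, r • (θ : Euc N))) (by fun_prop)
        refine lintegral_congr fun y => ?_
        simp only [hK, radialQuot, indicator]
        split_ifs with h
        · rw [← ofReal_norm, ENNReal.ofReal_rpow_of_nonneg (norm_nonneg _) hp0.le,
            ← ENNReal.ofReal_mul (by positivity), ← ENNReal.ofReal_mul (by positivity)]
          congr 1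
          rw [norm_mul, norm_smul, hθ, mul_one, Real.norm_of_nonneg hr.le, Real.norm_eq_abs,
            Real.norm_eq_abs, Real.mul_rpow (abs_nonneg _) (abs_nonneg _), abs_inv, abs_of_pos hr,
            ← Real.rpow_natCast, Real.inv_rpow hr.le, ← Real.rpow_neg hr.le, ← mul_assoc,
            ← Real.rpow_add hr, div_eq_mul_inv, ← Real.rpow_neg hr.le, mul_comm (|_| ^ p),
            ← mul_assoc, ← Real.rpow_add hr]
          -- The exponents match since (N - 1) - (N + ps) = (p(1 - s) - 1) - p; casting the natural
          -- subtraction N - 1 needs N ≥ 1.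
          congr 2
          rw [Nat.cast_sub (Nat.one_le_iff_ne_zero.2 hN)]
          push_cast
          ring
        · simp [hp0]

theorem tendsto_gagliardo_of_radial (hN : N ≠ 0) {p : ℝ} (hp : 1 ≤ p) {Ω : Set (Euc N)}
    (hΩ : MeasurableSet Ω) (hb : Bornology.IsBounded Ω) {w : Euc N → Euc N → ℝ}
    (hw : Measurable (Function.uncurry w)) {C ℓ : ℝ≥0∞} (hC : C ≠ ⊤)
    (hbd : ∀ r > 0, eLpNorm (radialQuot Ω w r) (ENNReal.ofReal p) (polarMeasure Ω) ≤
      C * (ENNReal.ofReal r)⁻¹)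
    (hlim : Tendsto (fun r => eLpNorm (radialQuot Ω w r) (ENNReal.ofReal p) (polarMeasure Ω))
      (𝓝[>] 0) (𝓝 ℓ)) :
    Tendsto (fun s : ℝ => ENNReal.ofReal (1 - s) * ∫⁻ y in Ω, ∫⁻ x in Ω,
      ENNReal.ofReal (|w y (x - y)| ^ p / ‖x - y‖ ^ ((N : ℝ) + p * s))) (𝓝[<] 1)
      (𝓝 (ℓ ^ p / ENNReal.ofReal p)) := by
  simp_rw [lintegral_gagliardo_eq_radial hN hp _ hΩ hw]
  obtain ⟨R, hR⟩ := hb.subset_closedBall (0 : Euc N)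
  have hp0 : 0 < p := by linarith
  -- Two points of a ball of radius R are at most 2R apart, so the quotient vanishes for larger r.
  -- The maximum covers a negative R, possible when Ω is empty.
  refine tendsto_radial hp (R := 2 * max R 0) (((ENNReal.continuous_rpow_const (y := p)).tendsto _).comp hlim) ?_ ?_
  · intro r hr
    rw [eLpNorm_congr_ae (g := 0)]
    · simp [hp0]
    have h1 : ∀ᵐ z ∂(polarMeasure Ω), z.2 ∈ Ω := by
      have := Measure.quasiMeasurePreserving_snd (μ := (volume : Measure (Euc N)).toSphere)
        (ν := volume.restrict Ω)
      exact this.ae (ae_restrict_mem hΩ)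
    filter_upwards [h1] with z hz
    have hθ : ‖(z.1 : Euc N)‖ = 1 := by simp
    rw [radialQuot, if_neg]
    · rfl
    intro hz2
    have h3 := hR hz
    have h4 := hR hz2
    rw [mem_closedBall_zero_iff] at h3 h4
    have h5 : ‖r • (z.1 : Euc N)‖ ≤ 2 * R := by
      have := norm_sub_le (z.2 + r • (z.1 : Euc N)) z.2
      rw [add_sub_cancel_left] at this
      linarith
    have h0 : 0 ≤ max R 0 := le_max_right _ _
    rw [norm_smul, hθ, mul_one, Real.norm_of_nonneg (by linarith)] at h5
    linarith [le_max_left R 0]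
  · intro δ hδ
    refine ⟨(C * (ENNReal.ofReal δ)⁻¹) ^ p, ?_, fun r hr => ?_⟩
    · refine ENNReal.rpow_ne_top_of_nonneg hp0.le (ENNReal.mul_ne_top hC ?_)
      simpa using hδ
    · gcongr
      refine (hbd r (lt_of_lt_of_le hδ hr)).trans ?_
      gcongr

theorem tendsto_eLpNorm_of_tendsto_sub {X ι F : Type*} [MeasurableSpace X] [NormedAddCommGroup F]
    {μ : Measure X} {p : ℝ≥0∞} (hp : 1 ≤ p) {l : Filter ι} {f g : ι → X → F} {ℓ : ℝ≥0∞}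
    (hf : ∀ i, AEStronglyMeasurable (f i) μ) (hg : ∀ i, AEStronglyMeasurable (g i) μ)
    (hfl : Tendsto (fun i => eLpNorm (f i) p μ) l (𝓝 ℓ))
    (hfg : Tendsto (fun i => eLpNorm (g i - f i) p μ) l (𝓝 0)) :
    Tendsto (fun i => eLpNorm (g i) p μ) l (𝓝 ℓ) := by
  have h1 : Tendsto (fun i => eLpNorm (f i) p μ - eLpNorm (g i - f i) p μ) l (𝓝 ℓ) := by
    simpa using ENNReal.Tendsto.sub hfl hfg (Or.inr (by simp))
  have h2 : Tendsto (fun i => eLpNorm (f i) p μ + eLpNorm (g i - f i) p μ) l (𝓝 ℓ) := by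
    simpa using hfl.add hfg
  refine tendsto_of_tendsto_of_tendsto_of_le_of_le h1 h2 (fun i => ?_) (fun i => ?_)
  · rw [tsub_le_iff_right]
    have := eLpNorm_sub_le (hg i) ((hg i).sub (hf i)) hp
    simpa using this
  · have := eLpNorm_add_le (hf i) ((hg i).sub (hf i)) hp
    simpa using this

theorem radialQuot_sub (Ω : Set (Euc N)) (w w' : Euc N → Euc N → ℝ) (r : ℝ) :
    radialQuot Ω w r - radialQuot Ω w' r = radialQuot Ω (fun y h => w y h - w' y h) r := by
  ext z
  simp only [radialQuot, Pi.sub_apply]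
  split_ifs <;> ring

end Radial

/-! ### Fundamental theorem of calculus and Taylor remainders for weak gradients. -/

section Segments
variable {N : ℕ}

/-- Weak gradients of real functions, tested on the whole space. -/
def IsWeakGrad (Ω : Set (Euc N)) (v : Euc N → ℝ) (g : Euc N → Euc N) : Prop :=
  ∀ φ : Euc N → ℝ, ContDiff ℝ ∞ φ → HasCompactSupport φ → tsupport φ ⊆ Ω → ∀ a : Euc N,
    ∫ x, v x * fderiv ℝ φ x a = -∫ x, inner ℝ (g x) a * φ x

/-- The base points `x` for which the segment from `x` to `x + h` stays in `Ω`. -/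
def segmentSet (Ω : Set (Euc N)) (h : Euc N) : Set (Euc N) :=
  {x | ∀ t ∈ Icc (0 : ℝ) 1, x + t • h ∈ Ω}

/-- The segment is compact, so a whole neighbourhood of base points keeps it inside the open set. -/
theorem isOpen_segmentSet {Ω : Set (Euc N)} (hΩ : IsOpen Ω) (h : Euc N) :
    IsOpen (segmentSet Ω h) := by
  rw [isOpen_iff_eventually]
  intro x hx
  refine isCompact_Icc.eventually_forall_of_forall_eventually fun t ht => ?_
  have : Continuous fun z : Euc N × ℝ => z.1 + z.2 • h := by fun_prop
  exact this.continuousAt.eventually (hΩ.mem_nhds (hx t ht))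

instance isProbabilityMeasure_restrict_Icc :
    IsProbabilityMeasure (volume.restrict (Icc (0 : ℝ) 1)) := ⟨by simp⟩

theorem integrable_translate_prod {F : Type*} [NormedAddCommGroup F] {g : Euc N → F}
    (hgm : StronglyMeasurable g) (hg : Integrable g) (h : Euc N) :
    Integrable (fun z : Euc N × ℝ => g (z.1 + z.2 • h))
      (volume.prod (volume.restrict (Icc (0 : ℝ) 1))) := by
  have hm : StronglyMeasurable (fun z : Euc N × ℝ => g (z.1 + z.2 • h)) :=
    hgm.comp_measurable (by fun_prop)
  rw [integrable_prod_iff' hm.aestronglyMeasurable]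
  constructor
  · exact ae_of_all _ fun t => hg.comp_add_right (t • h)
  · have : ∀ t : ℝ, ∫ x, ‖g (x + t • h)‖ = ∫ x, ‖g x‖ := fun t =>
      integral_add_right_eq_self (fun x => ‖g x‖) (t • h)
    simp only [this]
    exact integrable_const _

theorem integral_fderiv_segment {φ : Euc N → ℝ} (hφ : ContDiff ℝ ∞ φ) (x h : Euc N) :
    ∫ t in Icc (0 : ℝ) 1, fderiv ℝ φ (x - t • h) h = φ x - φ (x - h) := by
  have hd : ∀ t ∈ uIcc (0 : ℝ) 1, HasDerivAt (fun t : ℝ => φ (x - t • h))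
      (-fderiv ℝ φ (x - t • h) h) t := by
    intro t _
    have h1 : HasDerivAt (fun t : ℝ => x - t • h) (-h) t := by
      simpa using ((hasDerivAt_id t).smul_const h).const_sub x
    have h2 := ((hφ.differentiable (by simp)) (x - t • h)).hasFDerivAt.comp_hasDerivAt t h1
    simpa using! h2
  have hc : Continuous fun t : ℝ => -fderiv ℝ φ (x - t • h) h := by
    have : Continuous fun y => fderiv ℝ φ y h :=
      (hφ.continuous_fderiv (by simp)).clm_apply continuous_const
    exact (this.comp (by fun_prop : Continuous fun t : ℝ => x - t • h)).neg
  have := intervalIntegral.integral_eq_sub_of_hasDerivAt hd (hc.intervalIntegrable _ _)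
  rw [intervalIntegral.integral_neg, intervalIntegral.integral_of_le zero_le_one,
    ← integral_Icc_eq_integral_Ioc] at this
  simp only [one_smul, zero_smul, sub_zero] at this
  linarith

theorem tsupport_comp_sub_subset (φ : Euc N → ℝ) (a : Euc N) :
    tsupport (fun x => φ (x - a)) ⊆ (fun x => x - a) ⁻¹' tsupport φ :=
  tsupport_comp_subset_preimage φ (by fun_prop : Continuous fun x : Euc N => x - a)

/-- The identity is tested against φ supported in `segmentSet Ω h`. Each translate φ(· - th) with t
in [0, 1] is then supported in Ω and admissible for the weak gradient. Averaging over t replaces the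
derivative of φ by φ(x) - φ(x - h), which is what moving the increment of v onto φ produces. -/
theorem IsWeakGrad.ae_eq_integral {Ω : Set (Euc N)} (hΩ : IsOpen Ω) {v : Euc N → ℝ}
    {g : Euc N → Euc N} (hgm : Measurable g) (hv : Integrable v)
    (hg : Integrable g) (hvg : IsWeakGrad Ω v g) (h : Euc N) :
    ∀ᵐ x, x ∈ segmentSet Ω h →
      v (x + h) - v x = ∫ t in Icc (0 : ℝ) 1, inner ℝ (g (x + t • h)) h := by
  have hgh : StronglyMeasurable fun x => (inner ℝ (g x) h : ℝ) :=
    (hgm.inner measurable_const).stronglyMeasurable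
  have hgi : Integrable fun x => (inner ℝ (g x) h : ℝ) := hg.inner_const h
  have hprod := integrable_translate_prod hgh hgi h
  have hI := hprod.integral_prod_left
  have hvh : Integrable fun x => v (x + h) := hv.comp_add_right h
  have key := (isOpen_segmentSet hΩ h).ae_eq_zero_of_integral_contDiff_smul_eq_zero
    (f := fun x => v (x + h) - v x - ∫ t in Icc (0 : ℝ) 1, inner ℝ (g (x + t • h)) h)
    (μ := volume) (((hvh.sub hv).sub hI).locallyIntegrable.locallyIntegrableOn _) ?_
  · filter_upwards [key] with x hx hxE
    linarith [hx hxE]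
  intro φ hφ hφc hφs
  have hφb : ∃ C, ∀ x, ‖φ x‖ ≤ C := hφc.exists_bound_of_continuous hφ.continuous
  obtain ⟨C, hC⟩ := hφb
  have hmul : ∀ {k : Euc N → ℝ}, Integrable k → Integrable fun x => φ x * k x := fun hk =>
    hk.bdd_mul hφ.continuous.aestronglyMeasurable (ae_of_all _ hC)
  have hmul' : ∀ {k : Euc N → ℝ}, Integrable k → Integrable fun x => φ (x - h) * k x := fun hk =>
    hk.bdd_mul (hφ.continuous.comp (by fun_prop)).aestronglyMeasurable (ae_of_all _ fun x => hC _)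
  simp only [smul_eq_mul, mul_sub]
  rw [integral_sub (by exact (hmul hvh).sub (hmul hv)) (hmul hI),
    integral_sub (hmul hvh) (hmul hv)]
  have e1 : ∫ x, φ x * v (x + h) = ∫ x, φ (x - h) * v x := by
    rw [← integral_add_right_eq_self (fun x => φ (x - h) * v x) h]
    simp
  have e2 : ∫ x, φ x * ∫ t in Icc (0 : ℝ) 1, inner ℝ (g (x + t • h)) h =
      -∫ x, v x * (φ x - φ (x - h)) := by
    simp_rw [← integral_const_mul]
    rw [integral_integral_swap (by
      exact hprod.bdd_mul (hφ.continuous.comp continuous_fst).aestronglyMeasurable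
        (ae_of_all _ fun z => hC z.1))]
    have e3 : ∀ t ∈ Icc (0 : ℝ) 1, ∫ x, φ x * inner ℝ (g (x + t • h)) h =
        -∫ x, v x * fderiv ℝ φ (x - t • h) h := by
      intro t ht
      have hcomp : HasCompactSupport fun x => φ (x - t • h) := by
        simpa [sub_eq_add_neg] using! hφc.comp_homeomorph (Homeomorph.addRight (-(t • h)))
      have h3 := hvg (fun x => φ (x - t • h)) (hφ.comp (by fun_prop)) hcomp ?_ h
      · simp only [fderiv_comp_sub] at h3
        rw [← integral_add_right_eq_self (fun x => inner ℝ (g x) h * φ (x - t • h)) (t • h)] at h3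
        simp only [add_sub_cancel_right] at h3
        rw [h3, neg_neg]
        simp_rw [mul_comm (φ _)]
      · intro x hx
        have := hφs (tsupport_comp_sub_subset φ _ hx) t ht
        simpa using this
    rw [setIntegral_congr_fun measurableSet_Icc e3, integral_neg]
    rw [← integral_integral_swap]
    · simp_rw [integral_const_mul, integral_fderiv_segment hφ]
    · have hfc : Continuous fun y => fderiv ℝ φ y h :=
        (hφ.continuous_fderiv (by simp)).clm_apply continuous_const
      obtain ⟨C', hC'⟩ := (hφc.fderiv_apply ℝ h).exists_bound_of_continuous hfc
      refine Integrable.mul_bdd (c := C')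
        (f := fun z : Euc N × ℝ => v z.1) (g := fun z : Euc N × ℝ => fderiv ℝ φ (z.1 - z.2 • h) h) ?_ ?_ ?_
      · exact hv.comp_fst _
      · exact (hfc.comp (by fun_prop : Continuous
          fun z : Euc N × ℝ => z.1 - z.2 • h)).aestronglyMeasurable
      · exact ae_of_all _ fun z => hC' _
  rw [e1, e2, sub_neg_eq_add, ← integral_sub (hmul' hv) (hmul hv), ← integral_add]
  · have : ∀ x, φ (x - h) * v x - φ x * v x + v x * (φ x - φ (x - h)) = 0 := fun x => by ring
    simp [this]
  · exact (hmul' hv).sub (hmul hv)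
  · refine ((hmul hv).sub (hmul' hv)).congr (ae_of_all _ fun x => ?_)
    simp only [Pi.sub_apply]
    ring

/-- The first order Taylor remainder `v(x+h) - v(x) - ⟨g(x), h⟩`. -/
noncomputable def taylorRem (v : Euc N → ℝ) (g : Euc N → Euc N) (h x : Euc N) : ℝ :=
  v (x + h) - v x - inner ℝ (g x) h

theorem measurable_taylorRem {v : Euc N → ℝ} {g : Euc N → Euc N} (hvm : Measurable v)
    (hgm : Measurable g) (h : Euc N) : Measurable (taylorRem v g h) := by
  unfold taylorRem
  exact ((hvm.comp (by fun_prop)).sub hvm).sub (hgm.inner measurable_const)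

theorem eLpNorm_inner_const_le {X : Type*} [MeasurableSpace X] {μ : Measure X} {p : ℝ≥0∞}
    (k : X → Euc N) (h : Euc N) :
    eLpNorm (fun x => (inner ℝ (k x) h : ℝ)) p μ ≤ ENNReal.ofReal ‖h‖ * eLpNorm k p μ := by
  refine eLpNorm_le_mul_eLpNorm_of_ae_le_mul (ae_of_all _ fun x => ?_) p
  rw [mul_comm]
  exact norm_inner_le_norm _ _

/-- The remainder is the average over t of ⟨g(x + th) - g(x), h⟩, so it is controlled by |h| times
the L^p modulus of continuity of g under translations, here M. -/
theorem IsWeakGrad.eLpNorm_taylorRem_le {Ω : Set (Euc N)} (hΩ : IsOpen Ω) {v : Euc N → ℝ}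
    {g : Euc N → Euc N} (hgm : Measurable g) (hv : Integrable v)
    (hg : Integrable g) (hvg : IsWeakGrad Ω v g) {p : ℝ≥0∞} (hp1 : 1 ≤ p) (hp : p ≠ ⊤)
    {h : Euc N} {M : ℝ≥0∞}
    (hM : ∀ k : Euc N, ‖k‖ ≤ ‖h‖ → eLpNorm (fun x => g (x + k) - g x) p volume ≤ M) :
    eLpNorm (taylorRem v g h) p (volume.restrict (segmentSet Ω h)) ≤ ENNReal.ofReal ‖h‖ * M := by
  have hgh : StronglyMeasurable fun x => (inner ℝ (g x) h : ℝ) :=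
    (hgm.inner measurable_const).stronglyMeasurable
  have hprod := integrable_translate_prod hgh (hg.inner_const h) h
  have hae : taylorRem v g h =ᵐ[volume.restrict (segmentSet Ω h)]
      fun x => ∫ t in Icc (0 : ℝ) 1, inner ℝ (g (x + t • h) - g x) h := by
    filter_upwards [ae_restrict_of_ae (hvg.ae_eq_integral hΩ hgm hv hg h),
      ae_restrict_mem (isOpen_segmentSet hΩ h).measurableSet,
      ae_restrict_of_ae hprod.prod_right_ae] with x h1 h2 h3
    simp_rw [inner_sub_left]
    rw [integral_sub h3 (integrable_const _), ← h1 h2]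
    simp [taylorRem]
  rw [eLpNorm_congr_ae hae]
  refine eLpNorm_integral_le_of_forall hp1 hp ?_ ?_
  · refine (Measurable.inner (𝕜 := ℝ) ?_ measurable_const).aestronglyMeasurable
    exact (hgm.comp (by fun_prop : Measurable fun z : Euc N × ℝ => z.1 + z.2 • h)).sub
      (hgm.comp measurable_fst)
  · filter_upwards [ae_restrict_mem measurableSet_Icc] with t ht
    refine (eLpNorm_inner_const_le _ _).trans ?_
    gcongr
    refine (eLpNorm_restrict_le _ _ _ _).trans (hM _ ?_)
    rw [norm_smul, Real.norm_of_nonneg ht.1]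
    exact mul_le_of_le_one_left (norm_nonneg _) ht.2

theorem eLpNorm_comp_add_restrict_le {F : Type*} [NormedAddCommGroup F] {k : Euc N → F}
    {p : ℝ≥0∞} {S T : Set (Euc N)} (hT : MeasurableSet T) {a : Euc N}
    (hk : AEStronglyMeasurable k (volume.restrict T)) (hST : ∀ x ∈ S, x + a ∈ T) :
    eLpNorm (fun x => k (x + a)) p (volume.restrict S) ≤ eLpNorm k p (volume.restrict T) := by
  have hmp := (measurePreserving_add_right (volume : Measure (Euc N)) a).restrict_preimage hT
  rw [← eLpNorm_comp_measurePreserving hk hmp]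
  exact eLpNorm_mono_measure _ (Measure.restrict_mono hST le_rfl)

/-- When the segment from x to x+h may leave Ω, the path x, x+a, x+a+h, x+h is used instead. Each of
its three sides lies in Ω, and a comparable in size to h costs only a constant. -/
theorem IsWeakGrad.eLpNorm_taylorRem_detour_le {Ω : Set (Euc N)} (hΩ : IsOpen Ω) {v : Euc N → ℝ}
    {g : Euc N → Euc N} (hvm : Measurable v) (hgm : Measurable g) (hv : Integrable v)
    (hg : Integrable g) (hvg : IsWeakGrad Ω v g) {p : ℝ≥0∞} (hp1 : 1 ≤ p) (hp : p ≠ ⊤)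
    {h a : Euc N} {S : Set (Euc N)}
    (h1 : ∀ x ∈ S, x ∈ segmentSet Ω a) (h2 : ∀ x ∈ S, x + a ∈ segmentSet Ω h)
    (h3 : ∀ x ∈ S, x + h ∈ segmentSet Ω a) {M : ℝ≥0∞}
    (hM : ∀ k : Euc N, ‖k‖ ≤ ‖h‖ + ‖a‖ → eLpNorm (fun x => g (x + k) - g x) p volume ≤ M) :
    eLpNorm (taylorRem v g h) p (volume.restrict S) ≤
      3 * ENNReal.ofReal (‖h‖ + ‖a‖) * M := by
  have ha : ∀ k : Euc N, ‖k‖ ≤ ‖a‖ → eLpNorm (fun x => g (x + k) - g x) p volume ≤ M :=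
    fun k hk => hM k (hk.trans (by linarith [norm_nonneg h]))
  have hh : ∀ k : Euc N, ‖k‖ ≤ ‖h‖ → eLpNorm (fun x => g (x + k) - g x) p volume ≤ M :=
    fun k hk => hM k (hk.trans (by linarith [norm_nonneg a]))
  have hTa := measurable_taylorRem hvm hgm a
  have hTh := measurable_taylorRem hvm hgm h
  have A1 : eLpNorm (taylorRem v g a) p (volume.restrict S) ≤ ENNReal.ofReal ‖a‖ * M :=
    (eLpNorm_mono_measure _ (Measure.restrict_mono h1 le_rfl)).trans
      (hvg.eLpNorm_taylorRem_le hΩ hgm hv hg hp1 hp ha)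
  have A2 : eLpNorm (fun x => taylorRem v g h (x + a)) p (volume.restrict S) ≤
      ENNReal.ofReal ‖h‖ * M :=
    (eLpNorm_comp_add_restrict_le (isOpen_segmentSet hΩ h).measurableSet
      hTh.aestronglyMeasurable h2).trans
      (hvg.eLpNorm_taylorRem_le hΩ hgm hv hg hp1 hp hh)
  have A3 : eLpNorm (fun x => taylorRem v g a (x + h)) p (volume.restrict S) ≤
      ENNReal.ofReal ‖a‖ * M :=
    (eLpNorm_comp_add_restrict_le (isOpen_segmentSet hΩ a).measurableSet
      hTa.aestronglyMeasurable h3).trans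
      (hvg.eLpNorm_taylorRem_le hΩ hgm hv hg hp1 hp ha)
  have A4 : eLpNorm (fun x => (inner ℝ (g (x + a) - g x) h : ℝ)) p (volume.restrict S) ≤
      ENNReal.ofReal ‖h‖ * M :=
    (eLpNorm_inner_const_le _ _).trans (by
      gcongr; exact (eLpNorm_restrict_le _ _ _ _).trans (ha a le_rfl))
  have A5 : eLpNorm (fun x => (inner ℝ (g (x + h) - g x) a : ℝ)) p (volume.restrict S) ≤
      ENNReal.ofReal ‖a‖ * M :=
    (eLpNorm_inner_const_le _ _).trans (by
      gcongr; exact (eLpNorm_restrict_le _ _ _ _).trans (hh h le_rfl))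
  have hadd : ∀ b : Euc N, Measurable fun x : Euc N => x + b := fun b => by fun_prop
  have hgd : ∀ b : Euc N, Measurable fun x => g (x + b) - g x := fun b =>
    (hgm.comp (hadd b)).sub hgm
  have m2 : Measurable fun x => taylorRem v g h (x + a) := hTh.comp (hadd a)
  have m3 : Measurable fun x => taylorRem v g a (x + h) := hTa.comp (hadd h)
  have m4 : Measurable fun x => (inner ℝ (g (x + a) - g x) h : ℝ) :=
    (hgd a).inner measurable_const
  have m5 : Measurable fun x => (inner ℝ (g (x + h) - g x) a : ℝ) :=
    (hgd h).inner measurable_const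
  -- The increments of v telescope along the three sides. The two inner products correct for the
  -- gradient being taken at x+a and x+h instead of x.
  have heq : taylorRem v g h = (((taylorRem v g a + fun x => taylorRem v g h (x + a)) +
      fun x => (inner ℝ (g (x + a) - g x) h : ℝ)) - fun x => taylorRem v g a (x + h)) -
      fun x => (inner ℝ (g (x + h) - g x) a : ℝ) := by
    ext x
    simp only [taylorRem, Pi.sub_apply, Pi.add_apply, inner_sub_left, add_right_comm x h a]
    ring
  rw [heq]
  refine (eLpNorm_sub_le (((hTa.add m2).add m4).sub m3).aestronglyMeasurable
    m5.aestronglyMeasurable hp1).trans ?_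
  refine (add_le_add ((eLpNorm_sub_le ((hTa.add m2).add m4).aestronglyMeasurable
    m3.aestronglyMeasurable hp1).trans (add_le_add ((eLpNorm_add_le
    (hTa.add m2).aestronglyMeasurable m4.aestronglyMeasurable hp1).trans
    (add_le_add ((eLpNorm_add_le hTa.aestronglyMeasurable m2.aestronglyMeasurable hp1).trans
    (add_le_add A1 A2)) A4)) A3)) A5).trans ?_
  rw [ENNReal.ofReal_add (norm_nonneg _) (norm_nonneg _)]
  set x := ENNReal.ofReal ‖a‖
  set y := ENNReal.ofReal ‖h‖
  -- Five terms occur, three of size |a| M and two of size |h| M; the common constant 3 is a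
  -- convenience.
  calc x * M + y * M + y * M + x * M + x * M = (2 * y + 3 * x) * M := by ring
    _ ≤ (3 * y + 3 * x) * M := by gcongr; norm_num
    _ = _ := by ring

end Segments

/-! ### Detours in Lipschitz domains and the limit of the quotients for Sobolev functions. -/

section Lipschitz
variable {N : ℕ}

/-- Near a boundary point, lifting the segment by a large multiple of |h| in the direction e places
it above the graph of γ; the vertical sides stay above the graph because γ does not see the e
coordinate. The vector b and the radius depend only on x₀. -/
theorem exists_detour_of_mem_closure {Ω : Set (Euc N)} (hΩ : IsOpen Ω)
    (hL : HasLipschitzBoundary Ω) {x₀ : Euc N} (hx₀ : x₀ ∈ closure Ω) :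
    ∃ r > 0, ∃ b : Euc N, ∀ h : Euc N, ‖h‖ < r → ∀ x ∈ Metric.ball x₀ r, x ∈ Ω → x + h ∈ Ω →
      x ∈ segmentSet Ω (‖h‖ • b) ∧ x + ‖h‖ • b ∈ segmentSet Ω h ∧
        x + h ∈ segmentSet Ω (‖h‖ • b) := by
  by_cases hx : x₀ ∈ Ω
  · obtain ⟨ρ, hρ, hball⟩ := Metric.isOpen_iff.1 hΩ x₀ hx
    -- Around an interior point a ball lies in Ω and contains the segment, so the detour is trivial.
    refine ⟨ρ / 2, by positivity, 0, fun h hh x hxb hxΩ hxh => ⟨?_, ?_, ?_⟩⟩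
    · intro t _; simpa using hxΩ
    · intro t ht
      apply hball
      rw [Metric.mem_ball, dist_eq_norm] at hxb ⊢
      have h1 : ‖t • h‖ ≤ ‖h‖ := by
        rw [norm_smul, Real.norm_of_nonneg ht.1]
        exact mul_le_of_le_one_left (norm_nonneg _) ht.2
      have h2 : x + ‖h‖ • (0 : Euc N) + t • h - x₀ = (x - x₀) + t • h := by
        rw [smul_zero]; abel
      rw [h2]
      linarith [norm_add_le (x - x₀) (t • h)]
    · intro t _; simpa using hxh
  · obtain ⟨r, hr, e, he, γ, K, hγ, hiff⟩ := hL x₀ ⟨hx₀, by rwa [hΩ.interior_eq]⟩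
    -- Along the segment the graph rises by at most 2K|h|, as the projected displacement is at most
    -- 2|h|, and the height drops by at most |h|. A lift of (2K + 2)|h| exceeds both.
    set c : ℝ := 2 * K + 2 with hc
    have hK : (0 : ℝ) ≤ K := K.2
    have hc0 : 0 < c := by positivity
    -- The distance to x₀, the step h and the lift c|h| then sum to less than r, which keeps the
    -- whole path in the ball of the chart.
    refine ⟨r / (c + 2), by positivity, c • e, fun h hh x hxb hxΩ hxh => ?_⟩
    rw [lt_div_iff₀ (by positivity)] at hh
    rw [Metric.mem_ball, dist_eq_norm, lt_div_iff₀ (by positivity)] at hxb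
    have hn : 0 ≤ ‖h‖ := norm_nonneg h
    have hee : (inner ℝ e e : ℝ) = 1 := by rw [real_inner_self_eq_norm_sq, he]; norm_num
    have hih : |(inner ℝ e h : ℝ)| ≤ ‖h‖ := by
      have := abs_real_inner_le_norm e h
      rwa [he, one_mul] at this
    have hxn := norm_nonneg (x - x₀)
    have hmem : ∀ t ∈ Icc (0 : ℝ) 1, ∀ s ∈ Icc (0 : ℝ) 1,
        x + t • h + s • (‖h‖ • (c • e)) ∈ Metric.ball x₀ r := by
      intro t ht s hs
      rw [Metric.mem_ball, dist_eq_norm]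
      have e1 : x + t • h + s • (‖h‖ • (c • e)) - x₀ = (x - x₀) + t • h + s • (‖h‖ • (c • e)) := by
        abel
      have e2 : ‖t • h‖ ≤ ‖h‖ := by
        rw [norm_smul, Real.norm_of_nonneg ht.1]
        exact mul_le_of_le_one_left hn ht.2
      have e3 : ‖s • (‖h‖ • (c • e))‖ ≤ ‖h‖ * c := by
        rw [norm_smul, norm_smul, norm_smul, he, Real.norm_of_nonneg hs.1, norm_norm,
          Real.norm_of_nonneg hc0.le, mul_one]
        exact mul_le_of_le_one_left (by positivity) hs.2
      rw [e1]
      have := norm_add₃_le (a := x - x₀) (b := t • h) (c := s • (‖h‖ • (c • e)))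
      have h5 : ‖x - x₀‖ * 2 ≤ ‖x - x₀‖ * (c + 2) := by nlinarith
      nlinarith
    have hproj : ∀ (y : Euc N) (s : ℝ), y + s • e - (inner ℝ e (y + s • e) : ℝ) • e =
        y - (inner ℝ e y : ℝ) • e := by
      intro y s
      rw [inner_add_right, inner_smul_right, hee, add_smul, mul_one]
      abel
    have hup : ∀ t ∈ Icc (0 : ℝ) 1, x + t • h ∈ Ω → ∀ s ∈ Icc (0 : ℝ) 1,
        x + t • h + s • (‖h‖ • (c • e)) ∈ Ω := by
      intro t ht hxt s hs
      have h0 := (hiff _ (by simpa using hmem t ht 0 (by simp))).1 hxt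
      rw [hiff _ (hmem t ht s hs)]
      rw [smul_smul, smul_smul, hproj, inner_add_right _ (x + t • h), inner_smul_right _ e, hee]
      have : 0 ≤ s * (‖h‖ * c) := mul_nonneg hs.1 (by positivity)
      linarith
    refine ⟨?_, ?_, ?_⟩
    · intro s hs
      simpa using hup 0 (by simp) (by simpa using hxΩ) s hs
    · intro t ht
      have h0 := (hiff _ (by simpa using hmem 0 (by simp) 0 (by simp))).1 hxΩ
      have h1 : x + ‖h‖ • c • e + t • h = x + t • h + (1 : ℝ) • (‖h‖ • (c • e)) := by
        rw [one_smul]; abel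
      rw [h1, hiff _ (hmem t ht 1 (by simp))]
      rw [one_smul, smul_smul, hproj, inner_add_right _ (x + t • h), inner_smul_right _ e, hee,
        inner_add_right, inner_smul_right]
      have h2 := hγ.dist_le_mul (x + t • h - (inner ℝ e (x + t • h) : ℝ) • e)
        (x - (inner ℝ e x : ℝ) • e)
      have h3 : dist (x + t • h - (inner ℝ e (x + t • h) : ℝ) • e)
          (x - (inner ℝ e x : ℝ) • e) ≤ 2 * ‖h‖ := by
        rw [dist_eq_norm, inner_add_right, inner_smul_right]
        have e1 : x + t • h - ((inner ℝ e x : ℝ) + t * (inner ℝ e h : ℝ)) • e -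
            (x - (inner ℝ e x : ℝ) • e) = t • h - (t * (inner ℝ e h : ℝ)) • e := by
          rw [add_smul]; abel
        rw [e1]
        refine (norm_sub_le _ _).trans ?_
        rw [norm_smul, norm_smul, he, mul_one, norm_mul, Real.norm_of_nonneg ht.1,
          Real.norm_eq_abs]
        nlinarith [ht.1, ht.2, abs_nonneg (inner ℝ e h : ℝ)]
      rw [Real.dist_eq] at h2
      have h4 := (abs_le.1 (h2.trans (mul_le_mul_of_nonneg_left h3 hK))).2
      have h5 : -‖h‖ ≤ t * (inner ℝ e h : ℝ) := by
        have := (abs_le.1 hih).1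
        nlinarith [ht.1, ht.2]
      rw [inner_add_right _ x (t • h), inner_smul_right _ _ t] at h4
      rw [hc]
      nlinarith
    · intro s hs
      simpa using hup 1 (by simp) (by simpa using hxh) s hs

/-- Compactness of the closure makes the local detours uniform. The estimate is stated for the p-th
power because that is additive over the pieces of a finite cover; n collects the number of pieces.
-/
theorem IsWeakGrad.exists_lintegral_taylorRem_le {Ω : Set (Euc N)} (hΩ : IsOpen Ω)
    (hb : Bornology.IsBounded Ω) (hL : HasLipschitzBoundary Ω) {v : Euc N → ℝ}
    {g : Euc N → Euc N} (hvm : Measurable v) (hgm : Measurable g) (hv : Integrable v)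
    (hg : Integrable g) (hvg : IsWeakGrad Ω v g) {p : ℝ} (hp : 1 ≤ p) :
    ∃ δ > 0, ∃ C : ℝ, 0 ≤ C ∧ ∃ n : ℕ, ∀ h : Euc N, ‖h‖ < δ → ∀ M : ℝ≥0∞,
      (∀ k : Euc N, ‖k‖ ≤ C * ‖h‖ →
        eLpNorm (fun x => g (x + k) - g x) (ENNReal.ofReal p) volume ≤ M) →
      ∫⁻ x in Ω ∩ {x | x + h ∈ Ω}, ‖taylorRem v g h x‖ₑ ^ p ≤
        n * (3 * ENNReal.ofReal (C * ‖h‖) * M) ^ p := by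
  have hcov : ∀ x₀ ∈ closure Ω, ∃ U ∈ 𝓝[closure Ω] x₀, ∃ δ > 0, ∃ C : ℝ, 0 ≤ C ∧ ∃ n : ℕ,
      ∀ h : Euc N, ‖h‖ < δ → ∀ M : ℝ≥0∞,
      (∀ k : Euc N, ‖k‖ ≤ C * ‖h‖ →
        eLpNorm (fun x => g (x + k) - g x) (ENNReal.ofReal p) volume ≤ M) →
      ∫⁻ x in U ∩ (Ω ∩ {x | x + h ∈ Ω}), ‖taylorRem v g h x‖ₑ ^ p ≤
        n * (3 * ENNReal.ofReal (C * ‖h‖) * M) ^ p := by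
    intro x₀ hx₀
    obtain ⟨r, hr, b, hdet⟩ := exists_detour_of_mem_closure hΩ hL hx₀
    refine ⟨Metric.ball x₀ r, mem_nhdsWithin_of_mem_nhds (Metric.ball_mem_nhds _ hr), r, hr,
      1 + ‖b‖, by positivity, 1, fun h hh M hM => ?_⟩
    have hab : ‖h‖ + ‖‖h‖ • b‖ = (1 + ‖b‖) * ‖h‖ := by
      rw [norm_smul, norm_norm]; ring
    rw [← eLpNorm_rpow_eq hp, Nat.cast_one, one_mul, ← hab]
    gcongr
    refine hvg.eLpNorm_taylorRem_detour_le hΩ hvm hgm hv hg ?_ ENNReal.ofReal_ne_top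
      (a := ‖h‖ • b) ?_ ?_ ?_ ?_
    · simpa using hp
    · rintro x ⟨h1, h2, h3⟩; exact (hdet h hh x h1 h2 h3).1
    · rintro x ⟨h1, h2, h3⟩; exact (hdet h hh x h1 h2 h3).2.1
    · rintro x ⟨h1, h2, h3⟩; exact (hdet h hh x h1 h2 h3).2.2
    · rwa [hab]
  have hcpt : IsCompact (closure Ω) := hb.isCompact_closure
  have key := hcpt.induction_on (p := fun U => ∃ δ > 0, ∃ C : ℝ, 0 ≤ C ∧ ∃ n : ℕ,
      ∀ h : Euc N, ‖h‖ < δ → ∀ M : ℝ≥0∞,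
      (∀ k : Euc N, ‖k‖ ≤ C * ‖h‖ →
        eLpNorm (fun x => g (x + k) - g x) (ENNReal.ofReal p) volume ≤ M) →
      ∫⁻ x in U ∩ (Ω ∩ {x | x + h ∈ Ω}), ‖taylorRem v g h x‖ₑ ^ p ≤
        n * (3 * ENNReal.ofReal (C * ‖h‖) * M) ^ p) ?_ ?_ ?_ hcov
  · obtain ⟨δ, hδ, C, hC, n, H⟩ := key
    refine ⟨δ, hδ, C, hC, n, fun h hh M hM => ?_⟩
    have := H h hh M hM
    rwa [inter_eq_self_of_subset_right (inter_subset_left.trans subset_closure)] at this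
  · exact ⟨1, one_pos, 0, le_rfl, 0, fun h _ M _ => by simp⟩
  · rintro s t hst ⟨δ, hδ, C, hC, n, H⟩
    exact ⟨δ, hδ, C, hC, n, fun h hh M hM => (lintegral_mono_set
      (inter_subset_inter_left _ hst)).trans (H h hh M hM)⟩
  · rintro s t ⟨δ, hδ, C, hC, n, H⟩ ⟨δ', hδ', C', hC', n', H'⟩
    refine ⟨min δ δ', lt_min hδ hδ', max C C', le_max_of_le_left hC, n + n',
      fun h hh M hM => ?_⟩
    have B1 := H h (hh.trans_le (min_le_left _ _)) M fun k hk => hM k (hk.trans (by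
      gcongr; exact le_max_left _ _))
    have B2 := H' h (hh.trans_le (min_le_right _ _)) M fun k hk => hM k (hk.trans (by
      gcongr; exact le_max_right _ _))
    rw [union_inter_distrib_right]
    refine (lintegral_union_le _ _ _).trans ((add_le_add B1 B2).trans ?_)
    rw [Nat.cast_add, add_mul]
    gcongr
    · exact le_max_left _ _
    · exact le_max_right _ _

theorem eLpNorm_inner_polar_rpow {p : ℝ} (hp : 1 ≤ p) {e : Euc N} (he : ‖e‖ = 1)
    (Ω : Set (Euc N)) {G : Euc N → Euc N} (hG : Measurable G) :
    eLpNorm (fun z => (inner ℝ (G z.2) (z.1 : Euc N) : ℝ)) (ENNReal.ofReal p)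
      (polarMeasure Ω) ^ p =
      ENNReal.ofReal p * ENNReal.ofReal (bbmConst p e) * ∫⁻ x in Ω, ‖G x‖ₑ ^ p := by
  have hm : Measurable fun z : Metric.sphere (0 : Euc N) 1 × Euc N =>
      (inner ℝ (G z.2) (z.1 : Euc N) : ℝ) :=
    (hG.comp measurable_snd).inner (measurable_subtype_coe.comp measurable_fst)
  rw [eLpNorm_rpow_eq hp, lintegral_prod_symm _ (hm.enorm.pow_const _).aemeasurable,
    ← lintegral_const_mul _ (hG.enorm.pow_const _)]
  exact lintegral_congr fun x => lintegral_sphere_inner_rpow hp he (G x)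

/-- The quotient is compared with its linearization ⟨g + f, θ⟩, cut off where y + rθ leaves Ω. The
cutoff disappears as r → 0 by dominated convergence, since Ω is open. The term in f cancels in the
difference, leaving the Taylor remainder divided by r. -/
theorem tendsto_radialQuot_of_isWeakGrad {Ω : Set (Euc N)} (hΩ : IsOpen Ω)
    (hb : Bornology.IsBounded Ω) (hL : HasLipschitzBoundary Ω) {v : Euc N → ℝ}
    {f g : Euc N → Euc N} (hvm : Measurable v) (hgm : Measurable g) (hfm : Measurable f)
    (hv : Integrable v) (hg : Integrable g) (hvg : IsWeakGrad Ω v g) {p : ℝ} (hp : 1 ≤ p)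
    (hgp : MemLp g (ENNReal.ofReal p) volume)
    (hfp : MemLp f (ENNReal.ofReal p) (volume.restrict Ω)) :
    Tendsto (fun r => eLpNorm (radialQuot Ω (fun y h => v (y + h) - v y + inner ℝ (f y) h) r)
      (ENNReal.ofReal p) (polarMeasure Ω)) (𝓝[>] 0)
      (𝓝 (eLpNorm (fun z => (inner ℝ (g z.2 + f z.2) (z.1 : Euc N) : ℝ)) (ENNReal.ofReal p)
        (polarMeasure Ω))) := by
  classical
  have hp0 : 0 < p := by linarith
  have hpE : (1 : ℝ≥0∞) ≤ ENNReal.ofReal p := by simpa using hp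
  set w : Euc N → Euc N → ℝ := fun y h => v (y + h) - v y + inner ℝ (f y) h with hw
  set w' : Euc N → Euc N → ℝ := fun y h => inner ℝ (g y + f y) h with hw'
  have hwm : Measurable (Function.uncurry w) := by
    have h1 : Measurable fun z : Euc N × Euc N => v (z.1 + z.2) := hvm.comp (by fun_prop)
    have h2 : Measurable fun z : Euc N × Euc N => v z.1 := hvm.comp (by fun_prop)
    exact (h1.sub h2).add ((hfm.comp measurable_fst).inner measurable_snd)
  have hwm' : Measurable (Function.uncurry w') :=
    ((hgm.add hfm).comp measurable_fst).inner measurable_snd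
  refine tendsto_eLpNorm_of_tendsto_sub hpE (f := fun r => radialQuot Ω w' r)
    (fun r => (measurable_radialQuot hΩ.measurableSet hwm' r).aestronglyMeasurable)
    (fun r => (measurable_radialQuot hΩ.measurableSet hwm r).aestronglyMeasurable) ?_ ?_
  · have hpow : Tendsto (fun r => ∫⁻ z, ‖radialQuot Ω w' r z‖ₑ ^ p ∂(polarMeasure Ω)) (𝓝[>] 0)
        (𝓝 (∫⁻ z, ‖(inner ℝ (g z.2 + f z.2) (z.1 : Euc N) : ℝ)‖ₑ ^ p ∂(polarMeasure Ω))) := by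
      refine tendsto_lintegral_filter_of_dominated_convergence (fun z => ‖g z.2 + f z.2‖ₑ ^ p)
        (Eventually.of_forall fun r =>
          (measurable_radialQuot hΩ.measurableSet hwm' r).enorm.pow_const _) ?_ ?_ ?_
      · filter_upwards [self_mem_nhdsWithin] with r (hr : 0 < r)
        refine ae_of_all _ fun z => ?_
        gcongr
        rw [radialQuot]
        split_ifs
        · simp only [hw', inner_smul_right]
          rw [inv_mul_cancel_left₀ hr.ne', ← ofReal_norm, ← ofReal_norm]
          refine ENNReal.ofReal_le_ofReal ?_
          have := norm_inner_le_norm (𝕜 := ℝ) (g z.2 + f z.2) (z.1 : Euc N)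
          simpa using this
        · simp
      · have hm2 : Measurable fun z : Metric.sphere (0 : Euc N) 1 × Euc N =>
            ‖g z.2 + f z.2‖ₑ ^ p := ((hgm.add hfm).comp measurable_snd).enorm.pow_const _
        rw [lintegral_prod_symm _ hm2.aemeasurable]
        simp only [lintegral_const]
        rw [lintegral_mul_const _ (by fun_prop)]
        refine ENNReal.mul_ne_top ?_ (measure_ne_top _ _)
        have := ((hgp.restrict Ω).add hfp).eLpNorm_lt_top
        have h2 := ENNReal.rpow_lt_top_of_nonneg hp0.le this.ne
        rw [eLpNorm_rpow_eq hp] at h2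
        exact h2.ne
      · have h1 : ∀ᵐ z ∂(polarMeasure Ω), z.2 ∈ Ω :=
          (Measure.quasiMeasurePreserving_snd (μ := (volume : Measure (Euc N)).toSphere)
            (ν := volume.restrict Ω)).ae (ae_restrict_mem hΩ.measurableSet)
        filter_upwards [h1] with z hz
        refine tendsto_const_nhds.congr' ?_
        have hc : Continuous fun r : ℝ => z.2 + r • (z.1 : Euc N) := by fun_prop
        have hev : ∀ᶠ r in 𝓝 (0 : ℝ), z.2 + r • (z.1 : Euc N) ∈ Ω :=
          hc.continuousAt.eventually (hΩ.mem_nhds (by simpa using hz))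
        filter_upwards [self_mem_nhdsWithin, nhdsWithin_le_nhds hev] with r (hr : 0 < r) hr2
        rw [radialQuot, if_pos hr2]
        simp only [hw', inner_smul_right]
        rw [inv_mul_cancel_left₀ hr.ne']
    have := ((ENNReal.continuous_rpow_const (y := 1 / p)).tendsto _).comp hpow
    simp only [← eLpNorm_rpow_eq hp, Function.comp_def, ← ENNReal.rpow_mul,
      mul_one_div_cancel hp0.ne', ENNReal.rpow_one] at this
    exact this
  · obtain ⟨δ, hδ, C, hC, n, H⟩ :=
      hvg.exists_lintegral_taylorRem_le hΩ hb hL hvm hgm hv hg hp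
    have htr := tendsto_eLpNorm_translate_sub hpE ENNReal.ofReal_ne_top hgp
    set σ := (volume : Measure (Euc N)).toSphere
    -- For small r every translation of length at most Cr moves g by at most M in L^p. The factor r
    -- in the remainder estimate cancels the division by r.
    have hbound : ∀ M : ℝ≥0∞, 0 < M → ∀ᶠ r : ℝ in 𝓝[>] 0,
        eLpNorm (radialQuot Ω w r - radialQuot Ω w' r) (ENNReal.ofReal p) (polarMeasure Ω) ≤
          ((σ univ * n) ^ (1 / p) * (3 * ENNReal.ofReal C)) * M := by
      intro M hM
      have h1 := htr.eventually (Iic_mem_nhds hM)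
      rw [Metric.eventually_nhds_iff] at h1
      obtain ⟨η, hη, h1⟩ := h1
      have hsmall : ∀ᶠ r : ℝ in 𝓝[>] 0, r < δ ∧ C * r < η := by
        refine nhdsWithin_le_nhds (Eventually.and (Iio_mem_nhds hδ) ?_)
        have : Continuous fun r : ℝ => C * r := by fun_prop
        exact this.continuousAt.eventually (Iio_mem_nhds (by simpa using hη))
      filter_upwards [hsmall, self_mem_nhdsWithin] with r ⟨hrδ, hrη⟩ (hr : 0 < r)
      rw [radialQuot_sub]
      have hm := measurable_radialQuot hΩ.measurableSet (w := fun y h => w y h - w' y h)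
        (hwm.sub hwm') r
      rw [← ENNReal.rpow_le_rpow_iff hp0, eLpNorm_rpow_eq hp, ENNReal.mul_rpow_of_nonneg _ _ hp0.le,
        ENNReal.mul_rpow_of_nonneg _ _ hp0.le, ← ENNReal.rpow_mul, one_div_mul_cancel hp0.ne',
        ENNReal.rpow_one, lintegral_prod _ (hm.enorm.pow_const _).aemeasurable]
      calc _ ≤ ∫⁻ θ, n * (3 * ENNReal.ofReal C * M) ^ p ∂σ := by
            refine lintegral_mono fun θ => ?_
            have hrθ : ‖r • (θ : Euc N)‖ = r := by
              rw [norm_smul, Real.norm_of_nonneg hr.le]; simp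
            have hH := H (r • (θ : Euc N)) (by rwa [hrθ]) M (fun k hk => h1 (by
              rw [dist_zero_right]; rw [hrθ] at hk; exact hk.trans_lt hrη))
            have hms : MeasurableSet {x | x + r • (θ : Euc N) ∈ Ω} :=
              hΩ.measurableSet.preimage (measurable_id.add_const _)
            have hrE : ENNReal.ofReal r ≠ 0 := by simpa using hr
            calc ∫⁻ y in Ω, ‖radialQuot Ω (fun y h => w y h - w' y h) r (θ, y)‖ₑ ^ p
                = ∫⁻ y in Ω ∩ {x | x + r • (θ : Euc N) ∈ Ω},
                    (ENNReal.ofReal r)⁻¹ ^ p * ‖taylorRem v g (r • (θ : Euc N)) y‖ₑ ^ p := by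
                  rw [inter_comm, ← Measure.restrict_restrict hms, ← lintegral_indicator hms]
                  refine lintegral_congr fun y => ?_
                  by_cases hy : y + r • (θ : Euc N) ∈ Ω
                  · rw [indicator_of_mem (by exact hy), radialQuot, if_pos hy, enorm_mul,
                      ENNReal.mul_rpow_of_nonneg _ _ hp0.le, enorm_inv hr.ne',
                      Real.enorm_of_nonneg hr.le]
                    congr 3
                    simp only [hw, hw', taylorRem, inner_add_left]
                    ring
                  · rw [indicator_of_notMem (by exact hy), radialQuot, if_neg hy]
                    simp [hp0]
              _ = (ENNReal.ofReal r)⁻¹ ^ p * ∫⁻ y in Ω ∩ {x | x + r • (θ : Euc N) ∈ Ω},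
                    ‖taylorRem v g (r • (θ : Euc N)) y‖ₑ ^ p :=
                  lintegral_const_mul _ ((measurable_taylorRem hvm hgm _).enorm.pow_const _)
              _ ≤ (ENNReal.ofReal r)⁻¹ ^ p * (n * (3 * ENNReal.ofReal (C * r) * M) ^ p) := by
                  rw [hrθ] at hH
                  gcongr
              _ = n * ((ENNReal.ofReal r)⁻¹ * (3 * ENNReal.ofReal (C * r) * M)) ^ p := by
                  rw [ENNReal.mul_rpow_of_nonneg (ENNReal.ofReal r)⁻¹ _ hp0.le]
                  ring
              _ = n * (3 * ENNReal.ofReal C * M) ^ p := by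
                  congr 2
                  rw [ENNReal.ofReal_mul hC]
                  calc _ = ((ENNReal.ofReal r)⁻¹ * ENNReal.ofReal r) *
                        (3 * ENNReal.ofReal C * M) := by ring
                    _ = _ := by rw [ENNReal.inv_mul_cancel hrE ENNReal.ofReal_ne_top, one_mul]
        _ = _ := by
            rw [lintegral_const, ENNReal.mul_rpow_of_nonneg _ M hp0.le]
            ring
    have hK : ((σ univ * n) ^ (1 / p) * (3 * ENNReal.ofReal C)) ≠ ⊤ := by
      refine ENNReal.mul_ne_top (ENNReal.rpow_ne_top_of_nonneg (by positivity) ?_) ?_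
      · exact ENNReal.mul_ne_top (measure_ne_top _ _) (by simp)
      · exact ENNReal.mul_ne_top (by simp) (by simp)
    rw [ENNReal.tendsto_nhds_zero]
    intro ε hε
    -- Adding 1 keeps c nonzero, so that division by it is legitimate.
    set c := ((σ univ * n) ^ (1 / p) * (3 * ENNReal.ofReal C)) + 1
    have hc0 : c ≠ 0 := by simp [c]
    have hct : c ≠ ⊤ := ENNReal.add_ne_top.2 ⟨hK, by simp⟩
    filter_upwards [hbound (ε / c) (ENNReal.div_pos hε.ne' hct)] with r hr
    refine hr.trans ?_
    calc _ ≤ c * (ε / c) := by gcongr; exact le_self_add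
      _ = ε := ENNReal.mul_div_cancel hc0 hct

end Lipschitz

/-! ### Mollification as averaging over translates. -/

section Mollify
variable {N : ℕ} {F : Type*} [NormedAddCommGroup F]

/-- The average of the translates of `f` with respect to `ν`. -/
noncomputable def mollify [NormedSpace ℝ F] (ν : Measure (Euc N)) (f : Euc N → F) (x : Euc N) : F :=
  ∫ t, f (x - t) ∂ν

theorem integrable_comp_sub_prod (ν : Measure (Euc N)) [IsProbabilityMeasure ν] {f : Euc N → F}
    (hfm : StronglyMeasurable f) (hf : Integrable f) :
    Integrable (fun z : Euc N × Euc N => f (z.1 - z.2)) (volume.prod ν) := by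
  have hm : StronglyMeasurable (fun z : Euc N × Euc N => f (z.1 - z.2)) :=
    hfm.comp_measurable (by fun_prop)
  rw [integrable_prod_iff' hm.aestronglyMeasurable]
  constructor
  · exact ae_of_all _ fun t => hf.comp_sub_right t
  · have : ∀ t : Euc N, ∫ x, ‖f (x - t)‖ = ∫ x, ‖f x‖ := fun t =>
      integral_sub_right_eq_self (fun x => ‖f x‖) t
    simp only [this]
    exact integrable_const _

variable [NormedSpace ℝ F]

theorem integrable_mollify (ν : Measure (Euc N)) [IsProbabilityMeasure ν] {f : Euc N → F}
    (hfm : StronglyMeasurable f) (hf : Integrable f) : Integrable (mollify ν f) :=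
  (integrable_comp_sub_prod ν hfm hf).integral_prod_left

/-- The restriction to S matters: only the values of f on the translates S - t enter, which later
confines the estimate to Ω. -/
theorem lintegral_enorm_mollify_le {ν : Measure (Euc N)} [IsProbabilityMeasure ν] {f : Euc N → F}
    (hfm : StronglyMeasurable f) {S : Set (Euc N)} {M : ℝ≥0∞}
    (hM : ∀ᵐ t ∂ν, ∫⁻ x in S, ‖f (x - t)‖ₑ ≤ M) : ∫⁻ x in S, ‖mollify ν f x‖ₑ ≤ M := by
  have hm : StronglyMeasurable (fun z : Euc N × Euc N => f (z.1 - z.2)) :=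
    hfm.comp_measurable (by fun_prop)
  have := eLpNorm_integral_le_of_forall (μ := volume.restrict S) (ν := ν) le_rfl ENNReal.one_ne_top
    (k := fun x t => f (x - t)) (C := M) hm.aestronglyMeasurable
    (by simpa only [eLpNorm_one_eq_lintegral_enorm] using hM)
  rwa [eLpNorm_one_eq_lintegral_enorm] at this

theorem lintegral_enorm_mollify_sub_le [CompleteSpace F] {ν : Measure (Euc N)} [IsProbabilityMeasure ν]
    {f : Euc N → F} (hfm : StronglyMeasurable f) (hf : Integrable f) {M : ℝ≥0∞}
    (hM : ∀ᵐ t ∂ν, ∫⁻ x, ‖f (x - t) - f x‖ₑ ≤ M) : ∫⁻ x, ‖mollify ν f x - f x‖ₑ ≤ M := by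
  have hm : StronglyMeasurable (fun z : Euc N × Euc N => f (z.1 - z.2) - f z.1) :=
    (hfm.comp_measurable (by fun_prop)).sub (hfm.comp_measurable (by fun_prop))
  have := eLpNorm_integral_le_of_forall (μ := volume) (ν := ν) le_rfl ENNReal.one_ne_top
    (k := fun x t => f (x - t) - f x) (C := M) hm.aestronglyMeasurable
    (by simpa only [eLpNorm_one_eq_lintegral_enorm] using hM)
  rw [eLpNorm_one_eq_lintegral_enorm] at this
  refine le_trans (lintegral_mono_ae ?_) this
  filter_upwards [(integrable_comp_sub_prod ν hfm hf).prod_right_ae] with x hx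
  rw [integral_sub hx (integrable_const _)]
  simp [mollify]

/-- Mollification by an even measure is self-adjoint: Fubini, a translation in x, then the symmetry
t ↦ -t. -/
theorem integral_inner_mollify {ν : Measure (Euc N)} [IsProbabilityMeasure ν]
    {H : Type*} [NormedAddCommGroup H] [InnerProductSpace ℝ H] [CompleteSpace H]
    (hν : ν.map (fun t => -t) = ν) {f φ : Euc N → H}
    (hfm : StronglyMeasurable f) (hf : Integrable f) (hφ : Continuous φ) {C : ℝ}
    (hC : ∀ x, ‖φ x‖ ≤ C) :
    ∫ x, (inner ℝ (mollify ν f x) (φ x) : ℝ) = ∫ x, inner ℝ (f x) (mollify ν φ x) := by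
  have hprod := integrable_comp_sub_prod ν hfm hf
  have hneg : ∀ x, mollify ν φ x = ∫ t, φ (x + t) ∂ν := by
    intro x
    rw [mollify]
    conv_lhs => rw [← hν]
    have := integral_map (μ := ν) (φ := fun t => -t) (f := fun t => φ (x - t))
      measurable_neg.aemeasurable
      (hφ.comp (by fun_prop : Continuous fun t => x - t)).aestronglyMeasurable
    rw [this]
    simp
  have hbd : ∀ x, Integrable (fun t => φ (x + t)) ν := fun x =>
    Integrable.of_bound (hφ.comp (by fun_prop)).aestronglyMeasurable C (ae_of_all _ fun t => hC _)
  have hI1 : Integrable (fun z : Euc N × Euc N => (inner ℝ (f (z.1 - z.2)) (φ z.1) : ℝ))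
      (volume.prod ν) := by
    refine Integrable.mono' (hprod.norm.mul_const C) ?_ (ae_of_all _ fun z => ?_)
    · exact hprod.aestronglyMeasurable.inner (hφ.comp continuous_fst).aestronglyMeasurable
    · exact (norm_inner_le_norm _ _).trans
        (mul_le_mul_of_nonneg_left (hC _) (norm_nonneg _))
  have hI2 : Integrable (fun z : Euc N × Euc N => (inner ℝ (f z.1) (φ (z.1 + z.2)) : ℝ))
      (volume.prod ν) := by
    refine Integrable.mono' ((hf.comp_fst ν).norm.mul_const C) ?_ (ae_of_all _ fun z => ?_)
    · exact (hf.comp_fst ν).aestronglyMeasurable.inner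
        (hφ.comp (by fun_prop : Continuous fun z : Euc N × Euc N =>
          z.1 + z.2)).aestronglyMeasurable
    · exact (norm_inner_le_norm _ _).trans
        (mul_le_mul_of_nonneg_left (hC _) (norm_nonneg _))
  calc ∫ x, (inner ℝ (mollify ν f x) (φ x) : ℝ)
      = ∫ x, ∫ t, (inner ℝ (f (x - t)) (φ x) : ℝ) ∂ν := by
        refine integral_congr_ae ?_
        filter_upwards [hprod.prod_right_ae] with x hx
        rw [mollify, real_inner_comm, ← integral_inner hx]
        simp_rw [real_inner_comm]
    _ = ∫ t, (∫ x, (inner ℝ (f (x - t)) (φ x) : ℝ)) ∂ν := integral_integral_swap hI1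
    _ = ∫ t, (∫ x, (inner ℝ (f x) (φ (x + t)) : ℝ)) ∂ν := by
        refine integral_congr_ae (ae_of_all _ fun t => ?_)
        beta_reduce
        rw [← integral_add_right_eq_self (fun x => (inner ℝ (f (x - t)) (φ x) : ℝ)) t]
        simp
    _ = ∫ x, ∫ t, (inner ℝ (f x) (φ (x + t)) : ℝ) ∂ν := (integral_integral_swap hI2).symm
    _ = _ := by
        refine integral_congr_ae (ae_of_all _ fun x => ?_)
        beta_reduce
        rw [hneg, ← integral_inner (hbd x)]

/-- The probability measure with density the normalized bump function `ρ`. -/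
noncomputable def mollMeasure (ρ : ContDiffBump (0 : Euc N)) : Measure (Euc N) :=
  volume.withDensity fun t => ENNReal.ofReal (ρ.normed volume t)

instance (ρ : ContDiffBump (0 : Euc N)) : IsProbabilityMeasure (mollMeasure ρ) := by
  constructor
  rw [mollMeasure, withDensity_apply _ MeasurableSet.univ, Measure.restrict_univ,
    ← ofReal_integral_eq_lintegral_ofReal ρ.integrable_normed (ae_of_all _ ρ.nonneg_normed),
    ρ.integral_normed, ENNReal.ofReal_one]

theorem mollMeasure_map_neg (ρ : ContDiffBump (0 : Euc N)) :
    (mollMeasure ρ).map (fun t => -t) = mollMeasure ρ := by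
  ext s hs
  have hc : Measurable fun t => ENNReal.ofReal (ρ.normed volume t) :=
    ρ.continuous_normed.measurable.ennreal_ofReal
  rw [Measure.map_apply measurable_neg hs, mollMeasure, withDensity_apply _ (measurable_neg hs),
    withDensity_apply _ hs]
  have := (Measure.measurePreserving_neg (volume : Measure (Euc N))).setLIntegral_comp_preimage hs hc
  rw [← this]
  simp only [ρ.normed_neg]

theorem ae_mollMeasure_norm_lt (ρ : ContDiffBump (0 : Euc N)) :
    ∀ᵐ t ∂(mollMeasure ρ), ‖t‖ < ρ.rOut := by
  rw [mollMeasure, ae_withDensity_iff ρ.continuous_normed.measurable.ennreal_ofReal]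
  refine ae_of_all _ fun t ht => ?_
  by_contra hlt
  apply ht
  have : t ∉ Function.support (ρ.normed volume) := by
    rw [ρ.support_normed_eq]
    simpa using hlt
  rw [Function.notMem_support.1 this, ENNReal.ofReal_zero]

/-- Gives access to smoothness, differentiation and pointwise convergence of convolutions, while
estimates use the averaging form. -/
theorem mollify_mollMeasure_eq_convolution (ρ : ContDiffBump (0 : Euc N)) (f : Euc N → F) :
    mollify (mollMeasure ρ) f =
      convolution (ρ.normed volume) f (ContinuousLinearMap.lsmul ℝ ℝ) volume := by
  ext x
  rw [mollify, mollMeasure, convolution_def, integral_withDensity_eq_integral_toReal_smul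
    ρ.continuous_normed.measurable.ennreal_ofReal (by simp)]
  simp only [ENNReal.toReal_ofReal (ρ.nonneg_normed _), ContinuousLinearMap.lsmul_apply]

theorem contDiff_mollify (ρ : ContDiffBump (0 : Euc N)) {f : Euc N → F}
    (hf : LocallyIntegrable f) : ContDiff ℝ ∞ (mollify (mollMeasure ρ) f) := by
  rw [mollify_mollMeasure_eq_convolution]
  exact ρ.hasCompactSupport_normed.contDiff_convolution_left _ ρ.contDiff_normed hf

theorem fderiv_mollify_apply (ρ : ContDiffBump (0 : Euc N)) {φ : Euc N → F}
    (hφ : ContDiff ℝ ∞ φ) (hφc : HasCompactSupport φ) (x a : Euc N) :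
    fderiv ℝ (mollify (mollMeasure ρ) φ) x a =
      mollify (mollMeasure ρ) (fun y => fderiv ℝ φ y a) x := by
  rw [mollify_mollMeasure_eq_convolution, mollify_mollMeasure_eq_convolution]
  have hloc : LocallyIntegrable (ρ.normed volume) (volume : Measure (Euc N)) :=
    ρ.integrable_normed.locallyIntegrable
  rw [(hφc.hasFDerivAt_convolution_right (ContinuousLinearMap.lsmul ℝ ℝ) hloc
    (hφ.of_le (by simp)) x).fderiv]
  exact convolution_precompR_apply _ hloc (hφc.fderiv ℝ) (hφ.continuous_fderiv (by simp)) x a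

theorem tsupport_mollify_subset (ρ : ContDiffBump (0 : Euc N)) (φ : Euc N → F) :
    tsupport (mollify (mollMeasure ρ) φ) ⊆ Metric.cthickening ρ.rOut (tsupport φ) := by
  refine closure_minimal (fun x hx => ?_) Metric.isClosed_cthickening
  by_contra hxn
  apply hx
  rw [mollify, integral_eq_zero_of_ae]
  filter_upwards [ae_mollMeasure_norm_lt ρ] with t ht
  by_contra hne
  apply hxn
  have hmem : x - t ∈ tsupport φ := subset_tsupport _ hne
  refine Metric.mem_cthickening_of_dist_le x (x - t) _ _ hmem ?_
  rw [dist_eq_norm]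
  simpa using ht.le

end Mollify

/-! ### The total variation of Dv + f and its mollification. -/

section Pairing
variable {N : ℕ}

theorem exists_cutoff {K U : Set (Euc N)} (hK : IsCompact K) (hU : IsOpen U) (hKU : K ⊆ U) :
    ∃ χ : Euc N → ℝ, ContDiff ℝ ∞ χ ∧ HasCompactSupport χ ∧ tsupport χ ⊆ U ∧
      (∀ x, 0 ≤ χ x ∧ χ x ≤ 1) ∧ ∀ x ∈ K, χ =ᶠ[𝓝 x] 1 := by
  obtain ⟨δ, hδ, hδU⟩ := hK.exists_cthickening_subset_open hU hKU
  obtain ⟨χ, hχ, hr, hs, h1⟩ := exists_contMDiff_support_eq_eq_one_iff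
    (modelWithCornersSelf ℝ (Euc N)) (n := (⊤ : ℕ∞)) (s := Metric.thickening δ K)
    (t := Metric.cthickening (δ / 2) K) Metric.isOpen_thickening Metric.isClosed_cthickening
    (Metric.cthickening_subset_thickening' hδ (by linarith) K)
  have hts : tsupport χ ⊆ Metric.cthickening δ K := by
    rw [tsupport, hs]
    exact Metric.closure_thickening_subset_cthickening δ K
  refine ⟨χ, hχ.contDiff, ?_, hts.trans hδU, fun x => ?_, fun x hx => ?_⟩
  · exact hK.cthickening.of_isClosed_subset (isClosed_tsupport χ) hts
  · exact hr (mem_range_self x)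
  · have : Metric.cthickening (δ / 2) K ∈ 𝓝 x :=
      mem_of_superset (Metric.isOpen_thickening.mem_nhds
        (Metric.self_subset_thickening (by linarith : 0 < δ / 2) K hx))
        (Metric.thickening_subset_cthickening _ _)
    filter_upwards [this] with y hy
    exact (h1 y).1 hy

/-- The pairing `∫ v div φ - ⟨f, φ⟩`. -/
noncomputable def bvPairing (v : Euc N → ℝ) (f φ : Euc N → Euc N) : ℝ :=
  ∫ x, (v x * divergence φ x - inner ℝ (f x) (φ x))

/-- The total variation on `U` of the distribution `Dv + f`. -/
noncomputable def bvVar (v : Euc N → ℝ) (f : Euc N → Euc N) (U : Set (Euc N)) : ℝ≥0∞ :=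
  ⨆ φ ∈ testFields U, ENNReal.ofReal (bvPairing v f φ)

theorem continuous_divergence {φ : Euc N → Euc N} (hφ : ContDiff ℝ ∞ φ) :
    Continuous (divergence φ) := by
  unfold divergence
  refine continuous_finsetSum _ fun i _ => ?_
  have : Continuous fun x => fderiv ℝ φ x (EuclideanSpace.single i 1) :=
    (hφ.continuous_fderiv (by simp)).clm_apply continuous_const
  exact (EuclideanSpace.proj i : Euc N →L[ℝ] ℝ).continuous.comp this

theorem divergence_eq_zero_of_notMem {φ : Euc N → Euc N} {x : Euc N} (hx : x ∉ tsupport φ) :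
    divergence φ x = 0 := by
  have : fderiv ℝ φ x = 0 := by
    by_contra h
    exact hx (support_fderiv_subset ℝ h)
  simp [divergence, this]

theorem hasCompactSupport_divergence {φ : Euc N → Euc N} (hφc : HasCompactSupport φ) :
    HasCompactSupport (divergence φ) := by
  refine hφc.of_isClosed_subset (isClosed_tsupport _) (closure_minimal ?_ (isClosed_tsupport _))
  intro x hx
  by_contra h
  exact hx (divergence_eq_zero_of_notMem h)

theorem integrable_pairing {v : Euc N → ℝ} {f φ : Euc N → Euc N} (hv : Integrable v)
    (hf : Integrable f) (hφ : ContDiff ℝ ∞ φ) (hφc : HasCompactSupport φ) :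
    Integrable (fun x => v x * divergence φ x) ∧ Integrable fun x => (inner ℝ (f x) (φ x) : ℝ) := by
  obtain ⟨C, hC⟩ :=
    (hasCompactSupport_divergence hφc).exists_bound_of_continuous (continuous_divergence hφ)
  obtain ⟨C', hC'⟩ := hφc.exists_bound_of_continuous hφ.continuous
  constructor
  · exact hv.mul_bdd (c := C) (continuous_divergence hφ).aestronglyMeasurable (ae_of_all _ hC)
  · refine Integrable.mono' (hf.norm.mul_const C') ?_ (ae_of_all _ fun x => ?_)
    · exact hf.aestronglyMeasurable.inner hφ.continuous.aestronglyMeasurable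
    · exact (norm_inner_le_norm _ _).trans (mul_le_mul_of_nonneg_left (hC' _) (norm_nonneg _))

theorem divergence_add {φ ψ : Euc N → Euc N} (hφ : ContDiff ℝ ∞ φ) (hψ : ContDiff ℝ ∞ ψ)
    (x : Euc N) : divergence (φ + ψ) x = divergence φ x + divergence ψ x := by
  simp only [divergence, ← Finset.sum_add_distrib]
  refine Finset.sum_congr rfl fun i _ => ?_
  rw [fderiv_add ((hφ.differentiable (by simp)) x) ((hψ.differentiable (by simp)) x)]
  rfl

theorem bvPairing_add {v : Euc N → ℝ} {f φ ψ : Euc N → Euc N} (hv : Integrable v)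
    (hf : Integrable f) (hφ : ContDiff ℝ ∞ φ) (hφc : HasCompactSupport φ)
    (hψ : ContDiff ℝ ∞ ψ) (hψc : HasCompactSupport ψ) :
    bvPairing v f (φ + ψ) = bvPairing v f φ + bvPairing v f ψ := by
  obtain ⟨a1, a2⟩ := integrable_pairing hv hf hφ hφc
  obtain ⟨b1, b2⟩ := integrable_pairing hv hf hψ hψc
  rw [bvPairing, bvPairing, bvPairing, ← integral_add (by exact a1.sub a2) (by exact b1.sub b2)]
  refine integral_congr_ae (ae_of_all _ fun x => ?_)
  simp only [divergence_add hφ hψ, Pi.add_apply, inner_add_right]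
  ring

/-- A cutoff χ splits a test field φ as χφ + (1 - χ)φ, admissible on U and on V respectively; both
pieces keep norm at most 1 because 0 ≤ χ ≤ 1. -/
theorem bvVar_union_le {v : Euc N → ℝ} {f : Euc N → Euc N} (hv : Integrable v)
    (hf : Integrable f) {U V : Set (Euc N)} (hU : IsOpen U) (hV : IsOpen V) :
    bvVar v f (U ∪ V) ≤ bvVar v f U + bvVar v f V := by
  refine iSup₂_le fun φ hφ => ?_
  obtain ⟨hφs, hφc, hφt, hφ1⟩ := hφ
  -- Outside V the support of φ is a compact subset of U. With χ = 1 near it, (1 - χ)φ is supported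
  -- in V.
  have hK : IsCompact (tsupport φ \ V) := IsCompact.diff hφc hV
  obtain ⟨χ, hχ, hχc, hχU, hχ01, hχ1⟩ := exists_cutoff hK hU (fun x hx => by
    rcases hφt hx.1 with h | h
    · exact h
    · exact absurd h hx.2)
  have hs1 : ContDiff ℝ ∞ fun x => χ x • φ x := hχ.smul hφs
  have hs2 : ContDiff ℝ ∞ fun x => (1 - χ x) • φ x := (contDiff_const.sub hχ).smul hφs
  have hc : ∀ c : Euc N → ℝ, HasCompactSupport fun x => c x • φ x := fun c =>
    hφc.mono (Function.support_smul_subset_right c φ)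
  have hc1 : HasCompactSupport fun x => χ x • φ x := hc χ
  have hc2 : HasCompactSupport fun x => (1 - χ x) • φ x := hc fun x => 1 - χ x
  have hn : ∀ c : ℝ, 0 ≤ c → c ≤ 1 → ∀ x, ‖c • φ x‖ ≤ 1 := fun c h0 h1 x => by
    rw [norm_smul, Real.norm_of_nonneg h0]
    exact mul_le_one₀ h1 (norm_nonneg _) (hφ1 x)
  have hm1 : (fun x => χ x • φ x) ∈ testFields U :=
    ⟨hs1, hc1, (tsupport_smul_subset_left χ φ).trans hχU, fun x => hn _ (hχ01 x).1 (hχ01 x).2 x⟩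
  have hm2 : (fun x => (1 - χ x) • φ x) ∈ testFields V := by
    refine ⟨hs2, hc2, fun x hx => ?_,
      fun x => hn _ (by linarith [(hχ01 x).2]) (by linarith [(hχ01 x).1]) x⟩
    by_contra hxV
    have hxφ : x ∈ tsupport φ := tsupport_smul_subset_right (fun x => 1 - χ x) φ hx
    refine (notMem_tsupport_iff_eventuallyEq.2 ?_) hx
    filter_upwards [hχ1 x ⟨hxφ, hxV⟩] with y hy
    simp [hy]
  have hsum : φ = (fun x => χ x • φ x) + fun x => (1 - χ x) • φ x := by
    ext1 x
    simp only [Pi.add_apply, sub_smul, one_smul]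
    abel
  rw [hsum, bvPairing_add hv hf hs1 hc1 hs2 hc2]
  refine ENNReal.ofReal_add_le.trans (add_le_add ?_ ?_)
  · exact le_iSup₂ (f := fun φ _ => ENNReal.ofReal (bvPairing v f φ)) _ hm1
  · exact le_iSup₂ (f := fun φ _ => ENNReal.ofReal (bvPairing v f φ)) _ hm2

theorem divergence_mollify (ρ : ContDiffBump (0 : Euc N)) {φ : Euc N → Euc N}
    (hφ : ContDiff ℝ ∞ φ) (hφc : HasCompactSupport φ) (x : Euc N) :
    divergence (mollify (mollMeasure ρ) φ) x = mollify (mollMeasure ρ) (divergence φ) x := by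
  have hint : ∀ i : Fin N, Integrable
      (fun t => fderiv ℝ φ (x - t) (EuclideanSpace.single i 1)) (mollMeasure ρ) := by
    intro i
    have hc : Continuous fun y => fderiv ℝ φ y (EuclideanSpace.single i 1) :=
      (hφ.continuous_fderiv (by simp)).clm_apply continuous_const
    obtain ⟨C, hC⟩ := (hφc.fderiv_apply ℝ _).exists_bound_of_continuous hc
    exact Integrable.of_bound (hc.comp (by fun_prop)).aestronglyMeasurable C
      (ae_of_all _ fun t => hC _)
  simp only [divergence, fderiv_mollify_apply ρ hφ hφc]
  simp only [mollify, divergence]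
  rw [integral_finsetSum]
  · refine Finset.sum_congr rfl fun i _ => ?_
    exact ((EuclideanSpace.proj i : Euc N →L[ℝ] ℝ).integral_comp_comm (hint i)).symm
  · intro i _
    exact (EuclideanSpace.proj i : Euc N →L[ℝ] ℝ).integrable_comp (hint i)

theorem norm_mollify_le {F : Type*} [NormedAddCommGroup F] [NormedSpace ℝ F]
    (ν : Measure (Euc N)) [IsProbabilityMeasure ν] {φ : Euc N → F} {C : ℝ}
    (hC : ∀ x, ‖φ x‖ ≤ C) (x : Euc N) : ‖mollify ν φ x‖ ≤ C := by
  have := norm_integral_le_of_norm_le_const (μ := ν) (ae_of_all _ fun t => hC (x - t))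
  simpa [mollify] using this

theorem mollify_mem_testFields (ρ : ContDiffBump (0 : Euc N)) {K O : Set (Euc N)}
    {φ : Euc N → Euc N} (hφ : ContDiff ℝ ∞ φ) (hφc : HasCompactSupport φ)
    (hK : tsupport φ ⊆ K) (hφ1 : ∀ x, ‖φ x‖ ≤ 1) (hKO : Metric.cthickening ρ.rOut K ⊆ O) :
    mollify (mollMeasure ρ) φ ∈ testFields O := by
  refine ⟨contDiff_mollify ρ hφ.continuous.locallyIntegrable, ?_, ?_, norm_mollify_le _ hφ1⟩
  · exact IsCompact.of_isClosed_subset (IsCompact.cthickening hφc) (isClosed_tsupport _)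
      (tsupport_mollify_subset ρ φ)
  · exact (tsupport_mollify_subset ρ φ).trans
      ((Metric.cthickening_subset_of_subset _ hK).trans hKO)

/-- Self-adjointness transfers the mollification from the test field to both v and f, using that it
commutes with the divergence. -/
theorem bvPairing_mollify (ρ : ContDiffBump (0 : Euc N)) {v : Euc N → ℝ} {f φ : Euc N → Euc N}
    (hvm : StronglyMeasurable v) (hfm : StronglyMeasurable f) (hv : Integrable v)
    (hf : Integrable f) (hφ : ContDiff ℝ ∞ φ) (hφc : HasCompactSupport φ) :
    bvPairing v f (mollify (mollMeasure ρ) φ) =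
      bvPairing (mollify (mollMeasure ρ) v) (mollify (mollMeasure ρ) f) φ := by
  set ν := mollMeasure ρ
  obtain ⟨C, hC⟩ :=
    (hasCompactSupport_divergence hφc).exists_bound_of_continuous (continuous_divergence hφ)
  obtain ⟨C', hC'⟩ := hφc.exists_bound_of_continuous hφ.continuous
  have e1 := integral_inner_mollify (mollMeasure_map_neg ρ) hvm hv (continuous_divergence hφ) hC
  have e2 := integral_inner_mollify (mollMeasure_map_neg ρ) hfm hf hφ.continuous hC'
  have hms : ContDiff ℝ ∞ (mollify ν φ) := contDiff_mollify ρ hφ.continuous.locallyIntegrable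
  have hmc : HasCompactSupport (mollify ν φ) :=
    IsCompact.of_isClosed_subset (IsCompact.cthickening hφc) (isClosed_tsupport _)
      (tsupport_mollify_subset ρ φ)
  obtain ⟨a1, a2⟩ := integrable_pairing hv hf hms hmc
  obtain ⟨b1, b2⟩ := integrable_pairing (integrable_mollify ν hvm hv)
    (integrable_mollify ν hfm hf) hφ hφc
  rw [bvPairing, bvPairing, integral_sub a1 a2, integral_sub b1 b2, e2]
  congr 1
  simp only [RCLike.inner_apply, conj_trivial] at e1
  calc ∫ x, v x * divergence (mollify ν φ) x = ∫ x, mollify ν (divergence φ) x * v x :=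
        integral_congr_ae (ae_of_all _ fun x => by
          beta_reduce
          rw [divergence_mollify ρ hφ hφc, mul_comm])
    _ = ∫ x, mollify ν v x * divergence φ x := by
        rw [← e1]
        exact integral_congr_ae (ae_of_all _ fun x => mul_comm _ _)

/-- The smooth field `∇(v_ρ) + f_ρ`, where `v_ρ`, `f_ρ` are the mollifications. -/
noncomputable def mollGrad (ρ : ContDiffBump (0 : Euc N)) (v : Euc N → ℝ) (f : Euc N → Euc N)
    (x : Euc N) : Euc N :=
  (InnerProductSpace.toDual ℝ (Euc N)).symm (fderiv ℝ (mollify (mollMeasure ρ) v) x) +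
    mollify (mollMeasure ρ) f x

theorem inner_mollGrad (ρ : ContDiffBump (0 : Euc N)) (v : Euc N → ℝ) (f : Euc N → Euc N)
    (x h : Euc N) : (inner ℝ (mollGrad ρ v f x) h : ℝ) =
      fderiv ℝ (mollify (mollMeasure ρ) v) x h + inner ℝ (mollify (mollMeasure ρ) f x) h := by
  rw [mollGrad, inner_add_left, InnerProductSpace.toDual_symm_apply]

theorem contDiff_mollGrad (ρ : ContDiffBump (0 : Euc N)) {v : Euc N → ℝ} {f : Euc N → Euc N}
    (hv : Integrable v) (hf : Integrable f) : ContDiff ℝ ∞ (mollGrad ρ v f) := by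
  refine ContDiff.add ?_ (contDiff_mollify ρ hf.locallyIntegrable)
  refine (InnerProductSpace.toDual ℝ (Euc N)).symm.contDiff.comp ?_
  exact (contDiff_mollify ρ hv.locallyIntegrable).fderiv_right (by simp)

theorem integral_fderiv_apply_self {V : Euc N → ℝ} {φ : Euc N → Euc N} (hV : ContDiff ℝ ∞ V)
    (hφ : ContDiff ℝ ∞ φ) (hφc : HasCompactSupport φ) :
    ∫ x, fderiv ℝ V x (φ x) = -∫ x, V x * divergence φ x := by
  have hcoord : ∀ i : Fin N, ContDiff ℝ ∞ fun x => φ x i := fun i =>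
    (EuclideanSpace.proj i : Euc N →L[ℝ] ℝ).contDiff.comp hφ
  have hcc : ∀ i : Fin N, HasCompactSupport fun x => φ x i := fun i =>
    hφc.comp_left (g := fun y : Euc N => y i) rfl
  have hfd : ∀ (i : Fin N) x, (fderiv ℝ φ x (EuclideanSpace.single i 1)) i =
      fderiv ℝ (fun y => φ y i) x (EuclideanSpace.single i 1) := by
    intro i x
    have := ((EuclideanSpace.proj i : Euc N →L[ℝ] ℝ).hasFDerivAt.comp x
      ((hφ.differentiable (by simp)) x).hasFDerivAt).fderiv
    change _ = fderiv ℝ ((EuclideanSpace.proj i : Euc N →L[ℝ] ℝ) ∘ φ) x _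
    rw [this]
    rfl
  have hsum : ∀ x, fderiv ℝ V x (φ x) =
      ∑ i, fderiv ℝ V x (EuclideanSpace.single i 1) * φ x i := by
    intro x
    have : φ x = ∑ i, φ x i • (EuclideanSpace.single i (1 : ℝ) : Euc N) := by
      simpa using ((EuclideanSpace.basisFun (Fin N) ℝ).sum_repr (φ x)).symm
    conv_lhs => rw [this]
    rw [map_sum]
    exact Finset.sum_congr rfl fun i _ => by rw [map_smul, smul_eq_mul, mul_comm]
  have hVd : ∀ a : Euc N, Continuous fun x => fderiv ℝ V x a := fun a =>
    (hV.continuous_fderiv (by simp)).clm_apply continuous_const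
  have hI1 : ∀ i : Fin N, Integrable
      fun x => fderiv ℝ V x (EuclideanSpace.single i 1) * φ x i := fun i =>
    ((hVd _).mul (hcoord i).continuous).integrable_of_hasCompactSupport (hcc i).mul_left
  have hI2 : ∀ i : Fin N, Integrable
      fun x => V x * fderiv ℝ (fun y => φ y i) x (EuclideanSpace.single i 1) := fun i =>
    (hV.continuous.mul (((hcoord i).continuous_fderiv (by simp)).clm_apply
      continuous_const)).integrable_of_hasCompactSupport ((hcc i).fderiv_apply ℝ _).mul_left
  have hI3 : ∀ i : Fin N, Integrable fun x => V x * φ x i := fun i =>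
    (hV.continuous.mul (hcoord i).continuous).integrable_of_hasCompactSupport (hcc i).mul_left
  simp_rw [hsum, divergence, hfd, Finset.mul_sum]
  rw [integral_finsetSum _ fun i _ => hI1 i, integral_finsetSum _ fun i _ => hI2 i,
    ← Finset.sum_neg_distrib]
  refine Finset.sum_congr rfl fun i _ => ?_
  rw [integral_mul_fderiv_eq_neg_fderiv_mul_of_integrable (hI1 i) (hI2 i) (hI3 i)
    (fun x _ => hV.differentiable (by simp) x) (fun x _ => (hcoord i).differentiable (by simp) x),
    neg_neg]

/-- Integration by parts identifies the smooth field with minus the mollified distribution, so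
bounds on the variation of (v, f) become L¹ bounds on `mollGrad` and conversely. -/
theorem integral_inner_mollGrad (ρ : ContDiffBump (0 : Euc N)) {v : Euc N → ℝ}
    {f φ : Euc N → Euc N} (hvm : StronglyMeasurable v) (hfm : StronglyMeasurable f)
    (hv : Integrable v) (hf : Integrable f) (hφ : ContDiff ℝ ∞ φ) (hφc : HasCompactSupport φ) :
    ∫ x, (inner ℝ (mollGrad ρ v f x) (φ x) : ℝ) =
      -bvPairing v f (mollify (mollMeasure ρ) φ) := by
  rw [bvPairing_mollify ρ hvm hfm hv hf hφ hφc]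
  simp_rw [inner_mollGrad]
  have hVs : ContDiff ℝ ∞ (mollify (mollMeasure ρ) v) := contDiff_mollify ρ hv.locallyIntegrable
  obtain ⟨b1, b2⟩ := integrable_pairing (integrable_mollify (mollMeasure ρ) hvm hv)
    (integrable_mollify (mollMeasure ρ) hfm hf) hφ hφc
  have hI : Integrable fun x => fderiv ℝ (mollify (mollMeasure ρ) v) x (φ x) := by
    refine Continuous.integrable_of_hasCompactSupport
      ((hVs.continuous_fderiv (by simp)).clm_apply hφ.continuous) ?_
    refine hφc.mono fun x hx => ?_
    contrapose! hx
    simp only [Function.mem_support, not_not] at hx ⊢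
    simp [hx]
  rw [integral_add hI b2, bvPairing, integral_sub b1 b2, integral_fderiv_apply_self hVs hφ hφc]
  ring

/-- The L¹ norm of G on K is nearly attained by pairing G with a smooth regularization of -G/|G| cut
off inside O. Once mollified, this field is still admissible on O as soon as ρ is smaller than the
margin δ, which does not depend on the regularization. -/
theorem setLIntegral_mollGrad_le {v : Euc N → ℝ} {f : Euc N → Euc N}
    (hvm : StronglyMeasurable v) (hfm : StronglyMeasurable f) (hv : Integrable v)
    (hf : Integrable f) {K O : Set (Euc N)} (hK : IsCompact K) (hO : IsOpen O) (hKO : K ⊆ O) :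
    ∃ δ > 0, ∀ ρ : ContDiffBump (0 : Euc N), ρ.rOut < δ →
      ∫⁻ x in K, ‖mollGrad ρ v f x‖ₑ ≤ bvVar v f O := by
  obtain ⟨χ, hχ, hχc, hχO, hχ01, hχ1⟩ := exists_cutoff hK hO hKO
  obtain ⟨δ, hδ, hδO⟩ := IsCompact.exists_cthickening_subset_open hχc hO hχO
  refine ⟨δ, hδ, fun ρ hρ => ?_⟩
  set G := mollGrad ρ v f
  have hG : ContDiff ℝ ∞ G := contDiff_mollGrad ρ hv hf
  have hIχ : Integrable χ := hχ.continuous.integrable_of_hasCompactSupport hχc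
  have hIG : Integrable fun x => χ x * ‖G x‖ :=
    (hχ.continuous.mul hG.continuous.norm).integrable_of_hasCompactSupport hχc.mul_right
  have hKle : ∫⁻ x in K, ‖G x‖ₑ ≤ ENNReal.ofReal (∫ x, χ x * ‖G x‖) := by
    rw [ofReal_integral_eq_lintegral_ofReal hIG
      (ae_of_all _ fun x => mul_nonneg (hχ01 x).1 (norm_nonneg _)),
      ← lintegral_indicator hK.measurableSet]
    refine lintegral_mono fun x => ?_
    by_cases hx : x ∈ K
    · rw [indicator_of_mem hx, (hχ1 x hx).eq_of_nhds, Pi.one_apply, one_mul, ofReal_norm]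
    · rw [indicator_of_notMem hx]; exact zero_le
  refine hKle.trans ?_
  have hη : ∀ η > 0, ENNReal.ofReal (∫ x, χ x * ‖G x‖) ≤
      bvVar v f O + ENNReal.ofReal (η * ∫ x, χ x) := by
    intro η hη
    -- A smooth positive substitute for |G|, lying between |G| and |G| + η; the field -χG/q then has
    -- norm at most 1.
    set q : Euc N → ℝ := fun x => √(‖G x‖ ^ 2 + η ^ 2) with hq
    have hqpos : ∀ x, 0 < ‖G x‖ ^ 2 + η ^ 2 := fun x => by positivity
    have hqs : ContDiff ℝ ∞ q := (hG.norm_sq ℝ |>.add contDiff_const).sqrt fun x => (hqpos x).ne'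
    have hq0 : ∀ x, 0 < q x := fun x => Real.sqrt_pos.2 (hqpos x)
    have hqG : ∀ x, ‖G x‖ ≤ q x := fun x => Real.le_sqrt_of_sq_le (by nlinarith)
    have hqle : ∀ x, q x ≤ ‖G x‖ + η := fun x => by
      rw [hq]
      refine Real.sqrt_le_iff.2 ⟨by positivity, ?_⟩
      nlinarith [norm_nonneg (G x)]
    set φ : Euc N → Euc N := fun x => -((χ x / q x) • G x) with hφdef
    have hφs : ContDiff ℝ ∞ φ := ((hχ.div hqs fun x => (hq0 x).ne').smul hG).neg
    have hsub : tsupport φ ⊆ tsupport χ := by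
      refine closure_mono fun x hx => ?_
      contrapose! hx
      simp only [Function.mem_support, not_not] at hx ⊢
      simp [hφdef, hx]
    have hφc : HasCompactSupport φ := hχc.of_isClosed_subset (isClosed_tsupport _) hsub
    have hφ1 : ∀ x, ‖φ x‖ ≤ 1 := fun x => by
      rw [norm_neg, norm_smul, norm_div, Real.norm_of_nonneg (hχ01 x).1,
        Real.norm_of_nonneg (hq0 x).le, div_mul_eq_mul_div, div_le_one (hq0 x)]
      exact (mul_le_of_le_one_left (norm_nonneg _) (hχ01 x).2).trans (hqG x)
    have hmem := mollify_mem_testFields ρ hφs hφc hsub hφ1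
      ((Metric.cthickening_mono hρ.le _).trans hδO)
    have hpair := integral_inner_mollGrad ρ hvm hfm hv hf hφs hφc
    have hIin : Integrable fun x => (inner ℝ (G x) (φ x) : ℝ) := by
      refine Continuous.integrable_of_hasCompactSupport (hG.continuous.inner hφs.continuous) ?_
      refine hφc.mono fun x hx => ?_
      contrapose! hx
      simp only [Function.mem_support, not_not] at hx ⊢
      simp [hx]
    have hle : ∫ x, χ x * ‖G x‖ ≤ bvPairing v f (mollify (mollMeasure ρ) φ) + η * ∫ x, χ x := by
      rw [← neg_eq_iff_eq_neg.2 hpair, ← integral_neg, ← integral_const_mul,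
        ← integral_add (by exact hIin.neg) (hIχ.const_mul η)]
      refine integral_mono hIG (hIin.neg.add (hIχ.const_mul η)) fun x => ?_
      have h0 : (inner ℝ (mollGrad ρ v f x) (G x) : ℝ) = ‖G x‖ ^ 2 := real_inner_self_eq_norm_sq (G x)
      simp only [hφdef, inner_neg_right, neg_neg, inner_smul_right, h0]
      -- Since q ≤ |G| + η, multiplying by q gives (|G| - η)(|G| + η) ≤ |G|² when |G| ≥ η; otherwise
      -- the left side is negative.
      have h1 : ‖G x‖ - η ≤ ‖G x‖ ^ 2 / q x := by
        rw [le_div_iff₀ (hq0 x)]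
        by_cases h : 0 ≤ ‖G x‖ - η
        · nlinarith [hqle x, mul_le_mul_of_nonneg_left (hqle x) h]
        · nlinarith [hq0 x, sq_nonneg ‖G x‖]
      have h2 := mul_le_mul_of_nonneg_left h1 (hχ01 x).1
      have h3 : χ x / q x * ‖G x‖ ^ 2 = χ x * (‖G x‖ ^ 2 / q x) := by ring
      show χ x * ‖G x‖ ≤ χ x / q x * ‖G x‖ ^ 2 + η * χ x
      rw [h3]
      linarith
    refine (ENNReal.ofReal_le_ofReal hle).trans (ENNReal.ofReal_add_le.trans ?_)
    gcongr
    exact le_iSup₂ (f := fun φ _ => ENNReal.ofReal (bvPairing v f φ)) _ hmem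
  have hlim : Tendsto (fun η : ℝ => bvVar v f O + ENNReal.ofReal (η * ∫ x, χ x)) (𝓝[>] 0)
      (𝓝 (bvVar v f O + ENNReal.ofReal (0 * ∫ x, χ x))) := by
    refine tendsto_const_nhds.add (ENNReal.tendsto_ofReal ?_)
    exact (tendsto_id.mono_left nhdsWithin_le_nhds).mul_const _
  rw [zero_mul, ENNReal.ofReal_zero, add_zero] at hlim
  exact ge_of_tendsto hlim (by filter_upwards [self_mem_nhdsWithin] with η h using hη η h)

end Pairing

/-! ### Upper bound for the quotients of BV functions. -/

section Upper
variable {N : ℕ}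

theorem exists_lintegral_translate_sub_le {F : Type*} [NormedAddCommGroup F] {f : Euc N → F}
    (hf : Integrable f) {M : ℝ≥0∞} (hM : 0 < M) :
    ∃ δ > 0, ∀ k : Euc N, ‖k‖ < δ → ∫⁻ x, ‖f (x + k) - f x‖ₑ ≤ M := by
  have := (tendsto_eLpNorm_translate_sub le_rfl ENNReal.one_ne_top
    (memLp_one_iff_integrable.2 hf)).eventually (Iic_mem_nhds hM)
  rw [Metric.eventually_nhds_iff] at this
  obtain ⟨δ, hδ, h⟩ := this
  refine ⟨δ, hδ, fun k hk => ?_⟩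
  have h1 := h (y := k) (by simpa using hk)
  rwa [eLpNorm_one_eq_lintegral_enorm] at h1

/-- The increment `v(x+h) - v(x) + ⟨f(x), h⟩`. -/
noncomputable def bvDiff (v : Euc N → ℝ) (f : Euc N → Euc N) (h x : Euc N) : ℝ :=
  v (x + h) - v x + inner ℝ (f x) h

theorem stronglyMeasurable_bvDiff {v : Euc N → ℝ} {f : Euc N → Euc N}
    (hvm : StronglyMeasurable v) (hfm : StronglyMeasurable f) (h : Euc N) :
    StronglyMeasurable (bvDiff v f h) :=
  ((hvm.comp_measurable (by fun_prop)).sub hvm).add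
    (hfm.measurable.inner measurable_const).stronglyMeasurable

theorem integrable_bvDiff {v : Euc N → ℝ} {f : Euc N → Euc N} (hv : Integrable v)
    (hf : Integrable f) (h : Euc N) : Integrable (bvDiff v f h) :=
  ((hv.comp_add_right h).sub hv).add (hf.inner_const h)

theorem lintegral_bvDiff_translate_le {v : Euc N → ℝ} {f : Euc N → Euc N}
    (hvm : StronglyMeasurable v) (hfm : StronglyMeasurable f) {h k : Euc N} {M : ℝ≥0∞}
    (hv : ∫⁻ x, ‖v (x + k) - v x‖ₑ ≤ M) (hf : ∫⁻ x, ‖f (x + k) - f x‖ₑ ≤ M) :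
    ∫⁻ x, ‖bvDiff v f h (x + k) - bvDiff v f h x‖ₑ ≤ 2 * M + ENNReal.ofReal ‖h‖ * M := by
  have hvm' := hvm.measurable
  have hfm' := hfm.measurable
  have m1 : Measurable fun x => ‖v (x + k) - v x‖ₑ := by fun_prop
  have m2 : Measurable fun x => ‖v (x + h + k) - v (x + h)‖ₑ := by fun_prop
  have m3 : Measurable fun x => ‖f (x + k) - f x‖ₑ := by fun_prop
  calc _ ≤ ∫⁻ x, ((‖v (x + h + k) - v (x + h)‖ₑ + ‖v (x + k) - v x‖ₑ) +
        ENNReal.ofReal ‖h‖ * ‖f (x + k) - f x‖ₑ) := by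
        refine lintegral_mono fun x => ?_
        have e : bvDiff v f h (x + k) - bvDiff v f h x =
            ((v (x + h + k) - v (x + h)) - (v (x + k) - v x)) +
              inner ℝ (f (x + k) - f x) h := by
          simp only [bvDiff, inner_sub_left, add_right_comm x k h]
          ring
        rw [e]
        refine (enorm_add_le _ _).trans (add_le_add (enorm_sub_le) ?_)
        rw [← ofReal_norm, ← ofReal_norm, ← ENNReal.ofReal_mul (norm_nonneg _), mul_comm]
        exact ENNReal.ofReal_le_ofReal (norm_inner_le_norm _ _)
    _ = ((∫⁻ x, ‖v (x + h + k) - v (x + h)‖ₑ) + ∫⁻ x, ‖v (x + k) - v x‖ₑ) +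
        ENNReal.ofReal ‖h‖ * ∫⁻ x, ‖f (x + k) - f x‖ₑ := by
        rw [lintegral_add_left (by exact m2.add m1), lintegral_add_left m2,
          lintegral_const_mul _ m3]
    _ ≤ (M + M) + ENNReal.ofReal ‖h‖ * M := by
        rw [lintegral_add_right_eq_self (fun x => ‖v (x + k) - v x‖ₑ) h]
        gcongr
    _ = _ := by rw [two_mul]

theorem integrable_comp_sub_mollMeasure {F : Type*} [NormedAddCommGroup F] [NormedSpace ℝ F]
    (ρ : ContDiffBump (0 : Euc N)) {f : Euc N → F} (hf : Integrable f) (x : Euc N) :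
    Integrable (fun t => f (x - t)) (mollMeasure ρ) := by
  rw [mollMeasure, integrable_withDensity_iff_integrable_smul'
    ρ.continuous_normed.measurable.ennreal_ofReal (by simp)]
  simp only [ENNReal.toReal_ofReal (ρ.nonneg_normed _)]
  obtain ⟨C, hC⟩ := ρ.hasCompactSupport_normed.exists_bound_of_continuous
    (ρ.continuous_normed (μ := volume))
  exact (hf.comp_sub_left x).bdd_smul C (φ := fun t => ρ.normed volume t)
    ρ.continuous_normed.aestronglyMeasurable (ae_of_all _ hC)

theorem mollify_bvDiff (ρ : ContDiffBump (0 : Euc N)) {v : Euc N → ℝ} {f : Euc N → Euc N}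
    (hv : Integrable v) (hf : Integrable f) (h x : Euc N) :
    mollify (mollMeasure ρ) (bvDiff v f h) x =
      bvDiff (mollify (mollMeasure ρ) v) (mollify (mollMeasure ρ) f) h x := by
  have i1 := integrable_comp_sub_mollMeasure ρ hv x
  have i2 : Integrable (fun t => v (x - t + h)) (mollMeasure ρ) := by
    simpa only [sub_add_eq_add_sub] using integrable_comp_sub_mollMeasure ρ hv (x + h)
  have i3 := integrable_comp_sub_mollMeasure ρ hf x
  simp only [mollify, bvDiff]
  rw [integral_add (by exact i2.sub i1) (i3.inner_const h), integral_sub i2 i1]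
  simp only [sub_add_eq_add_sub]
  congr 2
  calc ∫ t, (inner ℝ (f (x - t)) h : ℝ) ∂mollMeasure ρ
      = ∫ t, (inner ℝ h (f (x - t)) : ℝ) ∂mollMeasure ρ :=
        integral_congr_ae (ae_of_all _ fun t => real_inner_comm _ _)
    _ = inner ℝ h (∫ t, f (x - t) ∂mollMeasure ρ) := integral_inner i3 h
    _ = _ := real_inner_comm _ _

theorem mollify_translate_sub (ρ : ContDiffBump (0 : Euc N)) {f : Euc N → Euc N}
    (hf : Integrable f) (k x : Euc N) :
    mollify (mollMeasure ρ) (fun y => f (y + k) - f y) x =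
      mollify (mollMeasure ρ) f (x + k) - mollify (mollMeasure ρ) f x := by
  have i1 := integrable_comp_sub_mollMeasure ρ hf x
  have i2 : Integrable (fun t => f (x - t + k)) (mollMeasure ρ) := by
    simpa only [sub_add_eq_add_sub] using integrable_comp_sub_mollMeasure ρ hf (x + k)
  simp only [mollify]
  rw [integral_sub i2 i1]
  simp only [sub_add_eq_add_sub]

theorem lintegral_mollify_translate_sub_le (ρ : ContDiffBump (0 : Euc N)) {f : Euc N → Euc N}
    (hfm : StronglyMeasurable f) (hf : Integrable f) {k : Euc N} {M : ℝ≥0∞}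
    (hM : ∫⁻ x, ‖f (x + k) - f x‖ₑ ≤ M) :
    ∫⁻ x, ‖mollify (mollMeasure ρ) f (x + k) - mollify (mollMeasure ρ) f x‖ₑ ≤ M := by
  have hm : StronglyMeasurable fun y => f (y + k) - f y :=
    (hfm.comp_measurable (by fun_prop)).sub hfm
  have := lintegral_enorm_mollify_le (ν := mollMeasure ρ) hm (S := univ) (M := M)
    (ae_of_all _ fun t => by
      rw [Measure.restrict_univ,
        lintegral_sub_right_eq_self (fun x => ‖f (x + k) - f x‖ₑ) t]
      exact hM)
  rw [Measure.restrict_univ] at this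
  simpa only [mollify_translate_sub ρ hf] using this

/-- Along the segment, the increment is the average of ⟨G, h⟩ at intermediate points, corrected by
the variation of the mollified f. That correction is bounded by the translation modulus of f itself,
hence uniformly in ρ. -/
theorem setLIntegral_bvDiff_mollify_le (ρ : ContDiffBump (0 : Euc N)) {v : Euc N → ℝ}
    {f : Euc N → Euc N} (hfm : StronglyMeasurable f)
    (hv : Integrable v) (hf : Integrable f) {S S' : Set (Euc N)} (hS' : MeasurableSet S')
    {h : Euc N} (hSS : ∀ x ∈ S, ∀ t ∈ Icc (0 : ℝ) 1, x + t • h ∈ S') {M : ℝ≥0∞}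
    (hM : ∀ k : Euc N, ‖k‖ ≤ ‖h‖ → ∫⁻ x, ‖f (x + k) - f x‖ₑ ≤ M) :
    ∫⁻ x in S, ‖bvDiff (mollify (mollMeasure ρ) v) (mollify (mollMeasure ρ) f) h x‖ₑ ≤
      (∫⁻ x in S', ‖(inner ℝ (mollGrad ρ v f x) h : ℝ)‖ₑ) + ENNReal.ofReal ‖h‖ * M := by
  set V := mollify (mollMeasure ρ) v
  set W := mollify (mollMeasure ρ) f
  set G := mollGrad ρ v f
  have hV : ContDiff ℝ ∞ V := contDiff_mollify ρ hv.locallyIntegrable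
  have hW : Continuous W := (contDiff_mollify ρ hf.locallyIntegrable).continuous
  have hG : Continuous G := (contDiff_mollGrad ρ hv hf).continuous
  -- The parameter 1 - t appears because `integral_fderiv_segment` runs backwards from x + h.
  set k : Euc N → ℝ → ℝ := fun x t =>
    inner ℝ (G (x + (1 - t) • h)) h - inner ℝ (W (x + (1 - t) • h) - W x) h with hk
  have hkc : Continuous (Function.uncurry k) := by
    have c1 : Continuous fun z : Euc N × ℝ => G (z.1 + (1 - z.2) • h) := hG.comp (by fun_prop)
    have c2 : Continuous fun z : Euc N × ℝ => W (z.1 + (1 - z.2) • h) := hW.comp (by fun_prop)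
    have c3 : Continuous fun z : Euc N × ℝ => W z.1 := hW.comp (by fun_prop)
    exact (c1.inner continuous_const).sub ((c2.sub c3).inner continuous_const)
  have heq : ∀ x, bvDiff V W h x = ∫ t in Icc (0 : ℝ) 1, k x t := by
    intro x
    have h1 := integral_fderiv_segment hV (x + h) h
    have h2 : ∀ t : ℝ, k x t = fderiv ℝ V (x + h - t • h) h + inner ℝ (W x) h := by
      intro t
      have h3 : x + h - t • h = x + (1 - t) • h := by rw [sub_smul, one_smul]; abel
      simp only [hk, h3, inner_sub_left]
      rw [show (inner ℝ (G (x + (1 - t) • h)) h : ℝ) = fderiv ℝ V (x + (1 - t) • h) h +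
        inner ℝ (W (x + (1 - t) • h)) h from inner_mollGrad ρ v f _ h]
      ring
    simp_rw [h2]
    have hc : Continuous fun t : ℝ => fderiv ℝ V (x + h - t • h) h := by
      have : Continuous fun y => fderiv ℝ V y h :=
        (hV.continuous_fderiv (by simp)).clm_apply continuous_const
      exact this.comp (by fun_prop)
    rw [integral_add (hc.continuousOn.integrableOn_Icc) (integrable_const _), h1]
    simp [bvDiff]
  have := eLpNorm_integral_le_of_forall (μ := volume.restrict S)
    (ν := volume.restrict (Icc (0 : ℝ) 1)) le_rfl ENNReal.one_ne_top (k := k)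
    (C := (∫⁻ x in S', ‖(inner ℝ (G x) h : ℝ)‖ₑ) + ENNReal.ofReal ‖h‖ * M)
    hkc.aestronglyMeasurable ?_
  · rw [eLpNorm_one_eq_lintegral_enorm] at this
    simpa only [← heq] using this
  · filter_upwards [ae_restrict_mem measurableSet_Icc] with t ht
    rw [eLpNorm_one_eq_lintegral_enorm]
    have ht' : 1 - t ∈ Icc (0 : ℝ) 1 := ⟨by linarith [ht.2], by linarith [ht.1]⟩
    have c1 : Measurable fun x => ‖(inner ℝ (G (x + (1 - t) • h)) h : ℝ)‖ₑ :=
      ((hG.comp (by fun_prop)).inner continuous_const).measurable.enorm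
    calc ∫⁻ x in S, ‖k x t‖ₑ ≤ ∫⁻ x in S, (‖(inner ℝ (G (x + (1 - t) • h)) h : ℝ)‖ₑ +
          ENNReal.ofReal ‖h‖ * ‖W (x + (1 - t) • h) - W x‖ₑ) := by
          refine lintegral_mono fun x => ?_
          refine (enorm_sub_le).trans (add_le_add le_rfl ?_)
          rw [← ofReal_norm, ← ofReal_norm, ← ENNReal.ofReal_mul (norm_nonneg _), mul_comm]
          exact ENNReal.ofReal_le_ofReal (norm_inner_le_norm _ _)
      _ = (∫⁻ x in S, ‖(inner ℝ (G (x + (1 - t) • h)) h : ℝ)‖ₑ) +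
          ENNReal.ofReal ‖h‖ * ∫⁻ x in S, ‖W (x + (1 - t) • h) - W x‖ₑ := by
          rw [lintegral_add_left c1, lintegral_const_mul]
          exact ((hW.comp (by fun_prop)).sub hW).measurable.enorm
      _ ≤ _ := by
          refine add_le_add ?_ (mul_le_mul' le_rfl ?_)
          · have := eLpNorm_comp_add_restrict_le (p := 1) (S := S) hS' (a := (1 - t) • h)
              (k := fun x => (inner ℝ (G x) h : ℝ))
              (hG.inner continuous_const).aestronglyMeasurable (fun x hx => hSS x hx _ ht')
            simpa only [eLpNorm_one_eq_lintegral_enorm] using this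
          · refine (setLIntegral_le_lintegral _ _).trans
              (lintegral_mollify_translate_sub_le ρ hfm hf (hM _ ?_))
            rw [norm_smul, Real.norm_of_nonneg ht'.1]
            exact mul_le_of_le_one_left (norm_nonneg _) ht'.2

theorem lintegral_sphere_inner_mollGrad {e : Euc N} (he : ‖e‖ = 1) {G : Euc N → Euc N}
    (hG : Measurable G) (K : Set (Euc N)) :
    ∫⁻ θ : Metric.sphere (0 : Euc N) 1, (∫⁻ x in K, ‖(inner ℝ (G x) (θ : Euc N) : ℝ)‖ₑ)
      ∂(volume : Measure (Euc N)).toSphere =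
      ENNReal.ofReal (bbmConst 1 e) * ∫⁻ x in K, ‖G x‖ₑ := by
  have hm : Measurable fun z : Metric.sphere (0 : Euc N) 1 × Euc N =>
      ‖(inner ℝ (G z.2) (z.1 : Euc N) : ℝ)‖ₑ :=
    ((hG.comp measurable_snd).inner (measurable_subtype_coe.comp measurable_fst)).enorm
  rw [lintegral_lintegral_swap hm.aemeasurable, ← lintegral_const_mul _ hG.enorm]
  refine lintegral_congr fun x => ?_
  simpa using lintegral_sphere_inner_rpow (p := 1) le_rfl he (G x)

theorem exists_contDiffBump_rOut_lt {δ : ℝ} (hδ : 0 < δ) :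
    ∃ ρ : ContDiffBump (0 : Euc N), ρ.rOut < δ :=
  ⟨⟨δ / 4, δ / 2, by positivity, by linarith⟩, by simp only; linarith⟩

/-- The step r is fixed first; then ρ is chosen depending on r, so fine that mollifying the
increment costs less than r times a small constant. The direction θ is kept inside the inner product
until the end, so that the sphere integral yields the sharp constant `bbmConst`. -/
theorem eventually_radialQuot_bvDiff_le {e : Euc N} (he : ‖e‖ = 1) {v : Euc N → ℝ}
    {f : Euc N → Euc N} (hvm : StronglyMeasurable v) (hfm : StronglyMeasurable f)
    (hv : Integrable v) (hf : Integrable f) {Ω O : Set (Euc N)} (hΩ : IsOpen Ω)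
    (hb : Bornology.IsBounded Ω) (hO : IsOpen O) (hΩO : closure Ω ⊆ O) {η : ℝ≥0∞} (hη : 0 < η) :
    ∀ᶠ r in 𝓝[>] (0 : ℝ),
      eLpNorm (radialQuot Ω (fun y h => bvDiff v f h y) r) 1 (polarMeasure Ω) ≤
        ENNReal.ofReal (bbmConst 1 e) * bvVar v f O + η := by
  set σ := (volume : Measure (Euc N)).toSphere with hσ
  have hcpt : IsCompact (closure Ω) := hb.isCompact_closure
  obtain ⟨δ₀, hδ₀, hδO⟩ := hcpt.exists_cthickening_subset_open hO hΩO
  set K := Metric.cthickening δ₀ (closure Ω)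
  have hK : IsCompact K := hcpt.cthickening
  -- Two errors η' are integrated over the sphere; this normalization makes their total at most η.
  set c : ℝ≥0∞ := 2 * (σ univ + 1) with hc
  have hc0 : c ≠ 0 := by simp [hc]
  have hct : c ≠ ⊤ := ENNReal.mul_ne_top (by simp) (ENNReal.add_ne_top.2 ⟨measure_ne_top _ _, by simp⟩)
  set η' := η / c
  have hη' : 0 < η' := ENNReal.div_pos hη.ne' hct
  have hcη : σ univ * (η' + η') ≤ η := by
    calc σ univ * (η' + η') = (2 * σ univ) * η' := by ring
      _ ≤ c * η' := by gcongr; rw [hc]; gcongr; exact le_self_add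
      _ = η := ENNReal.mul_div_cancel hc0 hct
  obtain ⟨δ₁, hδ₁, hfδ⟩ := exists_lintegral_translate_sub_le hf hη'
  obtain ⟨δ₂, hδ₂, hGK⟩ := setLIntegral_mollGrad_le hvm hfm hv hf hK hO hδO
  have hsmall : ∀ᶠ r in 𝓝[>] (0 : ℝ), r < min (min δ₀ δ₁) 1 :=
    nhdsWithin_le_nhds (Iio_mem_nhds (lt_min (lt_min hδ₀ hδ₁) one_pos))
  filter_upwards [hsmall, self_mem_nhdsWithin] with r hr (hr0 : 0 < r)
  have hrδ₀ : r < δ₀ := hr.trans_le ((min_le_left _ _).trans (min_le_left _ _))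
  have hrδ₁ : r < δ₁ := hr.trans_le ((min_le_left _ _).trans (min_le_right _ _))
  have hr1 : r < 1 := hr.trans_le (min_le_right _ _)
  have hrE : ENNReal.ofReal r ≠ 0 := by simpa using hr0
  -- The translated increment costs 2M' for v and |h| M' ≤ M' for f, in total r η'.
  set M' := ENNReal.ofReal r * η' / 3 with hM'
  have hM'0 : 0 < M' := ENNReal.div_pos (mul_ne_zero hrE hη'.ne') (by simp)
  obtain ⟨d₁, hd₁, hvd⟩ := exists_lintegral_translate_sub_le hv hM'0
  obtain ⟨d₂, hd₂, hfd⟩ := exists_lintegral_translate_sub_le hf hM'0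
  obtain ⟨ρ, hρ⟩ := exists_contDiffBump_rOut_lt (N := N) (lt_min (lt_min hd₁ hd₂) hδ₂)
  have hρ1 : ρ.rOut < d₁ := hρ.trans_le ((min_le_left _ _).trans (min_le_left _ _))
  have hρ2 : ρ.rOut < d₂ := hρ.trans_le ((min_le_left _ _).trans (min_le_right _ _))
  have hρ3 : ρ.rOut < δ₂ := hρ.trans_le (min_le_right _ _)
  set G := mollGrad ρ v f with hGdef
  have hGm : Measurable G := (contDiff_mollGrad ρ hv hf).continuous.measurable
  have hθ : ∀ θ : Metric.sphere (0 : Euc N) 1,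
      ∫⁻ x in Ω, ‖bvDiff v f (r • (θ : Euc N)) x‖ₑ ≤
        ENNReal.ofReal r * ((∫⁻ x in K, ‖(inner ℝ (G x) (θ : Euc N) : ℝ)‖ₑ) + (η' + η')) := by
    intro θ
    have hrθ : ‖r • (θ : Euc N)‖ = r := by
      rw [norm_smul, Real.norm_of_nonneg hr0.le]; simp
    set h := r • (θ : Euc N) with hh
    have hDm := stronglyMeasurable_bvDiff hvm hfm h
    have hmol : ∫⁻ x, ‖mollify (mollMeasure ρ) (bvDiff v f h) x - bvDiff v f h x‖ₑ ≤
        ENNReal.ofReal r * η' := by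
      refine lintegral_enorm_mollify_sub_le hDm (integrable_bvDiff hv hf h) ?_
      filter_upwards [ae_mollMeasure_norm_lt ρ] with t ht
      have h1 := lintegral_bvDiff_translate_le hvm hfm (h := h) (k := -t)
        (hvd (-t) (by rw [norm_neg]; exact ht.trans hρ1))
        (hfd (-t) (by rw [norm_neg]; exact ht.trans hρ2))
      simp only [← sub_eq_add_neg] at h1
      refine h1.trans ?_
      calc 2 * M' + ENNReal.ofReal ‖h‖ * M' ≤ 2 * M' + 1 * M' := by
            gcongr
            rw [hrθ, ENNReal.ofReal_le_one]
            exact hr1.le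
        _ = 3 * M' := by ring
        _ = _ := ENNReal.mul_div_cancel (by simp) (by simp)
    have hseg := setLIntegral_bvDiff_mollify_le ρ (v := v) hfm hv hf (S := Ω) (S' := K)
      hK.measurableSet (h := h) (fun x hx t ht => by
        refine Metric.mem_cthickening_of_dist_le _ x _ _ (subset_closure hx) ?_
        rw [dist_eq_norm, add_sub_cancel_left, norm_smul, hrθ, Real.norm_of_nonneg ht.1]
        nlinarith [ht.2]) (M := η') (fun k hk => hfδ k (by rw [hrθ] at hk; linarith))
    simp only [← mollify_bvDiff ρ hv hf] at hseg
    have hVm : StronglyMeasurable (mollify (mollMeasure ρ) (bvDiff v f h)) :=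
      (contDiff_mollify ρ (integrable_bvDiff hv hf h).locallyIntegrable).continuous.stronglyMeasurable
    calc ∫⁻ x in Ω, ‖bvDiff v f h x‖ₑ
        ≤ ∫⁻ x in Ω, (‖mollify (mollMeasure ρ) (bvDiff v f h) x‖ₑ +
          ‖mollify (mollMeasure ρ) (bvDiff v f h) x - bvDiff v f h x‖ₑ) := by
          refine lintegral_mono fun x => ?_
          have := enorm_sub_le (a := mollify (mollMeasure ρ) (bvDiff v f h) x)
            (b := mollify (mollMeasure ρ) (bvDiff v f h) x - bvDiff v f h x)
          rwa [sub_sub_cancel] at this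
      _ = (∫⁻ x in Ω, ‖mollify (mollMeasure ρ) (bvDiff v f h) x‖ₑ) +
          ∫⁻ x in Ω, ‖mollify (mollMeasure ρ) (bvDiff v f h) x - bvDiff v f h x‖ₑ :=
          lintegral_add_left hVm.measurable.enorm _
      _ ≤ ((∫⁻ x in K, ‖(inner ℝ (G x) h : ℝ)‖ₑ) + ENNReal.ofReal ‖h‖ * η') +
          ENNReal.ofReal r * η' := by
          gcongr
          exact (setLIntegral_le_lintegral _ _).trans hmol
      _ = _ := by
          rw [hrθ, mul_add, mul_add, add_assoc]
          congr 1
          rw [← lintegral_const_mul _ (by fun_prop)]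
          refine lintegral_congr fun x => ?_
          rw [hh, inner_smul_right, enorm_mul, Real.enorm_of_nonneg hr0.le]
  have hwm : Measurable (Function.uncurry fun y h => bvDiff v f h y) := by
    have hvm' := hvm.measurable
    have hfm' := hfm.measurable
    unfold bvDiff
    simp only [Function.uncurry_def]
    fun_prop
  rw [eLpNorm_one_eq_lintegral_enorm, lintegral_prod _
    (measurable_radialQuot hΩ.measurableSet hwm r).enorm.aemeasurable]
  calc _ ≤ ∫⁻ θ, ((∫⁻ x in K, ‖(inner ℝ (G x) (θ : Euc N) : ℝ)‖ₑ) + (η' + η')) ∂σ := by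
        refine lintegral_mono fun θ => ?_
        calc ∫⁻ y in Ω, ‖radialQuot Ω (fun y h => bvDiff v f h y) r (θ, y)‖ₑ
            ≤ ∫⁻ y in Ω, (ENNReal.ofReal r)⁻¹ * ‖bvDiff v f (r • (θ : Euc N)) y‖ₑ := by
              refine lintegral_mono fun y => ?_
              rw [radialQuot]
              split_ifs
              · rw [enorm_mul, enorm_inv hr0.ne', Real.enorm_of_nonneg hr0.le]
              · simp
          _ = (ENNReal.ofReal r)⁻¹ * ∫⁻ y in Ω, ‖bvDiff v f (r • (θ : Euc N)) y‖ₑ :=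
              lintegral_const_mul _ (stronglyMeasurable_bvDiff hvm hfm _).measurable.enorm
          _ ≤ (ENNReal.ofReal r)⁻¹ * (ENNReal.ofReal r *
              ((∫⁻ x in K, ‖(inner ℝ (G x) (θ : Euc N) : ℝ)‖ₑ) + (η' + η'))) := by
              gcongr
              exact hθ θ
          _ = _ := by
              rw [← mul_assoc, ENNReal.inv_mul_cancel hrE ENNReal.ofReal_ne_top, one_mul]
    _ = ENNReal.ofReal (bbmConst 1 e) * (∫⁻ x in K, ‖G x‖ₑ) + (η' + η') * σ univ := by
        rw [lintegral_add_right _ measurable_const, lintegral_const,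
          lintegral_sphere_inner_mollGrad he hGm]
    _ ≤ _ := by
        gcongr
        · exact hGK ρ hρ3
        · rwa [mul_comm]

end Upper

/-! ### Lower bound by Fatou, and the limit of the quotients for BV functions. -/

section Lower
variable {N : ℕ}

theorem tendsto_mollify_of_continuous {F : Type*} [NormedAddCommGroup F] [NormedSpace ℝ F]
    [CompleteSpace F] {ρ : ℕ → ContDiffBump (0 : Euc N)}
    (hρ : Tendsto (fun n => (ρ n).rOut) atTop (𝓝 0)) {φ : Euc N → F} (hφ : Continuous φ)
    (x : Euc N) : Tendsto (fun n => mollify (mollMeasure (ρ n)) φ x) atTop (𝓝 (φ x)) := by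
  simp only [mollify_mollMeasure_eq_convolution]
  exact ContDiffBump.convolution_tendsto_right_of_continuous hρ hφ x

theorem tendsto_bvPairing_mollify {ρ : ℕ → ContDiffBump (0 : Euc N)}
    (hρ : Tendsto (fun n => (ρ n).rOut) atTop (𝓝 0)) {v : Euc N → ℝ} {f φ : Euc N → Euc N}
    (hv : Integrable v) (hf : Integrable f) (hφ : ContDiff ℝ ∞ φ) (hφc : HasCompactSupport φ) :
    Tendsto (fun n => bvPairing v f (mollify (mollMeasure (ρ n)) φ)) atTop
      (𝓝 (bvPairing v f φ)) := by
  have hdc := continuous_divergence hφ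
  obtain ⟨C, hC⟩ := (hasCompactSupport_divergence hφc).exists_bound_of_continuous hdc
  obtain ⟨C', hC'⟩ := hφc.exists_bound_of_continuous hφ.continuous
  simp only [bvPairing, divergence_mollify _ hφ hφc]
  refine tendsto_integral_of_dominated_convergence (fun x => ‖v x‖ * C + ‖f x‖ * C')
    (fun n => ?_) ((hv.norm.mul_const C).add (hf.norm.mul_const C')) (fun n => ?_) ?_
  · refine (hv.aestronglyMeasurable.mul ?_).sub (hf.aestronglyMeasurable.inner ?_)
    · exact (contDiff_mollify (ρ n) hdc.locallyIntegrable).continuous.aestronglyMeasurable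
    · exact (contDiff_mollify (ρ n)
        hφ.continuous.locallyIntegrable).continuous.aestronglyMeasurable
  · refine ae_of_all _ fun x => (norm_sub_le _ _).trans (add_le_add ?_ ?_)
    · rw [norm_mul]
      exact mul_le_mul_of_nonneg_left (norm_mollify_le _ hC x) (norm_nonneg _)
    · exact (norm_inner_le_norm _ _).trans
        (mul_le_mul_of_nonneg_left (norm_mollify_le _ hC' x) (norm_nonneg _))
  · exact ae_of_all _ fun x =>
      ((tendsto_mollify_of_continuous hρ hdc x).const_mul _).sub
        (tendsto_const_nhds.inner (tendsto_mollify_of_continuous hρ hφ.continuous x))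

theorem measurable_uncurry_bvDiff {v : Euc N → ℝ} {f : Euc N → Euc N} (hvm : Measurable v)
    (hfm : Measurable f) : Measurable (Function.uncurry fun y h => bvDiff v f h y) := by
  unfold bvDiff
  simp only [Function.uncurry_def]
  fun_prop

/-- For x in K and |t| less than the mollification radius, both x - t and x - t + h lie in Ω. So the
mollified increments on K average only increments that the cut-off quotient retains. -/
theorem setLIntegral_bvDiff_mollify_le_radialQuot {v : Euc N → ℝ} {f : Euc N → Euc N}
    (hvm : StronglyMeasurable v) (hfm : StronglyMeasurable f) (hv : Integrable v)
    (hf : Integrable f) {Ω K : Set (Euc N)} (hΩ : IsOpen Ω) {δ : ℝ}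
    (hKΩ : Metric.cthickening δ K ⊆ Ω) (ρ : ContDiffBump (0 : Euc N)) {r : ℝ} (hr : 0 < r)
    (hρr : ρ.rOut + r ≤ δ) (θ : Metric.sphere (0 : Euc N) 1) :
    ∫⁻ x in K, ‖r⁻¹ * bvDiff (mollify (mollMeasure ρ) v) (mollify (mollMeasure ρ) f)
        (r • (θ : Euc N)) x‖ₑ ≤
      ∫⁻ y in Ω, ‖radialQuot Ω (fun y h => bvDiff v f h y) r (θ, y)‖ₑ := by
  have hrθ : ‖r • (θ : Euc N)‖ = r := by
    rw [norm_smul, Real.norm_of_nonneg hr.le]; simp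
  set h := r • (θ : Euc N) with hh
  have hDm := stronglyMeasurable_bvDiff hvm hfm h
  have hms : MeasurableSet {x | x + h ∈ Ω} := hΩ.measurableSet.preimage (measurable_id.add_const _)
  set T := Ω ∩ {x | x + h ∈ Ω} with hT
  have hTm : MeasurableSet T := hΩ.measurableSet.inter hms
  have hrad : ∫⁻ y in Ω, ‖radialQuot Ω (fun y h => bvDiff v f h y) r (θ, y)‖ₑ =
      ∫⁻ y in T, ‖r⁻¹ * bvDiff v f h y‖ₑ := by
    rw [hT, inter_comm, ← Measure.restrict_restrict hms, ← lintegral_indicator hms]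
    refine lintegral_congr fun y => ?_
    by_cases hy : y + h ∈ Ω
    · rw [indicator_of_mem (by exact hy), radialQuot, if_pos hy]
    · rw [indicator_of_notMem (by exact hy), radialQuot, if_neg hy, enorm_zero]
  rw [hrad]
  simp only [← mollify_bvDiff ρ hv hf, enorm_mul]
  rw [lintegral_const_mul' _ _ (by simp), lintegral_const_mul' _ _ (by simp)]
  gcongr 1
  refine lintegral_enorm_mollify_le hDm ?_
  filter_upwards [ae_mollMeasure_norm_lt ρ] with t ht
  have key := eLpNorm_comp_add_restrict_le (p := 1) (S := K) hTm (a := -t)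
    (k := bvDiff v f h) hDm.aestronglyMeasurable (fun x hx => ⟨hKΩ ?_, hKΩ ?_⟩)
  · simpa only [eLpNorm_one_eq_lintegral_enorm, ← sub_eq_add_neg] using key
  · refine Metric.mem_cthickening_of_dist_le _ x _ _ hx ?_
    rw [dist_eq_norm, add_sub_cancel_left, norm_neg]
    linarith
  · refine Metric.mem_cthickening_of_dist_le _ x _ _ hx ?_
    rw [dist_eq_norm, add_assoc, add_sub_cancel_left]
    refine (norm_add_le _ _).trans ?_
    rw [norm_neg, hrθ]
    linarith

/-- One mollification scale, fixed independently of r, makes the function smooth: its quotients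
converge pointwise to ⟨G, θ⟩, while their L¹ norms on K stay below those of the original quotients
on Ω. -/
theorem eventually_lt_radialQuot_bvDiff {e : Euc N} (he : ‖e‖ = 1) {v : Euc N → ℝ}
    {f φ : Euc N → Euc N} (hvm : StronglyMeasurable v) (hfm : StronglyMeasurable f)
    (hv : Integrable v) (hf : Integrable f) {Ω : Set (Euc N)} (hΩ : IsOpen Ω)
    (hφ : φ ∈ testFields Ω) {a : ℝ≥0∞}
    (ha : a < ENNReal.ofReal (bbmConst 1 e) * ENNReal.ofReal (bvPairing v f φ)) :
    ∀ᶠ r in 𝓝[>] (0 : ℝ),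
      a < eLpNorm (radialQuot Ω (fun y h => bvDiff v f h y) r) 1 (polarMeasure Ω) := by
  obtain ⟨hφs, hφc, hφt, hφ1⟩ := hφ
  set σ := (volume : Measure (Euc N)).toSphere with hσ
  set K := tsupport φ with hKdef
  have hK : IsCompact K := hφc
  obtain ⟨δ, hδ, hδΩ⟩ := hK.exists_cthickening_subset_open hΩ hφt
  have hseq : ∃ ρ : ℕ → ContDiffBump (0 : Euc N), Tendsto (fun n => (ρ n).rOut) atTop (𝓝 0) := by
    refine ⟨fun n => ⟨1 / (2 * ((n : ℝ) + 1)), 1 / ((n : ℝ) + 1), by positivity, ?_⟩, ?_⟩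
    · gcongr
      have : (0 : ℝ) ≤ n := by positivity
      linarith
    · exact tendsto_one_div_add_atTop_nhds_zero_nat
  obtain ⟨ρs, hρs⟩ := hseq
  have hlim : Tendsto (fun n => ENNReal.ofReal (bbmConst 1 e) *
      ENNReal.ofReal (bvPairing v f (mollify (mollMeasure (ρs n)) φ))) atTop
      (𝓝 (ENNReal.ofReal (bbmConst 1 e) * ENNReal.ofReal (bvPairing v f φ))) :=
    ENNReal.Tendsto.const_mul (ENNReal.tendsto_ofReal
      (tendsto_bvPairing_mollify hρs hv hf hφs hφc)) (Or.inr ENNReal.ofReal_ne_top)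
  -- The mollified test field must still beat a, and the radius must leave room δ/2 for the step r.
  obtain ⟨n, hn1, hn2⟩ := ((hlim.eventually_const_lt ha).and
    (hρs.eventually_lt_const (half_pos hδ))).exists
  set ρ := ρs n
  set V := mollify (mollMeasure ρ) v with hVdef
  set W := mollify (mollMeasure ρ) f with hWdef
  set G := mollGrad ρ v f with hGdef
  have hV : ContDiff ℝ ∞ V := contDiff_mollify ρ hv.locallyIntegrable
  have hW : Continuous W := (contDiff_mollify ρ hf.locallyIntegrable).continuous
  have hG : Continuous G := (contDiff_mollGrad ρ hv hf).continuous
  have hGK : ENNReal.ofReal (bvPairing v f (mollify (mollMeasure ρ) φ)) ≤ ∫⁻ x in K, ‖G x‖ₑ := by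
    have h1 := integral_inner_mollGrad ρ hvm hfm hv hf hφs hφc
    rw [← neg_eq_iff_eq_neg.2 h1]
    refine (ENNReal.ofReal_le_ofReal (neg_le_abs _)).trans ?_
    rw [← Real.norm_eq_abs, ofReal_norm]
    refine (enorm_integral_le_lintegral_enorm _).trans ?_
    rw [← lintegral_indicator hK.measurableSet]
    refine lintegral_mono fun x => ?_
    by_cases hx : x ∈ K
    · rw [indicator_of_mem hx, ← ofReal_norm, ← ofReal_norm]
      refine ENNReal.ofReal_le_ofReal ((norm_inner_le_norm _ _).trans ?_)
      exact mul_le_of_le_one_right (norm_nonneg _) (hφ1 x)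
    · rw [image_eq_zero_of_notMem_tsupport hx]
      simp
  have haG : a < ∫⁻ z, ‖(inner ℝ (G z.2) (z.1 : Euc N) : ℝ)‖ₑ ∂(σ.prod (volume.restrict K)) := by
    have hm : Measurable fun z : Metric.sphere (0 : Euc N) 1 × Euc N =>
        ‖(inner ℝ (G z.2) (z.1 : Euc N) : ℝ)‖ₑ :=
      ((hG.measurable.comp measurable_snd).inner
        (measurable_subtype_coe.comp measurable_fst)).enorm
    rw [lintegral_prod _ hm.aemeasurable, lintegral_sphere_inner_mollGrad he hG.measurable]
    exact hn1.trans_le (by gcongr)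
  -- Failure gives a sequence of steps tending to 0 along which the norms stay at most a,
  -- contradicting Fatou's lemma.
  by_contra hcon
  rw [not_eventually] at hcon
  have hcon2 := hcon.and_eventually (nhdsWithin_le_nhds (Iio_mem_nhds (half_pos hδ)) :
    ∀ᶠ r in 𝓝[>] (0 : ℝ), r < δ / 2)
  obtain ⟨rs, hrs, hrs2⟩ := exists_seq_forall_of_frequently
    (hcon2.and_eventually self_mem_nhdsWithin)
  set Q : ℕ → Metric.sphere (0 : Euc N) 1 × Euc N → ℝ := fun n z =>
    (rs n)⁻¹ * bvDiff V W (rs n • (z.1 : Euc N)) z.2 with hQ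
  have hQm : ∀ n, Measurable (Q n) := fun n => by
    refine measurable_const.mul ?_
    exact (measurable_uncurry_bvDiff hV.continuous.measurable hW.measurable).comp
      (f := fun z : Metric.sphere (0 : Euc N) 1 × Euc N => (z.2, rs n • (z.1 : Euc N)))
      (by fun_prop)
  have hQle : ∀ n, ∫⁻ z, ‖Q n z‖ₑ ∂(σ.prod (volume.restrict K)) ≤ a := by
    intro n
    obtain ⟨⟨h1, h2⟩, h3 : 0 < rs n⟩ := hrs2 n
    refine le_trans ?_ (not_lt.1 h1)
    rw [eLpNorm_one_eq_lintegral_enorm, lintegral_prod _ (hQm n).enorm.aemeasurable,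
      lintegral_prod _ (measurable_radialQuot hΩ.measurableSet
        (measurable_uncurry_bvDiff hvm.measurable hfm.measurable) _).enorm.aemeasurable]
    exact lintegral_mono fun θ => setLIntegral_bvDiff_mollify_le_radialQuot hvm hfm hv hf hΩ hδΩ
      ρ h3 (by linarith) θ
  have hQlim : ∀ z, Tendsto (fun n => ‖Q n z‖ₑ) atTop
      (𝓝 ‖(inner ℝ (G z.2) (z.1 : Euc N) : ℝ)‖ₑ) := by
    intro z
    refine (continuous_enorm.tendsto _).comp ?_
    have hd : HasDerivAt (fun r : ℝ => V (z.2 + r • (z.1 : Euc N)))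
        (fderiv ℝ V z.2 (z.1 : Euc N)) 0 := by
      have h1 : HasDerivAt (fun r : ℝ => z.2 + r • (z.1 : Euc N)) (z.1 : Euc N) 0 := by
        simpa using ((hasDerivAt_id (0 : ℝ)).smul_const (z.1 : Euc N)).const_add z.2
      have h2 : HasFDerivAt V (fderiv ℝ V z.2) (z.2 + (0 : ℝ) • (z.1 : Euc N)) := by
        simpa using ((hV.differentiable (by simp)) z.2).hasFDerivAt
      exact h2.comp_hasDerivAt (0 : ℝ) h1
    have hs := hd.tendsto_slope
    have hs2 := hs.comp (hrs.mono_right (nhdsWithin_mono (0 : ℝ) (fun x (hx : 0 < x) => hx.ne')))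
    rw [show (inner ℝ (G z.2) (z.1 : Euc N) : ℝ) = fderiv ℝ V z.2 (z.1 : Euc N) +
      inner ℝ (W z.2) (z.1 : Euc N) from inner_mollGrad ρ v f _ _]
    refine (hs2.add_const (inner ℝ (W z.2) (z.1 : Euc N) : ℝ)).congr fun n => ?_
    have h3 : 0 < rs n := (hrs2 n).2
    simp only [hQ, bvDiff, slope, Function.comp_apply, sub_zero, zero_smul, add_zero, vsub_eq_sub,
      smul_eq_mul, inner_smul_right, mul_add]
    rw [inv_mul_cancel_left₀ h3.ne']
  have hfatou := lintegral_liminf_le (μ := σ.prod (volume.restrict K)) (u := atTop)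
    (fun n => (hQm n).enorm)
  simp only [(hQlim _).liminf_eq] at hfatou
  refine absurd (haG.trans_le (hfatou.trans ?_)) (lt_irrefl a)
  exact liminf_le_of_frequently_le' (Frequently.of_forall hQle)

/-- The hypothesis on ∂Ω closes the gap between the bounds: Ω ∪ U is an open neighbourhood of the
closure whose variation exceeds that of Ω by at most η. -/
theorem tendsto_radialQuot_bvDiff {e : Euc N} (he : ‖e‖ = 1) {v : Euc N → ℝ}
    {f : Euc N → Euc N} (hvm : StronglyMeasurable v) (hfm : StronglyMeasurable f)
    (hv : Integrable v) (hf : Integrable f) {Ω : Set (Euc N)} (hΩ : IsOpen Ω)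
    (hb : Bornology.IsBounded Ω)
    (hfr : ∀ η > 0, ∃ U, IsOpen U ∧ frontier Ω ⊆ U ∧ bvVar v f U ≤ η) :
    Tendsto (fun r => eLpNorm (radialQuot Ω (fun y h => bvDiff v f h y) r) 1 (polarMeasure Ω))
      (𝓝[>] 0) (𝓝 (ENNReal.ofReal (bbmConst 1 e) * bvVar v f Ω)) := by
  rw [tendsto_order]
  constructor
  · intro a ha
    simp only [bvVar, ENNReal.mul_iSup, lt_iSup_iff] at ha
    obtain ⟨φ, hφ, ha⟩ := ha
    exact eventually_lt_radialQuot_bvDiff he hvm hfm hv hf hΩ hφ ha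
  · intro a ha
    have hcont : Tendsto (fun η : ℝ≥0∞ => ENNReal.ofReal (bbmConst 1 e) * (bvVar v f Ω + η) + η)
        (𝓝[>] 0) (𝓝 (ENNReal.ofReal (bbmConst 1 e) * (bvVar v f Ω + 0) + 0)) := by
      have hid : Tendsto (fun η : ℝ≥0∞ => η) (𝓝[>] 0) (𝓝 0) :=
        tendsto_id.mono_left nhdsWithin_le_nhds
      exact (ENNReal.Tendsto.const_mul (hid.const_add _) (Or.inr ENNReal.ofReal_ne_top)).add hid
    rw [add_zero, add_zero] at hcont
    obtain ⟨η, hη, hη0⟩ := ((hcont.eventually_lt_const ha).and self_mem_nhdsWithin).exists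
    obtain ⟨U, hU, hfU, hUη⟩ := hfr η hη0
    have hcl : closure Ω ⊆ Ω ∪ U := by
      intro x hx
      by_cases h : x ∈ Ω
      · exact Or.inl h
      · exact Or.inr (hfU ⟨hx, by rwa [hΩ.interior_eq]⟩)
    filter_upwards [eventually_radialQuot_bvDiff_le he hvm hfm hv hf hΩ hb (hΩ.union hU) hcl hη0]
      with r hr
    refine hr.trans_lt (lt_of_le_of_lt ?_ hη)
    gcongr
    exact (bvVar_union_le hv hf hΩ hU).trans (by gcongr)

end Lower

/-! ### Linearization of the magnetic phase. -/

section Phase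
variable {N : ℕ}

/-- The phase factor `exp(i h · A(y + h/2))`. -/
noncomputable def phase (A : Euc N → Euc N) (y h : Euc N) : ℂ :=
  Complex.exp (Complex.I * ((inner ℝ h (A ((1 / 2 : ℝ) • (y + h + y))) : ℝ) : ℂ))

/-- The magnetic increment `u(y+h) - exp(i h · A(y + h/2)) u(y)`. -/
noncomputable def magDiff (A : Euc N → Euc N) (u : Euc N → ℂ) (y h : Euc N) : ℂ :=
  u (y + h) - phase A y h * u y

/-- The field `(Im u) A`, the zeroth order part of `Re (∇u - iAu)`. -/
def reField (A : Euc N → Euc N) (u : Euc N → ℂ) (x : Euc N) : Euc N := (u x).im • A x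

/-- The field `-(Re u) A`, the zeroth order part of `Im (∇u - iAu)`. -/
def imField (A : Euc N → Euc N) (u : Euc N → ℂ) (x : Euc N) : Euc N := -((u x).re • A x)

theorem pNorm_rpow {p : ℝ} (hp : 1 ≤ p) (z : ℂ) : pNorm p z ^ p = |z.re| ^ p + |z.im| ^ p := by
  rw [pNorm, ← Real.rpow_mul (by positivity), one_div_mul_cancel (by linarith), Real.rpow_one]

theorem measurable_uncurry_magDiff {A : Euc N → Euc N} (hA : Continuous A) {u : Euc N → ℂ}
    (hu : Measurable u) : Measurable (Function.uncurry (magDiff A u)) := by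
  have h1 : Measurable fun z : Euc N × Euc N => u (z.1 + z.2) := hu.comp (by fun_prop)
  have h2 : Continuous fun z : Euc N × Euc N => phase A z.1 z.2 := by
    unfold phase
    fun_prop
  exact h1.sub (h2.measurable.mul (hu.comp measurable_fst))

theorem gagliardo_eq_add {A : Euc N → Euc N} (hA : Continuous A) {u : Euc N → ℂ}
    (hu : Measurable u) {p : ℝ} (hp : 1 ≤ p) (s : ℝ) (Ω : Set (Euc N)) :
    gagliardo A p s Ω u =
      (∫⁻ y in Ω, ∫⁻ x in Ω,
        ENNReal.ofReal (|(magDiff A u y (x - y)).re| ^ p / ‖x - y‖ ^ ((N : ℝ) + p * s))) +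
      ∫⁻ y in Ω, ∫⁻ x in Ω,
        ENNReal.ofReal (|(magDiff A u y (x - y)).im| ^ p / ‖x - y‖ ^ ((N : ℝ) + p * s)) := by
  have hm : Measurable fun z : Euc N × Euc N => magDiff A u z.1 (z.2 - z.1) :=
    (measurable_uncurry_magDiff hA hu).comp
      (f := fun z : Euc N × Euc N => (z.1, z.2 - z.1)) (by fun_prop)
  have hre : Measurable fun z : Euc N × Euc N => ENNReal.ofReal
      (|(magDiff A u z.1 (z.2 - z.1)).re| ^ p / ‖z.2 - z.1‖ ^ ((N : ℝ) + p * s)) := by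
    have := Complex.measurable_re.comp hm
    simp only [Function.comp_def] at this
    fun_prop
  rw [gagliardo, ← lintegral_add_left hre.lintegral_prod_right']
  refine lintegral_congr fun y => ?_
  have hy : Measurable fun x : Euc N => ENNReal.ofReal
      (|(magDiff A u y (x - y)).re| ^ p / ‖x - y‖ ^ ((N : ℝ) + p * s)) :=
    hre.comp (f := fun x : Euc N => (y, x)) (by fun_prop)
  rw [show (∫⁻ x in Ω, (fun z : Euc N × Euc N => ENNReal.ofReal
      (|(magDiff A u z.1 (z.2 - z.1)).re| ^ p / ‖z.2 - z.1‖ ^ ((N : ℝ) + p * s))) (y, x)) =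
    ∫⁻ x in Ω, ENNReal.ofReal
      (|(magDiff A u y (x - y)).re| ^ p / ‖x - y‖ ^ ((N : ℝ) + p * s)) from rfl,
    ← lintegral_add_left hy]
  refine lintegral_congr fun x => ?_
  rw [← ENNReal.ofReal_add (by positivity) (by positivity), ← add_div, ← pNorm_rpow hp]
  -- For h = x - y the sum y + h + y in `phase` becomes x + y, giving the midpoint of the seminorm.
  simp only [magDiff, phase, add_sub_cancel]

/-- Two errors occur: the quadratic remainder of the exponential, and the replacement of the
midpoint value of A by A(y). Each is at most (η/2)|h|. -/
theorem exists_norm_phase_sub_le {A : Euc N → Euc N} (hA : Continuous A) {Ω : Set (Euc N)}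
    (hb : Bornology.IsBounded Ω) {η : ℝ} (hη : 0 < η) :
    ∃ δ > 0, ∀ y ∈ Ω, ∀ h : Euc N, ‖h‖ < δ →
      ‖phase A y h - 1 - Complex.I * ((inner ℝ (A y) h : ℝ) : ℂ)‖ ≤ η * ‖h‖ := by
  obtain ⟨R, hR⟩ := hb.subset_closedBall (0 : Euc N)
  have hcpt := isCompact_closedBall (0 : Euc N) (R + 1)
  obtain ⟨M, hM⟩ := hcpt.exists_bound_of_continuousOn hA.continuousOn
  have huc := hcpt.uniformContinuousOn_of_continuous hA.continuousOn
  rw [Metric.uniformContinuousOn_iff] at huc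
  obtain ⟨δ₁, hδ₁, huc⟩ := huc (η / 2) (half_pos hη)
  set M' := max M 1 with hM'
  have hM'1 : 1 ≤ M' := le_max_right _ _
  have hM'0 : 0 < M' := by linarith
  -- In order, the bounds serve the uniform continuity of A, staying in the ball of radius R + 1, an
  -- exponent of modulus at most 1, and t² ≤ (η/2)|h|.
  refine ⟨min (min δ₁ 1) (min (1 / M') (η / (2 * M' ^ 2))), by positivity, fun y hy h hh => ?_⟩
  have h1 : ‖h‖ < δ₁ := hh.trans_le ((min_le_left _ _).trans (min_le_left _ _))
  have h2 : ‖h‖ < 1 := hh.trans_le ((min_le_left _ _).trans (min_le_right _ _))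
  have h3 : ‖h‖ < 1 / M' := hh.trans_le ((min_le_right _ _).trans (min_le_left _ _))
  have h4 : ‖h‖ < η / (2 * M' ^ 2) := hh.trans_le ((min_le_right _ _).trans (min_le_right _ _))
  rw [lt_div_iff₀ (by positivity)] at h3 h4
  have hn : 0 ≤ ‖h‖ := norm_nonneg h
  have hyR : ‖y‖ ≤ R := by simpa using hR hy
  set m := (1 / 2 : ℝ) • (y + h + y) with hm
  have hmy : m = y + (1 / 2 : ℝ) • h := by
    rw [hm]
    module
  have hhalf : ‖(1 / 2 : ℝ) • h‖ ≤ ‖h‖ := by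
    rw [norm_smul]
    norm_num
    linarith
  have hmball : m ∈ Metric.closedBall (0 : Euc N) (R + 1) := by
    rw [mem_closedBall_zero_iff, hmy]
    linarith [norm_add_le y ((1 / 2 : ℝ) • h)]
  have hyball : y ∈ Metric.closedBall (0 : Euc N) (R + 1) := by
    rw [mem_closedBall_zero_iff]
    linarith
  have hdist : ‖A m - A y‖ ≤ η / 2 := by
    rw [← dist_eq_norm]
    refine (huc m hmball y hyball ?_).le
    rw [dist_eq_norm, hmy, add_sub_cancel_left]
    linarith
  set t : ℝ := inner ℝ h (A m) with ht
  have htM : |t| ≤ ‖h‖ * M' :=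
    (abs_real_inner_le_norm _ _).trans
      (mul_le_mul_of_nonneg_left ((hM m hmball).trans (le_max_left _ _)) hn)
  have hnt : ‖Complex.I * (t : ℂ)‖ = |t| := by simp
  have hexp : ‖phase A y h - 1 - Complex.I * (t : ℂ)‖ ≤ t ^ 2 := by
    have := Complex.norm_exp_sub_one_sub_id_le (x := Complex.I * (t : ℂ)) (by
      rw [hnt]; linarith)
    rwa [hnt, sq_abs] at this
  have ht2 : t ^ 2 ≤ η / 2 * ‖h‖ := by
    rw [← sq_abs]
    nlinarith [abs_nonneg t, mul_le_mul htM htM (abs_nonneg t) (by positivity)]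
  have hsplit : phase A y h - 1 - Complex.I * ((inner ℝ (A y) h : ℝ) : ℂ) =
      (phase A y h - 1 - Complex.I * (t : ℂ)) +
        Complex.I * ((inner ℝ h (A m - A y) : ℝ) : ℂ) := by
    rw [inner_sub_right, ← ht, real_inner_comm h (A y)]
    push_cast
    ring
  rw [hsplit]
  refine (norm_add_le _ _).trans ?_
  have h5 : ‖Complex.I * ((inner ℝ h (A m - A y) : ℝ) : ℂ)‖ ≤ η / 2 * ‖h‖ := by
    rw [norm_mul, Complex.norm_I, one_mul, Complex.norm_real]
    refine (norm_inner_le_norm _ _).trans ?_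
    rw [mul_comm]
    exact mul_le_mul_of_nonneg_right hdist hn
  linarith

theorem magDiff_re_sub (A : Euc N → Euc N) (u : Euc N → ℂ) (y h : Euc N) :
    (magDiff A u y h).re - bvDiff (fun x => (u x).re) (reField A u) h y =
      -((phase A y h - 1 - Complex.I * ((inner ℝ (A y) h : ℝ) : ℂ)) * u y).re := by
  simp only [magDiff, bvDiff, reField, inner_smul_left]
  simp
  ring

theorem magDiff_im_sub (A : Euc N → Euc N) (u : Euc N → ℂ) (y h : Euc N) :
    (magDiff A u y h).im - bvDiff (fun x => (u x).im) (imField A u) h y =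
      -((phase A y h - 1 - Complex.I * ((inner ℝ (A y) h : ℝ) : ℂ)) * u y).im := by
  simp only [magDiff, bvDiff, imField, inner_neg_left, inner_smul_left]
  simp
  ring

theorem eLpNorm_translate_polar_le {p : ℝ} (hp : 1 ≤ p) {u : Euc N → ℂ} (hu : Measurable u)
    (Ω : Set (Euc N)) (r : ℝ) :
    eLpNorm (fun z : Metric.sphere (0 : Euc N) 1 × Euc N => u (z.2 + r • (z.1 : Euc N)))
      (ENNReal.ofReal p) (polarMeasure Ω) ≤
      ((volume : Measure (Euc N)).toSphere univ) ^ (1 / p) *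
        eLpNorm u (ENNReal.ofReal p) volume := by
  have hp0 : 0 < p := by linarith
  have hm : Measurable fun z : Metric.sphere (0 : Euc N) 1 × Euc N =>
      u (z.2 + r • (z.1 : Euc N)) := hu.comp (by fun_prop)
  rw [← ENNReal.rpow_le_rpow_iff hp0, ENNReal.mul_rpow_of_nonneg _ _ hp0.le, ← ENNReal.rpow_mul,
    one_div_mul_cancel hp0.ne', ENNReal.rpow_one, eLpNorm_rpow_eq hp, eLpNorm_rpow_eq hp,
    lintegral_prod _ (hm.enorm.pow_const _).aemeasurable, mul_comm, ← lintegral_const]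
  refine lintegral_mono fun θ => (setLIntegral_le_lintegral _ _).trans_eq ?_
  exact lintegral_add_right_eq_self (fun x => ‖u x‖ₑ ^ p) (r • (θ : Euc N))

theorem eLpNorm_polar_snd_le {p : ℝ} (hp : 1 ≤ p) {u : Euc N → ℂ} (hu : Measurable u)
    (Ω : Set (Euc N)) :
    eLpNorm (fun z : Metric.sphere (0 : Euc N) 1 × Euc N => u z.2)
      (ENNReal.ofReal p) (polarMeasure Ω) ≤
      ((volume : Measure (Euc N)).toSphere univ) ^ (1 / p) *
        eLpNorm u (ENNReal.ofReal p) volume := by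
  simpa using eLpNorm_translate_polar_le hp hu Ω 0

theorem norm_phase (A : Euc N → Euc N) (y h : Euc N) : ‖phase A y h‖ = 1 := by
  rw [phase, mul_comm]
  exact Complex.norm_exp_ofReal_mul_I _

theorem norm_magDiff_le (A : Euc N → Euc N) (u : Euc N → ℂ) (y h : Euc N) :
    ‖magDiff A u y h‖ ≤ ‖u (y + h)‖ + ‖u y‖ := by
  refine (norm_sub_le _ _).trans ?_
  rw [norm_mul, norm_phase, one_mul]

/-- The limit for one real component `P ∘ magDiff` of the magnetic increment, from the limit for
its linearization. -/
theorem tendsto_component (hN : N ≠ 0) {A : Euc N → Euc N} (hA : Continuous A) {p : ℝ}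
    (hp : 1 ≤ p) {Ω : Set (Euc N)} (hΩ : IsOpen Ω) (hb : Bornology.IsBounded Ω) {u : Euc N → ℂ}
    (hu : Measurable u) (hup : MemLp u (ENNReal.ofReal p) volume) {P : ℂ → ℝ}
    (hPm : Measurable P) (hP : ∀ z, |P z| ≤ ‖z‖) {v : Euc N → ℝ} {f : Euc N → Euc N}
    (hvm : Measurable v) (hfm : Measurable f)
    (hPd : ∀ y h, P (magDiff A u y h) - bvDiff v f h y =
      -P ((phase A y h - 1 - Complex.I * ((inner ℝ (A y) h : ℝ) : ℂ)) * u y)) {ℓ : ℝ≥0∞}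
    (hlim : Tendsto (fun r => eLpNorm (radialQuot Ω (fun y h => bvDiff v f h y) r)
      (ENNReal.ofReal p) (polarMeasure Ω)) (𝓝[>] 0) (𝓝 ℓ)) :
    Tendsto (fun s : ℝ => ENNReal.ofReal (1 - s) * ∫⁻ y in Ω, ∫⁻ x in Ω,
      ENNReal.ofReal (|P (magDiff A u y (x - y))| ^ p / ‖x - y‖ ^ ((N : ℝ) + p * s))) (𝓝[<] 1)
      (𝓝 (ℓ ^ p / ENNReal.ofReal p)) := by
  have hp0 : 0 < p := by linarith
  have hpE : (1 : ℝ≥0∞) ≤ ENNReal.ofReal p := by simpa using hp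
  have hwm : Measurable (Function.uncurry fun y h => P (magDiff A u y h)) :=
    hPm.comp (measurable_uncurry_magDiff hA hu)
  have hbm := measurable_uncurry_bvDiff hvm hfm
  set D := ((volume : Measure (Euc N)).toSphere univ) ^ (1 / p) *
        eLpNorm u (ENNReal.ofReal p) volume with hD
  have hDt : D ≠ ⊤ := ENNReal.mul_ne_top
    (ENNReal.rpow_ne_top_of_nonneg (by positivity) (measure_ne_top _ _)) hup.eLpNorm_ne_top
  have hmemΩ : ∀ᵐ z ∂(polarMeasure Ω), z.2 ∈ Ω :=
    (Measure.quasiMeasurePreserving_snd (μ := (volume : Measure (Euc N)).toSphere)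
      (ν := volume.restrict Ω)).ae (ae_restrict_mem hΩ.measurableSet)
  refine tendsto_gagliardo_of_radial hN hp hΩ.measurableSet hb
    -- The phase has modulus 1, so the increment is at most |u(y+h)| + |u(y)|, and each term has
    -- polar norm at most D. This gives the crude bound 2D/r.
    (w := fun y h => P (magDiff A u y h)) hwm (C := D + D) (ENNReal.add_ne_top.2 ⟨hDt, hDt⟩) ?_ ?_
  · intro r hr
    have m1 : Measurable fun z : Metric.sphere (0 : Euc N) 1 × Euc N =>
        ‖u (z.2 + r • (z.1 : Euc N))‖ := (hu.comp (by fun_prop)).norm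
    have m2 : Measurable fun z : Metric.sphere (0 : Euc N) 1 × Euc N => ‖u z.2‖ :=
      (hu.comp (by fun_prop)).norm
    have hae : ∀ᵐ z ∂(polarMeasure Ω), ‖radialQuot Ω (fun y h => P (magDiff A u y h)) r z‖ ≤
        r⁻¹ * ‖((fun z : Metric.sphere (0 : Euc N) 1 × Euc N =>
          ‖u (z.2 + r • (z.1 : Euc N))‖) + fun z : Metric.sphere (0 : Euc N) 1 × Euc N => ‖u z.2‖) z‖ := by
      refine ae_of_all _ fun z => ?_
      have hn : 0 ≤ ‖u (z.2 + r • (z.1 : Euc N))‖ + ‖u z.2‖ := by positivity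
      rw [Pi.add_apply, Real.norm_of_nonneg hn, radialQuot]
      split_ifs
      · rw [norm_mul, Real.norm_of_nonneg (inv_nonneg.2 hr.le)]
        exact mul_le_mul_of_nonneg_left ((hP _).trans (norm_magDiff_le A u _ _))
          (inv_nonneg.2 hr.le)
      · rw [norm_zero]
        exact mul_nonneg (inv_nonneg.2 hr.le) hn
    refine (eLpNorm_le_mul_eLpNorm_of_ae_le_mul hae _).trans ?_
    rw [mul_comm, ENNReal.ofReal_inv_of_pos hr]
    refine mul_le_mul' ?_ le_rfl
    refine (eLpNorm_add_le m1.aestronglyMeasurable m2.aestronglyMeasurable hpE).trans ?_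
    rw [eLpNorm_norm, eLpNorm_norm]
    exact add_le_add (eLpNorm_translate_polar_le hp hu Ω r) (eLpNorm_polar_snd_le hp hu Ω)
  · refine tendsto_eLpNorm_of_tendsto_sub hpE
      (fun r => (measurable_radialQuot hΩ.measurableSet hbm r).aestronglyMeasurable)
      (fun r => (measurable_radialQuot hΩ.measurableSet hwm r).aestronglyMeasurable) hlim ?_
    -- The phase error is at most η r |u(y)| pointwise, and division by r leaves η |u(y)|.
    have hbound : ∀ η > 0, ∀ᶠ r in 𝓝[>] (0 : ℝ),
        eLpNorm (radialQuot Ω (fun y h => P (magDiff A u y h)) r -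
          radialQuot Ω (fun y h => bvDiff v f h y) r) (ENNReal.ofReal p) (polarMeasure Ω) ≤
          ENNReal.ofReal η * D := by
      intro η hη
      obtain ⟨δ, hδ, hph⟩ := exists_norm_phase_sub_le hA hb hη
      filter_upwards [nhdsWithin_le_nhds (Iio_mem_nhds hδ), self_mem_nhdsWithin]
        with r (hrδ : r < δ) (hr : 0 < r)
      have hae : ∀ᵐ z ∂(polarMeasure Ω), ‖radialQuot Ω
          (fun y h => P (magDiff A u y h) - bvDiff v f h y) r z‖ ≤ η * ‖u z.2‖ := by
        filter_upwards [hmemΩ] with z hz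
        rw [radialQuot]
        split_ifs
        · have hrθ : ‖r • (z.1 : Euc N)‖ = r := by
            rw [norm_smul, Real.norm_of_nonneg hr.le]; simp
          rw [hPd, norm_mul, norm_neg, Real.norm_of_nonneg (inv_nonneg.2 hr.le)]
          have h1 := hph z.2 hz (r • (z.1 : Euc N)) (by rwa [hrθ])
          rw [hrθ] at h1
          rw [inv_mul_le_iff₀ hr]
          refine (hP _).trans ?_
          rw [norm_mul]
          refine (mul_le_mul_of_nonneg_right h1 (norm_nonneg _)).trans_eq ?_
          ring
        · rw [norm_zero]
          exact mul_nonneg hη.le (norm_nonneg _)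
      rw [radialQuot_sub]
      exact (eLpNorm_le_mul_eLpNorm_of_ae_le_mul hae _).trans
        (mul_le_mul' le_rfl (eLpNorm_polar_snd_le hp hu Ω))
    rw [ENNReal.tendsto_nhds_zero]
    intro ε hε
    have hz : Tendsto (fun η : ℝ => ENNReal.ofReal η * D) (𝓝[>] 0) (𝓝 (ENNReal.ofReal 0 * D)) :=
      ENNReal.Tendsto.mul_const (ENNReal.tendsto_ofReal
        (tendsto_id.mono_left nhdsWithin_le_nhds)) (Or.inr hDt)
    rw [ENNReal.ofReal_zero, zero_mul] at hz
    obtain ⟨η, h1, h2⟩ := ((hz.eventually_lt_const hε).and self_mem_nhdsWithin).exists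
    filter_upwards [hbound η h2] with r hr
    exact hr.trans h1.le

theorem tendsto_gagliardo_of_components (hN : N ≠ 0) {A : Euc N → Euc N} (hA : Continuous A)
    {p : ℝ} (hp : 1 ≤ p) {Ω : Set (Euc N)} (hΩ : IsOpen Ω) (hb : Bornology.IsBounded Ω)
    {u : Euc N → ℂ} (hu : Measurable u) (hup : MemLp u (ENNReal.ofReal p) volume) {ℓ₁ ℓ₂ : ℝ≥0∞}
    (h₁ : Tendsto (fun r => eLpNorm (radialQuot Ω
      (fun y h => bvDiff (fun x => (u x).re) (reField A u) h y) r) (ENNReal.ofReal p)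
      (polarMeasure Ω)) (𝓝[>] 0) (𝓝 ℓ₁))
    (h₂ : Tendsto (fun r => eLpNorm (radialQuot Ω
      (fun y h => bvDiff (fun x => (u x).im) (imField A u) h y) r) (ENNReal.ofReal p)
      (polarMeasure Ω)) (𝓝[>] 0) (𝓝 ℓ₂)) :
    Tendsto (fun s : ℝ => ENNReal.ofReal (1 - s) * gagliardo A p s Ω u) (𝓝[<] 1)
      (𝓝 (ℓ₁ ^ p / ENNReal.ofReal p + ℓ₂ ^ p / ENNReal.ofReal p)) := by
  have hre : Measurable fun x => (u x).re := Complex.measurable_re.comp hu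
  have him : Measurable fun x => (u x).im := Complex.measurable_im.comp hu
  simp_rw [gagliardo_eq_add hA hu hp, mul_add]
  refine Tendsto.add ?_ ?_
  · exact tendsto_component hN hA hp hΩ hb hu hup Complex.measurable_re Complex.abs_re_le_norm hre
      (him.smul hA.measurable) (magDiff_re_sub A u) h₁
  · exact tendsto_component hN hA hp hΩ hb hu hup Complex.measurable_im Complex.abs_im_le_norm him
      (hre.smul hA.measurable).neg (magDiff_im_sub A u) h₂

end Phase

/-! ### The BV case. -/

section BoundedVariation
variable {N : ℕ}

theorem gagliardo_congr (A : Euc N → Euc N) (p s : ℝ) {Ω : Set (Euc N)} {u u' : Euc N → ℂ}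
    (h : u =ᵐ[volume.restrict Ω] u') : gagliardo A p s Ω u = gagliardo A p s Ω u' := by
  refine lintegral_congr_ae ?_
  filter_upwards [h] with y hy
  refine lintegral_congr_ae ?_
  filter_upwards [h] with x hx
  rw [hx, hy]

theorem variationRe_congr (A : Euc N → Euc N) {U : Set (Euc N)} {u u' : Euc N → ℂ}
    (h : u =ᵐ[volume.restrict U] u') : variationRe A u U = variationRe A u' U := by
  refine iSup_congr fun φ => iSup_congr fun _ => congrArg ENNReal.ofReal (integral_congr_ae ?_)
  filter_upwards [h] with x hx
  rw [hx]

theorem variationIm_congr (A : Euc N → Euc N) {U : Set (Euc N)} {u u' : Euc N → ℂ}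
    (h : u =ᵐ[volume.restrict U] u') : variationIm A u U = variationIm A u' U := by
  refine iSup_congr fun φ => iSup_congr fun _ => congrArg ENNReal.ofReal (integral_congr_ae ?_)
  filter_upwards [h] with x hx
  rw [hx]

/-- Test fields vanish outside U, so the integral over U may be taken over the whole space and the
pairing no longer depends on U. -/
theorem variationRe_eq_bvVar (A : Euc N → Euc N) (u : Euc N → ℂ) (U : Set (Euc N)) :
    variationRe A u U = bvVar (fun x => (u x).re) (reField A u) U := by
  refine iSup_congr fun φ => iSup_congr fun hφ => congrArg ENNReal.ofReal ?_
  rw [setIntegral_eq_integral_of_forall_compl_eq_zero, bvPairing]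
  · refine integral_congr_ae (ae_of_all _ fun x => ?_)
    simp only [reField, inner_smul_left]
    simp [mul_comm]
  · intro x hx
    have hx' : x ∉ tsupport φ := fun h => hx (hφ.2.2.1 h)
    simp [divergence_eq_zero_of_notMem hx', image_eq_zero_of_notMem_tsupport hx']

theorem variationIm_eq_bvVar (A : Euc N → Euc N) (u : Euc N → ℂ) (U : Set (Euc N)) :
    variationIm A u U = bvVar (fun x => (u x).im) (imField A u) U := by
  refine iSup_congr fun φ => iSup_congr fun hφ => congrArg ENNReal.ofReal ?_
  rw [setIntegral_eq_integral_of_forall_compl_eq_zero, bvPairing]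
  · refine integral_congr_ae (ae_of_all _ fun x => ?_)
    simp only [imField, inner_neg_left, inner_smul_left]
    simp [mul_comm]
  · intro x hx
    have hx' : x ∉ tsupport φ := fun h => hx (hφ.2.2.1 h)
    simp [divergence_eq_zero_of_notMem hx', image_eq_zero_of_notMem_tsupport hx']

/-- A is only known to be bounded on bounded sets, so u is required to vanish outside one. -/
theorem memLp_fields {A : Euc N → Euc N} (hA : Continuous A) {S : Set (Euc N)}
    (hS : Bornology.IsBounded S) {u : Euc N → ℂ} (hu : Measurable u) (hu0 : ∀ x ∉ S, u x = 0)
    {q : ℝ≥0∞} (hup : MemLp u q volume) :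
    MemLp (reField A u) q volume ∧ MemLp (imField A u) q volume := by
  obtain ⟨R, hR⟩ := hS.subset_closedBall (0 : Euc N)
  obtain ⟨M, hM⟩ := (isCompact_closedBall (0 : Euc N) R).exists_bound_of_continuousOn
    hA.continuousOn
  have key : ∀ x, ∀ t : ℝ, |t| ≤ ‖u x‖ → ‖t • A x‖ ≤ M * ‖u x‖ := by
    intro x t ht
    rw [norm_smul, mul_comm]
    by_cases hx : x ∈ S
    · exact mul_le_mul (hM x (hR hx)) ht (norm_nonneg _) ((norm_nonneg _).trans (hM x (hR hx)))
    · rw [hu0 x hx, norm_zero] at ht ⊢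
      rw [abs_nonpos_iff.1 ht]
      simp
  constructor
  · exact hup.of_le_mul ((Complex.measurable_im.comp hu).smul hA.measurable).aestronglyMeasurable
      (ae_of_all _ fun x => key x _ (Complex.abs_im_le_norm _))
  · refine hup.of_le_mul (c := M)
      ((Complex.measurable_re.comp hu).smul hA.measurable).neg.aestronglyMeasurable
      (ae_of_all _ fun x => ?_)
    rw [imField, norm_neg]
    exact key x _ (Complex.abs_re_le_norm _)

theorem tendsto_gagliardo_of_memBV {A : Euc N → Euc N} (hA : Continuous A) {e : Euc N}
    (he : ‖e‖ = 1) {Ω : Set (Euc N)} (hb : Bornology.IsBounded Ω) (hΩ : IsExtensionDomain A Ω)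
    {u : Euc N → ℂ} (hu : MemBV A Ω u) :
    Tendsto (fun s : ℝ => ENNReal.ofReal (1 - s) * gagliardo A 1 s Ω u) (𝓝[<] 1)
      (𝓝 (ENNReal.ofReal (bbmConst 1 e) * variation A u Ω)) := by
  have hN : N ≠ 0 := by
    rintro rfl
    simp [Subsingleton.elim e 0] at he
  obtain ⟨hΩo, -, hT⟩ := hΩ
  -- A bounded W forces the extension to have bounded support, which makes A times the extension
  -- integrable.
  obtain ⟨R, hR⟩ := hb.closure.subset_ball (0 : Euc N)
  set W := Metric.ball (0 : Euc N) R with hW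
  obtain ⟨T, hop, hTu⟩ := hT W Metric.isOpen_ball hR
  obtain ⟨hT0, hTvar⟩ := hTu u hu
  have hL := (hop.memBV u hu).1
  rw [Measure.restrict_univ] at hL
  set t := hL.aestronglyMeasurable.mk (T u) with ht
  set u' : Euc N → ℂ := W.indicator t with hu'
  have hWm : MeasurableSet W := Metric.isOpen_ball.measurableSet
  have hu's : StronglyMeasurable u' :=
    hL.aestronglyMeasurable.stronglyMeasurable_mk.indicator hWm
  have huT : T u =ᵐ[volume] u' := by
    rw [ae_restrict_iff' hWm.compl] at hT0
    filter_upwards [hL.aestronglyMeasurable.ae_eq_mk, hT0] with x h1 h2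
    rw [← ht] at h1
    by_cases hx : x ∈ W
    · rw [hu', indicator_of_mem hx, h1]
    · rw [hu', indicator_of_notMem hx, h2 hx]
  have hu'L : MemLp u' 1 volume := (memLp_congr_ae huT).1 hL
  have huu' : u =ᵐ[volume.restrict Ω] u' := by
    filter_upwards [hop.extends_ae u hu, ae_restrict_of_ae huT] with x h1 h2
    rw [← h1, h2]
  have hu'i : Integrable u' := memLp_one_iff_integrable.1 hu'L
  obtain ⟨hf1, hf2⟩ := memLp_fields hA Metric.isBounded_ball hu's.measurable
    (fun x hx => indicator_of_notMem hx t) hu'L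
  rw [variationMeas, add_eq_zero] at hTvar
  have hfr1 : ∀ η > 0, ∃ U, IsOpen U ∧ frontier Ω ⊆ U ∧
      bvVar (fun x => (u' x).re) (reField A u') U ≤ η := by
    intro η hη
    have := hTvar.1.trans_lt hη
    simp only [iInf_lt_iff] at this
    obtain ⟨U, hU, hlt⟩ := this
    refine ⟨U, hU.1, hU.2.1, ?_⟩
    rw [← variationRe_eq_bvVar, ← variationRe_congr A (ae_restrict_of_ae huT)]
    exact hlt.le
  have hfr2 : ∀ η > 0, ∃ U, IsOpen U ∧ frontier Ω ⊆ U ∧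
      bvVar (fun x => (u' x).im) (imField A u') U ≤ η := by
    intro η hη
    have := hTvar.2.trans_lt hη
    simp only [iInf_lt_iff] at this
    obtain ⟨U, hU, hlt⟩ := this
    refine ⟨U, hU.1, hU.2.1, ?_⟩
    rw [← variationIm_eq_bvVar, ← variationIm_congr A (ae_restrict_of_ae huT)]
    exact hlt.le
  have hre : Measurable fun x => (u' x).re := Complex.measurable_re.comp hu's.measurable
  have him : Measurable fun x => (u' x).im := Complex.measurable_im.comp hu's.measurable
  have h1 := tendsto_radialQuot_bvDiff he (f := reField A u') hre.stronglyMeasurable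
    (him.smul hA.measurable).stronglyMeasurable hu'i.re (memLp_one_iff_integrable.1 hf1) hΩo hb hfr1
  have h2 := tendsto_radialQuot_bvDiff he (f := imField A u') him.stronglyMeasurable
    (hre.smul hA.measurable).neg.stronglyMeasurable hu'i.im (memLp_one_iff_integrable.1 hf2) hΩo hb
    hfr2
  rw [← ENNReal.ofReal_one] at h1 h2 hu'L
  have := tendsto_gagliardo_of_components hN hA le_rfl hΩo hb hu's.measurable hu'L h1 h2
  simp only [ENNReal.rpow_one, ENNReal.ofReal_one, div_one] at this
  rw [← mul_add, ← variationRe_eq_bvVar, ← variationIm_eq_bvVar] at this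
  rw [variation, variationRe_congr A huu', variationIm_congr A huu']
  simpa only [gagliardo_congr A 1 _ huu'] using this

end BoundedVariation

/-! ### The Sobolev case. -/

section Sobolev
variable {N : ℕ}

/-- The vector of real parts. -/
def reVec (z : EuclideanSpace ℂ (Fin N)) : Euc N := WithLp.toLp 2 fun i => (z i).re

/-- The vector of imaginary parts. -/
def imVec (z : EuclideanSpace ℂ (Fin N)) : Euc N := WithLp.toLp 2 fun i => (z i).im

theorem continuous_reVec : Continuous (reVec : EuclideanSpace ℂ (Fin N) → Euc N) := by
  unfold reVec
  fun_prop

theorem continuous_imVec : Continuous (imVec : EuclideanSpace ℂ (Fin N) → Euc N) := by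
  unfold imVec
  fun_prop

theorem integrable_mul_test {Ω : Set (Euc N)} {f : Euc N → ℂ} (hf : LocallyIntegrableOn f Ω)
    {ψ : Euc N → ℝ} (hψ : Continuous ψ) (hψc : HasCompactSupport ψ) (hψΩ : tsupport ψ ⊆ Ω) :
    Integrable fun x => f x * ((ψ x : ℝ) : ℂ) := by
  obtain ⟨C, hC⟩ := hψc.exists_bound_of_continuous hψ
  have h1 : IntegrableOn f (tsupport ψ) := hf.integrableOn_compact_subset hψΩ hψc
  have h2 : IntegrableOn (fun x => f x * ((ψ x : ℝ) : ℂ)) (tsupport ψ) :=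
    Integrable.mul_bdd (c := C) h1 (by fun_prop) (ae_of_all _ fun x => by simpa using hC x)
  refine (integrableOn_iff_integrable_of_support_subset fun x hx => ?_).1 h2
  by_contra h
  exact hx (by simp [image_eq_zero_of_notMem_tsupport h])

theorem locallyIntegrableOn_apply {Ω : Set (Euc N)} {g : Euc N → EuclideanSpace ℂ (Fin N)}
    (hg : LocallyIntegrableOn g Ω) (i : Fin N) : LocallyIntegrableOn (fun x => g x i) Ω := by
  intro x hx
  obtain ⟨t, ht, hti⟩ := hg x hx
  exact ⟨t, ht, (EuclideanSpace.proj i : EuclideanSpace ℂ (Fin N) →L[ℂ] ℂ).integrable_comp hti⟩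

/-- Membership in the magnetic Sobolev space bounds the energy of some weak gradient; uniqueness
transfers the bound to the given one. -/
theorem HasWeakGradient.ae_eq {Ω : Set (Euc N)} (hΩ : IsOpen Ω) {u : Euc N → ℂ}
    {g g' : Euc N → EuclideanSpace ℂ (Fin N)} (h : HasWeakGradient Ω u g)
    (h' : HasWeakGradient Ω u g') : g =ᵐ[volume.restrict Ω] g' := by
  have key : ∀ i : Fin N, ∀ᵐ x ∂(volume : Measure (Euc N)), x ∈ Ω → g x i - g' x i = 0 := by
    intro i
    have hi := locallyIntegrableOn_apply h.2.1 i
    have hi' := locallyIntegrableOn_apply h'.2.1 i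
    refine hΩ.ae_eq_zero_of_integral_contDiff_smul_eq_zero (hi.sub hi') fun φ hφ hφc hφΩ => ?_
    have h1 := integrable_mul_test hi hφ.continuous hφc hφΩ
    have h2 := integrable_mul_test hi' hφ.continuous hφc hφΩ
    have e := h.2.2 φ hφ hφc hφΩ i
    rw [h'.2.2 φ hφ hφc hφΩ i, neg_inj,
      setIntegral_eq_integral_of_forall_compl_eq_zero fun x hx => by
        simp [image_eq_zero_of_notMem_tsupport fun hx' => hx (hφΩ hx')],
      setIntegral_eq_integral_of_forall_compl_eq_zero fun x hx => by
        simp [image_eq_zero_of_notMem_tsupport fun hx' => hx (hφΩ hx')]] at e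
    calc ∫ x, φ x • ((fun x => g x i) - fun x => g' x i) x
        = ∫ x, (g x i * ((φ x : ℝ) : ℂ) - g' x i * ((φ x : ℝ) : ℂ)) := by
          refine integral_congr_ae (ae_of_all _ fun x => ?_)
          simp only [Pi.sub_apply, Complex.real_smul]
          ring
      _ = 0 := by rw [integral_sub h1 h2, e, sub_self]
  rw [Filter.EventuallyEq, ae_restrict_iff' hΩ.measurableSet]
  filter_upwards [ae_all_iff.2 key] with x hx hxΩ
  ext i
  exact sub_eq_zero.1 (hx i hxΩ)

theorem fderiv_apply_eq_sum (φ : Euc N → ℝ) (x a : Euc N) :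
    fderiv ℝ φ x a = ∑ i, a i * fderiv ℝ φ x (EuclideanSpace.single i 1) := by
  have ha : a = ∑ i, a i • (EuclideanSpace.single i (1 : ℝ) : Euc N) := by
    ext j
    simp [Finset.sum_apply, Pi.single_apply]
  conv_lhs => rw [ha]
  simp [map_sum]

theorem tsupport_fderiv_apply_subset (φ : Euc N → ℝ) (a : Euc N) :
    tsupport (fun x => fderiv ℝ φ x a) ⊆ tsupport φ := by
  refine closure_minimal (fun x hx => ?_) (isClosed_tsupport _)
  refine support_fderiv_subset ℝ (f := φ) ?_
  intro h
  exact hx (by simp [h])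

/-- A real linear functional `L` on `ℂ`, such as the real or the imaginary part, maps weak gradients to
weak gradients. -/
theorem HasWeakGradient.isWeakGrad {Ω : Set (Euc N)} {u : Euc N → ℂ}
    {g : Euc N → EuclideanSpace ℂ (Fin N)} (h : HasWeakGradient Ω u g) (L : ℂ →L[ℝ] ℝ) :
    IsWeakGrad Ω (fun x => L (u x)) (fun x => WithLp.toLp 2 fun i => L (g x i)) := by
  intro φ hφ hφc hφΩ a
  have hsm : ∀ (z : ℂ) (t : ℝ), L (z * (t : ℂ)) = L z * t := by
    intro z t
    rw [mul_comm, ← Complex.real_smul, map_smul, smul_eq_mul, mul_comm]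
  have hd : ∀ i, Continuous fun x => fderiv ℝ φ x (EuclideanSpace.single i 1) := fun i =>
    (hφ.continuous_fderiv (by simp)).clm_apply continuous_const
  have hdc : ∀ i, HasCompactSupport fun x => fderiv ℝ φ x (EuclideanSpace.single i 1) := fun i =>
    hφc.of_isClosed_subset (isClosed_tsupport _) (tsupport_fderiv_apply_subset φ _)
  have hiu : ∀ i, Integrable fun x =>
      u x * ((fderiv ℝ φ x (EuclideanSpace.single i 1) : ℝ) : ℂ) := fun i =>
    integrable_mul_test h.1 (hd i) (hdc i) ((tsupport_fderiv_apply_subset φ _).trans hφΩ)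
  have hig : ∀ i, Integrable fun x => g x i * ((φ x : ℝ) : ℂ) := fun i =>
    integrable_mul_test (locallyIntegrableOn_apply h.2.1 i) hφ.continuous hφc hφΩ
  have key : ∀ i, ∫ x, L (u x) * fderiv ℝ φ x (EuclideanSpace.single i 1) =
      -∫ x, L (g x i) * φ x := by
    intro i
    have e := h.2.2 φ hφ hφc hφΩ i
    rw [setIntegral_eq_integral_of_forall_compl_eq_zero fun x hx => by
        have : fderiv ℝ φ x (EuclideanSpace.single i 1) = 0 :=
          image_eq_zero_of_notMem_tsupport (f := fun x => fderiv ℝ φ x (EuclideanSpace.single i 1))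
          fun hx' => hx (hφΩ (tsupport_fderiv_apply_subset φ _ hx'))
        simp [this],
      setIntegral_eq_integral_of_forall_compl_eq_zero fun x hx => by
        simp [image_eq_zero_of_notMem_tsupport fun hx' => hx (hφΩ hx')]] at e
    have e' := congrArg L e
    rw [map_neg, ← L.integral_comp_comm (hiu i), ← L.integral_comp_comm (hig i)] at e'
    simpa only [hsm] using e'
  have hiu' : ∀ i, Integrable fun x => L (u x) * fderiv ℝ φ x (EuclideanSpace.single i 1) := by
    intro i
    simpa only [hsm] using L.integrable_comp (hiu i)
  have hig' : ∀ i, Integrable fun x => L (g x i) * φ x := by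
    intro i
    simpa only [hsm] using L.integrable_comp (hig i)
  calc ∫ x, L (u x) * fderiv ℝ φ x a
      = ∫ x, ∑ i, a i * (L (u x) * fderiv ℝ φ x (EuclideanSpace.single i 1)) := by
        refine integral_congr_ae (ae_of_all _ fun x => ?_)
        simp only [fderiv_apply_eq_sum φ x a, Finset.mul_sum]
        exact Finset.sum_congr rfl fun i _ => by ring
    _ = ∑ i, a i * -∫ x, L (g x i) * φ x := by
        rw [integral_finsetSum _ fun i _ => (hiu' i).const_mul _]
        exact Finset.sum_congr rfl fun i _ => by rw [integral_const_mul, key i]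
    _ = -∫ x, ∑ i, a i * (L (g x i) * φ x) := by
        rw [integral_finsetSum _ fun i _ => (hig' i).const_mul _, ← Finset.sum_neg_distrib]
        exact Finset.sum_congr rfl fun i _ => by rw [integral_const_mul]; ring
    _ = _ := by
        congr 1
        refine integral_congr_ae (ae_of_all _ fun x => ?_)
        simp only [PiLp.inner_apply, Finset.sum_mul]
        refine Finset.sum_congr rfl fun i _ => ?_
        simp
        ring

theorem IsWeakGrad.congr {Ω : Set (Euc N)} (hΩ : MeasurableSet Ω) {v v' : Euc N → ℝ}
    {g g' : Euc N → Euc N} (h : IsWeakGrad Ω v g) (hv : v =ᵐ[volume.restrict Ω] v')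
    (hg : g =ᵐ[volume.restrict Ω] g') : IsWeakGrad Ω v' g' := by
  intro φ hφ hφc hφΩ a
  rw [Filter.EventuallyEq, ae_restrict_iff' hΩ] at hv hg
  convert h φ hφ hφc hφΩ a using 1
  · refine integral_congr_ae ?_
    filter_upwards [hv] with x hx
    by_cases hxΩ : x ∈ Ω
    · rw [hx hxΩ]
    · have : fderiv ℝ φ x a = 0 := image_eq_zero_of_notMem_tsupport
          (f := fun x => fderiv ℝ φ x a) fun hx' => hxΩ (hφΩ (tsupport_fderiv_apply_subset φ _ hx'))
      simp [this]
  · congr 1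
    refine integral_congr_ae ?_
    filter_upwards [hg] with x hx
    by_cases hxΩ : x ∈ Ω
    · rw [hx hxΩ]
    · simp [image_eq_zero_of_notMem_tsupport fun hx' => hxΩ (hφΩ hx')]

theorem magEnergy_congr (A : Euc N → Euc N) (p : ℝ) {Ω : Set (Euc N)} {u u' : Euc N → ℂ}
    {g g' : Euc N → EuclideanSpace ℂ (Fin N)} (hu : u =ᵐ[volume.restrict Ω] u')
    (hg : g =ᵐ[volume.restrict Ω] g') : magEnergy A p Ω u g = magEnergy A p Ω u' g' := by
  refine lintegral_congr_ae ?_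
  filter_upwards [hu, hg] with x h1 h2
  simp only [magGrad, h1, h2]

/-- Since -iAu has real part (Im u)A and imaginary part -(Re u)A, the energy splits into the fields
g + f of the two real problems. -/
theorem magEnergy_eq_add {A : Euc N → Euc N} (hA : Measurable A) {p : ℝ} (hp : 1 ≤ p)
    (Ω : Set (Euc N)) {u : Euc N → ℂ} (hu : Measurable u)
    {g : Euc N → EuclideanSpace ℂ (Fin N)} (hg : Measurable g) :
    magEnergy A p Ω u g = (∫⁻ x in Ω, ‖reVec (g x) + reField A u x‖ₑ ^ p) +
      ∫⁻ x in Ω, ‖imVec (g x) + imField A u x‖ₑ ^ p := by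
  have hp0 : 0 < p := by linarith
  have hm : Measurable fun x => ‖reVec (g x) + reField A u x‖ₑ ^ p :=
    ((continuous_reVec.measurable.comp hg).add
      ((Complex.measurable_im.comp hu).smul hA)).enorm.pow_const _
  rw [← lintegral_add_left hm]
  refine lintegral_congr fun x => ?_
  have h1 : (WithLp.toLp 2 fun i => (magGrad A u g x i).re) = reVec (g x) + reField A u x := by
    ext i
    simp [magGrad, reVec, reField, mul_comm]
  have h2 : (WithLp.toLp 2 fun i => (magGrad A u g x i).im) = imVec (g x) + imField A u x := by
    ext i
    simp [magGrad, imVec, imField, mul_comm, sub_eq_add_neg]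
  rw [pNormVec, h1, h2, ← Real.rpow_mul (by positivity), one_div_mul_cancel hp0.ne', Real.rpow_one,
    ENNReal.ofReal_add (by positivity) (by positivity),
    ← ENNReal.ofReal_rpow_of_nonneg (norm_nonneg _) hp0.le,
    ← ENNReal.ofReal_rpow_of_nonneg (norm_nonneg _) hp0.le, ofReal_norm, ofReal_norm]

/-- Finite energy and f in L^p give g = (g + f) - f in L^p(Ω); as g vanishes outside Ω it lies in
L^p of the whole space, where translations are continuous. It need only be the gradient of v when
tested inside Ω. -/
theorem exists_tendsto_radialQuot_bvDiff {e : Euc N} (he : ‖e‖ = 1) {Ω : Set (Euc N)}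
    (hΩ : IsOpen Ω) (hb : Bornology.IsBounded Ω) (hL : HasLipschitzBoundary Ω) {v : Euc N → ℝ}
    {f g : Euc N → Euc N} (hvm : Measurable v) (hgm : Measurable g) (hfm : Measurable f)
    (hv : Integrable v) (hg0 : ∀ x ∉ Ω, g x = 0) (hvg : IsWeakGrad Ω v g) {p : ℝ} (hp : 1 ≤ p)
    (hfp : MemLp f (ENNReal.ofReal p) volume) (hE : ∫⁻ x in Ω, ‖g x + f x‖ₑ ^ p < ⊤) :
    ∃ ℓ : ℝ≥0∞, Tendsto (fun r => eLpNorm (radialQuot Ω (fun y h => bvDiff v f h y) r)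
      (ENNReal.ofReal p) (polarMeasure Ω)) (𝓝[>] 0) (𝓝 ℓ) ∧
      ℓ ^ p / ENNReal.ofReal p =
        ENNReal.ofReal (bbmConst p e) * ∫⁻ x in Ω, ‖g x + f x‖ₑ ^ p := by
  have hp0 : 0 < p := by linarith
  have hpE : (1 : ℝ≥0∞) ≤ ENNReal.ofReal p := by simpa using hp
  have hgf : MemLp (g + f) (ENNReal.ofReal p) (volume.restrict Ω) := by
    refine ⟨(hgm.add hfm).aestronglyMeasurable, ?_⟩
    rw [← ENNReal.rpow_lt_top_iff_of_pos hp0, eLpNorm_rpow_eq hp]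
    exact hE
  have hfΩ : MemLp f (ENNReal.ofReal p) (volume.restrict Ω) := hfp.restrict Ω
  have hgΩ : MemLp g (ENNReal.ofReal p) (volume.restrict Ω) := by
    simpa using hgf.sub hfΩ
  have hgi : Ω.indicator g = g := by
    ext1 x
    by_cases hx : x ∈ Ω
    · rw [indicator_of_mem hx]
    · rw [indicator_of_notMem hx, hg0 x hx]
  have hgp : MemLp g (ENNReal.ofReal p) volume := by
    rw [← hgi, memLp_indicator_iff_restrict hΩ.measurableSet]
    exact hgΩ
  have : IsFiniteMeasure (volume.restrict Ω) := ⟨by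
    rw [Measure.restrict_apply_univ]
    exact hb.measure_lt_top⟩
  have hg1 : Integrable g := by
    rw [← hgi, integrable_indicator_iff hΩ.measurableSet]
    exact hgΩ.integrable hpE
  refine ⟨_, tendsto_radialQuot_of_isWeakGrad hΩ hb hL hvm hgm hfm hv hg1 hvg hp hgp hfΩ, ?_⟩
  have h := eLpNorm_inner_polar_rpow hp he Ω (G := fun x => g x + f x) (hgm.add hfm)
  beta_reduce at h
  rw [h, mul_assoc, mul_div_assoc, ENNReal.mul_div_cancel (by simpa using hp0)
    ENNReal.ofReal_ne_top]

theorem tendsto_gagliardo_of_memMagSobolev {A : Euc N → Euc N} (hA : Continuous A) {e : Euc N}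
    (he : ‖e‖ = 1) {p : ℝ} (hp : 1 ≤ p) {Ω : Set (Euc N)} (hΩ : IsOpen Ω)
    (hb : Bornology.IsBounded Ω) (hL : HasLipschitzBoundary Ω) {u : Euc N → ℂ}
    (hu : MemMagSobolev A p Ω u) {g : Euc N → EuclideanSpace ℂ (Fin N)}
    (hg : HasWeakGradient Ω u g) :
    Tendsto (fun s : ℝ => ENNReal.ofReal (1 - s) * gagliardo A p s Ω u) (𝓝[<] 1)
      (𝓝 (ENNReal.ofReal (bbmConst p e) * magEnergy A p Ω u g)) := by
  have hN : N ≠ 0 := by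
    rintro rfl
    simp [Subsingleton.elim e 0] at he
  have hpE : (1 : ℝ≥0∞) ≤ ENNReal.ofReal p := by simpa using hp
  have hΩm := hΩ.measurableSet
  obtain ⟨huL, g₀, hg₀, hE⟩ := hu
  rw [← magEnergy_congr A p (ae_eq_refl u) (hg.ae_eq hΩ hg₀)] at hE
  have hum := huL.aestronglyMeasurable
  have hgm := hg.2.1.aestronglyMeasurable
  -- Measurable representatives extended by zero; neither the seminorm nor the energy sees values
  -- outside Ω.
  set u' : Euc N → ℂ := Ω.indicator (hum.mk u) with hu'
  set g' : Euc N → EuclideanSpace ℂ (Fin N) := Ω.indicator (hgm.mk g) with hg'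
  have hu'm : Measurable u' := hum.stronglyMeasurable_mk.measurable.indicator hΩm
  have hg'm : Measurable g' := hgm.stronglyMeasurable_mk.measurable.indicator hΩm
  have huu' : u =ᵐ[volume.restrict Ω] u' :=
    hum.ae_eq_mk.trans (indicator_ae_eq_restrict hΩm).symm
  have hgg' : g =ᵐ[volume.restrict Ω] g' :=
    hgm.ae_eq_mk.trans (indicator_ae_eq_restrict hΩm).symm
  have hu'0 : ∀ x ∉ Ω, u' x = 0 := fun x hx => indicator_of_notMem hx _
  have hg'0 : ∀ x ∉ Ω, g' x = 0 := fun x hx => indicator_of_notMem hx _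
  have hmkL : MemLp (hum.mk u) (ENNReal.ofReal p) (volume.restrict Ω) :=
    (memLp_congr_ae hum.ae_eq_mk).1 huL
  have hu'L : MemLp u' (ENNReal.ofReal p) volume := (memLp_indicator_iff_restrict hΩm).2 hmkL
  have : IsFiniteMeasure (volume.restrict Ω) := ⟨by
    rw [Measure.restrict_apply_univ]
    exact hb.measure_lt_top⟩
  have hu'i : Integrable u' := (integrable_indicator_iff hΩm).2 (hmkL.integrable hpE)
  obtain ⟨hf1, hf2⟩ := memLp_fields hA hb hu'm hu'0 hu'L
  rw [magEnergy_congr A p huu' hgg', magEnergy_eq_add hA.measurable hp Ω hu'm hg'm] at hE ⊢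
  have hre : Measurable fun x => (u' x).re := Complex.measurable_re.comp hu'm
  have him : Measurable fun x => (u' x).im := Complex.measurable_im.comp hu'm
  have hw1 : IsWeakGrad Ω (fun x => (u' x).re) (fun x => reVec (g' x)) :=
    (hg.isWeakGrad Complex.reCLM).congr hΩm (huu'.fun_comp Complex.re) (hgg'.fun_comp reVec)
  have hw2 : IsWeakGrad Ω (fun x => (u' x).im) (fun x => imVec (g' x)) :=
    (hg.isWeakGrad Complex.imCLM).congr hΩm (huu'.fun_comp Complex.im) (hgg'.fun_comp imVec)
  obtain ⟨ℓ₁, h1, h1'⟩ := exists_tendsto_radialQuot_bvDiff he hΩ hb hL (f := reField A u')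
    (g := fun x => reVec (g' x)) hre
    (continuous_reVec.measurable.comp hg'm) (him.smul hA.measurable) hu'i.re
    (fun x hx => by ext i; simp [hg'0 x hx, reVec]) hw1 hp hf1 ((le_self_add).trans_lt hE)
  obtain ⟨ℓ₂, h2, h2'⟩ := exists_tendsto_radialQuot_bvDiff he hΩ hb hL (f := imField A u')
    (g := fun x => imVec (g' x)) him
    (continuous_imVec.measurable.comp hg'm) (hre.smul hA.measurable).neg hu'i.im
    (fun x hx => by ext i; simp [hg'0 x hx, imVec]) hw2 hp hf2 ((le_add_self).trans_lt hE)
  have := tendsto_gagliardo_of_components hN hA hp hΩ hb hu'm hu'L h1 h2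
  rw [h1', h2', ← mul_add] at this
  simpa only [gagliardo_congr A p _ huu'] using this

end Sobolev
end MagneticBBM

theorem mainTheorem1 {N : ℕ} (A : MagneticBBM.Euc N → MagneticBBM.Euc N)
    (hA : ContDiff ℝ 2 A) (e : MagneticBBM.Euc N) (he : ‖e‖ = 1) :
    (∀ Ω : Set (MagneticBBM.Euc N), Bornology.IsBounded Ω →
      MagneticBBM.IsExtensionDomain A Ω →
      ∀ u : MagneticBBM.Euc N → ℂ, MagneticBBM.MemBV A Ω u →
        Tendsto (fun s : ℝ => ENNReal.ofReal (1 - s) * MagneticBBM.gagliardo A 1 s Ω u)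
          (𝓝[<] 1)
          (𝓝 (ENNReal.ofReal (MagneticBBM.bbmConst 1 e) * MagneticBBM.variation A u Ω))) ∧
    (∀ p : ℝ, 1 ≤ p → ∀ Ω : Set (MagneticBBM.Euc N), IsOpen Ω → Bornology.IsBounded Ω →
      MagneticBBM.HasLipschitzBoundary Ω →
      ∀ u : MagneticBBM.Euc N → ℂ, MagneticBBM.MemMagSobolev A p Ω u →
      ∀ g : MagneticBBM.Euc N → EuclideanSpace ℂ (Fin N),
        MagneticBBM.HasWeakGradient Ω u g →
        Tendsto (fun s : ℝ => ENNReal.ofReal (1 - s) * MagneticBBM.gagliardo A p s Ω u)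
          (𝓝[<] 1)
          (𝓝 (ENNReal.ofReal (MagneticBBM.bbmConst p e) *
            MagneticBBM.magEnergy A p Ω u g))) :=
  ⟨fun _ hb hΩ _ hu => MagneticBBM.tendsto_gagliardo_of_memBV hA.continuous he hb hΩ hu,
    fun _ hp _ hΩ hb hL _ hu _ hg =>
      MagneticBBM.tendsto_gagliardo_of_memMagSobolev hA.continuous he hp hΩ hb hL hu hg⟩
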